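/- Let $\mathcal H$ be a separable complex Hilbert space and let $\mathcal N$ be a continuous nest of projections on $\mathcal H$: a chain of closed subspaces, identified with the orthogonal projections onto them, which contains $0$ and $I$, is closed under arbitrary intersections and closed linear spans, and in which every $N$ is the closed span of $\{L\in\mathcal N: L<N\}$. Let $\operatorname{Alg}\mathcal N$ be the algebra of all bounded operators leaving every $N\in\mathcal N$ invariant. Let $\|\cdot\|_{ess}$ be the norm of $B(\mathcal H)$ modulo the compact operators. For $X\in\operatorname{Alg}\mathcal N$ and $N\in\mathcal N$ put $$e_N^+(X)=\lim_{M\downarrow N}\sup_{N<L<M}\|(M-L)X(M-L)\|_{ess},\qquad i_N^+(X)=\lim_{M\downarrow N}\|(M-N)X(M-N)\|\qquad(N<I),$$ $$e_N^-(X)=\lim_{M\uparrow N}\sup_{M<L<N}\|(L-M)X(L-M)\|_{ess},\qquad i_N^-(X)=\lim_{M\uparrow N}\|(N-M)X(N-M)\|\qquad(N>0),$$ with $e_I^+=i_I^+=0$ and $e_0^-=i_0^-=0$, and $j_N(X)=\lim_{M\downarrow N,\,L\uparrow N}\|(M-L)X(M-L)\|$ for $0<N<I$, $j_0=i_0^+$,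 $j_I=i_I^-$. The elementary seminorms at $N$ are $0$, $e_N^\pm$, $i_N^\pm$, $j_N$ and the pointwise maxima $a\vee b$ with $a\in\{e_N^+,i_N^+\}$ and $b\in\{e_N^-,i_N^-\}$. A diagonal seminorm function $\delta$ assigns to each $N\in\mathcal N$ an elementary seminorm $X\mapsto\delta_N(X)$ at $N$. A stable ideal is a two-sided ideal of $\operatorname{Alg}\mathcal N$ that is norm closed and invariant under all automorphisms of the algebra $\operatorname{Alg}\mathcal N$. An ideal is of compact character if $(N-M)K(N-M)$ is compact for each of its elements $K$ and all $0<M<N<I$ in $\mathcal N$. Let $\mathcal I$ be a stable ideal of $\operatorname{Alg}\mathcal N$ that is not of compact character, and let $\mathcal F$ be a set of diagonal seminorm functions that specifies $\mathcal I$: for every $X\in\operatorname{Alg}\mathcal N$, $X\in\mathcal I$ if and only if for every $\varepsilon>0$ there is $\delta\in\mathcal F$ with $\delta_N(X)<\varepsilon$ for all $N\in\mathcal N$. Then, for every $X\in\operatorname{Alg}\mathcal N$, the quotient norm of $X+\mathcal I$ in $\operatorname{Alg}\mathcal N/\mathcal I$ is $$\|X+\mathcal I\|=\inf_{\delta\in\mathcal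 F}\ \sup_{N\in\mathcal N}\delta_N(X).$$ -/

import Mathlib

noncomputable section

namespace NestAlgebra

/-- The essential norm of a bounded operator: its norm in the quotient of `B(H)` by the
compact operators. -/
def essNorm {H : Type*} [NormedAddCommGroup H] [InnerProductSpace ℂ H] (X : H →L[ℂ] H) : ℝ :=
  ‖(Submodule.Quotient.mk X : (H →L[ℂ] H) ⧸ compactOperator (RingHom.id ℂ) H H)‖

/-- A continuous nest: a chain of closed subspaces that contains `0` and the whole space,
is closed under arbitrary intersections and closed linear spans, and in which every member
is the closed span of its strict predecessors. The members are identified with the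
orthogonal projections onto them (see `proj`). -/
structure ContinuousNest (H : Type*) [NormedAddCommGroup H] [InnerProductSpace ℂ H]
    [CompleteSpace H] where
  carrier : Set (ClosedSubmodule ℂ H)
  isChain : IsChain (· ≤ ·) carrier
  bot_mem : ⊥ ∈ carrier
  top_mem : ⊤ ∈ carrier
  sInf_mem : ∀ S : Set (ClosedSubmodule ℂ H), S ⊆ carrier → sInf S ∈ carrier
  sSup_mem : ∀ S : Set (ClosedSubmodule ℂ H), S ⊆ carrier → sSup S ∈ carrier
  continuous : ∀ N ∈ carrier, sSup {L | L ∈ carrier ∧ L < N} = N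

namespace ContinuousNest

variable {H : Type*} [NormedAddCommGroup H] [InnerProductSpace ℂ H] [CompleteSpace H]

/-- The members of the nest, ordered by inclusion. -/
abbrev Elem (𝒩 : ContinuousNest H) : Type _ := {N : ClosedSubmodule ℂ H // N ∈ 𝒩.carrier}

/-- The orthogonal projection onto a member of the nest. -/
def proj {𝒩 : ContinuousNest H} (N : 𝒩.Elem) : H →L[ℂ] H :=
  haveI : CompleteSpace N.1.toSubmodule := N.1.isClosed.completeSpace_coe
  N.1.toSubmodule.starProjection

/-- The zero projection, as a member of the nest. -/
def zero (𝒩 : ContinuousNest H) : 𝒩.Elem := ⟨⊥, 𝒩.bot_mem⟩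

/-- The identity, as a member of the nest. -/
def one (𝒩 : ContinuousNest H) : 𝒩.Elem := ⟨⊤, 𝒩.top_mem⟩

/-- The nest algebra: all bounded operators that leave every member of the nest invariant. -/
def alg (𝒩 : ContinuousNest H) : Subalgebra ℂ (H →L[ℂ] H) where
  carrier := {X | ∀ N ∈ 𝒩.carrier, ∀ x ∈ N, X x ∈ N}
  mul_mem' := fun ha hb N hN x hx => ha N hN _ (hb N hN x hx)
  add_mem' := fun ha hb N hN x hx => add_mem (ha N hN x hx) (hb N hN x hx)
  algebraMap_mem' := fun r N _ x hx => by
    simpa [Algebra.algebraMap_eq_smul_one] using N.toSubmodule.smul_mem r hx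

variable {𝒩 : ContinuousNest H}

/-- The compression `(M - L) X (M - L)`. -/
def compress (L M : 𝒩.Elem) (X : 𝒩.alg) : H →L[ℂ] H :=
  (proj M - proj L) * (X : H →L[ℂ] H) * (proj M - proj L)

/-! The five non-zero elementary seminorms at `N`. The quantities whose limits are taken
decrease as the interval shrinks, so the limits are infima; see `iPlus_isLimit` and the
lemmas after it. -/

open Classical in
/-- `i⁺_N(X) = lim_{M ↓ N} ‖(M - N) X (M - N)‖`, and `0` for `N = I`. -/
def iPlus (N : 𝒩.Elem) (X : 𝒩.alg) : ℝ :=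
  if N = 𝒩.one then 0 else ⨅ M : {M : 𝒩.Elem // N < M}, ‖compress N M.1 X‖

open Classical in
/-- `i⁻_N(X) = lim_{M ↑ N} ‖(N - M) X (N - M)‖`, and `0` for `N = 0`. -/
def iMinus (N : 𝒩.Elem) (X : 𝒩.alg) : ℝ :=
  if N = 𝒩.zero then 0 else ⨅ M : {M : 𝒩.Elem // M < N}, ‖compress M.1 N X‖

open Classical in
/-- `e⁺_N(X) = lim_{M ↓ N} sup_{N < L < M} ‖(M - L) X (M - L)‖_ess`, and `0` for `N = I`. -/
def ePlus (N : 𝒩.Elem) (X : 𝒩.alg) : ℝ :=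
  if N = 𝒩.one then 0 else
    ⨅ M : {M : 𝒩.Elem // N < M}, ⨆ L : {L : 𝒩.Elem // N < L ∧ L < M.1},
      essNorm (compress L.1 M.1 X)

open Classical in
/-- `e⁻_N(X) = lim_{M ↑ N} sup_{M < L < N} ‖(L - M) X (L - M)‖_ess`, and `0` for `N = 0`. -/
def eMinus (N : 𝒩.Elem) (X : 𝒩.alg) : ℝ :=
  if N = 𝒩.zero then 0 else
    ⨅ M : {M : 𝒩.Elem // M < N}, ⨆ L : {L : 𝒩.Elem // M.1 < L ∧ L < N},
      essNorm (compress M.1 L.1 X)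

open Classical in
/-- `j_N(X) = lim_{M ↓ N, L ↑ N} ‖(M - L) X (M - L)‖` for `0 < N < I`, with
`j_0 = i⁺_0` and `j_I = i⁻_I`. -/
def jBoth (N : 𝒩.Elem) (X : 𝒩.alg) : ℝ :=
  if N = 𝒩.zero then iPlus N X
  else if N = 𝒩.one then iMinus N X
  else ⨅ p : {L : 𝒩.Elem // L < N} × {M : 𝒩.Elem // N < M}, ‖compress p.1.1 p.2.1 X‖

/-- The elementary seminorms at `N` (pointwise-ordered lattice of ten seminorms):
`0`, `e^±_N`, `i^±_N`, `j_N`, and the joins (pointwise maxima) of a right-hand seminorm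
`e⁺_N`, `i⁺_N` with a left-hand one `e⁻_N`, `i⁻_N`. -/
def elementarySeminorms (N : 𝒩.Elem) : Set (𝒩.alg → ℝ) :=
  {0, ePlus N, eMinus N, iPlus N, iMinus N, jBoth N,
    ePlus N ⊔ eMinus N, ePlus N ⊔ iMinus N, iPlus N ⊔ eMinus N, iPlus N ⊔ iMinus N}

/-- A diagonal seminorm function: a choice of an elementary seminorm at each member
of the nest. -/
structure DiagonalSeminormFunction (𝒩 : ContinuousNest H) where
  seminorm : 𝒩.Elem → 𝒩.alg → ℝ
  elementary : ∀ N, seminorm N ∈ elementarySeminorms N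

/-- A stable ideal of the nest algebra: a two-sided ideal that is norm closed and invariant
under all automorphisms of the algebra. -/
structure IsStableIdeal (I : Ideal 𝒩.alg) : Prop where
  isTwoSided : I.IsTwoSided
  isClosed : IsClosed (I : Set 𝒩.alg)
  invariant : ∀ Φ : 𝒩.alg ≃ₐ[ℂ] 𝒩.alg, ∀ X ∈ I, Φ X ∈ I

/-- `K` is of compact character: `(N - M) K (N - M)` is compact for all `0 < M < N < I`. -/
def OfCompactCharacter (K : 𝒩.alg) : Prop :=
  ∀ M N : 𝒩.Elem, 𝒩.zero < M → M < N → N < 𝒩.one → IsCompactOperator (compress M N K)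

/-- An ideal is of compact character if all its elements are. -/
def IdealOfCompactCharacter (I : Ideal 𝒩.alg) : Prop :=
  ∀ K ∈ I, OfCompactCharacter K

/-- The set `F` of diagonal seminorm functions specifies the ideal `I`: `X ∈ I` iff for every
`ε > 0` some member of `F` has all its values at `X` smaller than `ε`. -/
def Specifies (F : Set 𝒩.DiagonalSeminormFunction) (I : Ideal 𝒩.alg) : Prop :=
  ∀ X : 𝒩.alg, X ∈ I ↔ ∀ ε : ℝ, 0 < ε → ∃ δ ∈ F, ∀ N : 𝒩.Elem, δ.seminorm N X < ε

/-- The quotient norm `‖X + I‖`, the norm of the coset of `X` in `Alg 𝒩 / I`. -/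
def quotientNorm (I : Ideal 𝒩.alg) (X : 𝒩.alg) : ℝ :=
  ‖(QuotientAddGroup.mk X : 𝒩.alg ⧸ Submodule.toAddSubgroup I)‖

theorem quotientNorm_eq_infDist (I : Ideal 𝒩.alg) (X : 𝒩.alg) :
    quotientNorm I X = Metric.infDist X (I : Set 𝒩.alg) :=
  QuotientAddGroup.norm_mk (S := Submodule.toAddSubgroup I) X

/-! Sanity facts: the infima above are limits. -/

theorem lt_or_le (L M : 𝒩.Elem) : L < M ∨ M ≤ L := by
  rcases 𝒩.isChain.total L.2 M.2 with h | h
  · rcases eq_or_lt_of_le h with h' | h'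
    · exact Or.inr (show M.1 ≤ L.1 from le_of_eq h'.symm)
    · exact Or.inl h'
  · exact Or.inr h

theorem proj_mul_of_le {L M : 𝒩.Elem} (h : L ≤ M) : proj L * proj M = proj L := by
  have : CompleteSpace L.1.toSubmodule := L.1.isClosed.completeSpace_coe
  have : CompleteSpace M.1.toSubmodule := M.1.isClosed.completeSpace_coe
  exact Submodule.starProjection_comp_starProjection_of_le h

theorem mul_proj_of_le {L M : 𝒩.Elem} (h : L ≤ M) : proj M * proj L = proj L := by
  have : CompleteSpace L.1.toSubmodule := L.1.isClosed.completeSpace_coe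
  have : CompleteSpace M.1.toSubmodule := M.1.isClosed.completeSpace_coe
  ext x
  exact Submodule.starProjection_eq_self_iff.mpr (h (Submodule.starProjection_apply_mem _ x))

theorem norm_proj_sub_le {L M : 𝒩.Elem} (h : L ≤ M) : ‖proj M - proj L‖ ≤ 1 := by
  have : CompleteSpace L.1.toSubmodule := L.1.isClosed.completeSpace_coe
  have : CompleteSpace M.1.toSubmodule := M.1.isClosed.completeSpace_coe
  have h1 : proj M - proj L = proj M * (1 - proj L) := by
    rw [mul_sub, mul_one, mul_proj_of_le h]
  have h2 : (1 - proj L : H →L[ℂ] H) = (L.1.toSubmodule)ᗮ.starProjection := by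
    rw [Submodule.starProjection_orthogonal]; rfl
  rw [h1]
  refine (norm_mul_le _ _).trans (mul_le_one₀ ?_ (norm_nonneg _) ?_)
  · exact Submodule.starProjection_norm_le _
  · rw [h2]; exact Submodule.starProjection_norm_le _

theorem compress_compress {L L' M' M : 𝒩.Elem} (h1 : L ≤ L') (h2 : L' ≤ M') (h3 : M' ≤ M)
    (X : 𝒩.alg) : compress L' M' X =
      (proj M' - proj L') * compress L M X * (proj M' - proj L') := by
  have ha : (proj M' - proj L') * (proj M - proj L) = proj M' - proj L' := by
    simp only [mul_sub, sub_mul, proj_mul_of_le h3, mul_proj_of_le h1,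
      mul_proj_of_le (h1.trans h2), proj_mul_of_le (h2.trans h3)]
    abel
  have hb : (proj M - proj L) * (proj M' - proj L') = proj M' - proj L' := by
    simp only [mul_sub, sub_mul, mul_proj_of_le h3, proj_mul_of_le h1,
      proj_mul_of_le (h1.trans h2), mul_proj_of_le (h2.trans h3)]
    abel
  unfold compress
  calc _ = ((proj M' - proj L') * (proj M - proj L)) * (X : H →L[ℂ] H) *
        ((proj M - proj L) * (proj M' - proj L')) := by rw [ha, hb]
    _ = _ := by simp only [mul_assoc]

theorem norm_compress_mono {L L' M' M : 𝒩.Elem} (h1 : L ≤ L') (h2 : L' ≤ M') (h3 : M' ≤ M)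
    (X : 𝒩.alg) : ‖compress L' M' X‖ ≤ ‖compress L M X‖ := by
  rw [compress_compress h1 h2 h3 X]
  have hp := norm_proj_sub_le h2
  calc _ ≤ ‖proj M' - proj L'‖ * ‖compress L M X‖ * ‖proj M' - proj L'‖ :=
        (norm_mul_le _ _).trans (by gcongr; exact norm_mul_le _ _)
    _ ≤ 1 * ‖compress L M X‖ * 1 := by gcongr
    _ = _ := by ring

theorem essNorm_nonneg (X : H →L[ℂ] H) : 0 ≤ essNorm X := norm_nonneg _

theorem essNorm_le (X : H →L[ℂ] H) : essNorm X ≤ ‖X‖ := Submodule.Quotient.norm_mk_le _ X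

theorem essNorm_mul_le (A X B : H →L[ℂ] H) (hA : ‖A‖ ≤ 1) (hB : ‖B‖ ≤ 1) :
    essNorm (A * X * B) ≤ essNorm X := by
  refine le_of_forall_pos_le_add fun ε hε => ?_
  obtain ⟨Y, hY, hn⟩ := Submodule.Quotient.norm_mk_lt
    (Submodule.Quotient.mk X : (H →L[ℂ] H) ⧸ compactOperator (RingHom.id ℂ) H H) hε
  have hK : IsCompactOperator (Y - X) := (Submodule.Quotient.eq _).1 hY
  have hE : (Submodule.Quotient.mk (A * X * B) :
      (H →L[ℂ] H) ⧸ compactOperator (RingHom.id ℂ) H H) =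
        Submodule.Quotient.mk (A * Y * B) := by
    symm
    rw [Submodule.Quotient.eq]
    have : A * Y * B - A * X * B = A * (Y - X) * B := by noncomm_ring
    rw [this]
    exact (hK.clm_comp A).comp_clm B
  have h1 : essNorm (A * X * B) ≤ ‖A * Y * B‖ := by
    unfold essNorm; rw [hE]; exact Submodule.Quotient.norm_mk_le _ _
  have h2 : ‖A * Y * B‖ ≤ ‖Y‖ :=
    calc _ ≤ ‖A‖ * ‖Y‖ * ‖B‖ := (norm_mul_le _ _).trans (by gcongr; exact norm_mul_le _ _)
      _ ≤ 1 * ‖Y‖ * 1 := by gcongr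
      _ = _ := by ring
  exact (h1.trans h2).trans hn.le

theorem exists_between_of_lt {L M : 𝒩.Elem} (h : L < M) : ∃ K : 𝒩.Elem, L < K ∧ K < M := by
  by_contra! hc
  refine absurd h (not_lt_of_ge ?_)
  change M.1 ≤ L.1
  rw [← 𝒩.continuous M.1 M.2]
  refine sSup_le fun K hK => ?_
  rcases lt_or_le L ⟨K, hK.1⟩ with h' | h'
  · exact absurd hK.2 (hc ⟨K, hK.1⟩ h')
  · exact h'

theorem lt_one {N : 𝒩.Elem} (hN : N ≠ 𝒩.one) : N < 𝒩.one :=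
  lt_of_le_of_ne (show N.1 ≤ ⊤ from le_top) hN

theorem zero_lt {N : 𝒩.Elem} (hN : N ≠ 𝒩.zero) : 𝒩.zero < N :=
  lt_of_le_of_ne (show ⊥ ≤ N.1 from bot_le) hN.symm

theorem iPlus_isLimit {N : 𝒩.Elem} (hN : N ≠ 𝒩.one) (X : 𝒩.alg) {ε : ℝ} (hε : 0 < ε) :
    ∃ M₀ : 𝒩.Elem, N < M₀ ∧ ∀ M : 𝒩.Elem, N < M → M ≤ M₀ →
      |‖compress N M X‖ - iPlus N X| < ε := by
  have : Nonempty {M : 𝒩.Elem // N < M} := ⟨⟨𝒩.one, lt_one hN⟩⟩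
  have hb : BddBelow (Set.range fun M : {M : 𝒩.Elem // N < M} => ‖compress N M.1 X‖) :=
    ⟨0, by rintro _ ⟨M, rfl⟩; exact norm_nonneg _⟩
  obtain ⟨M₀, h0⟩ := exists_lt_of_ciInf_lt (lt_add_of_pos_right
    (⨅ M : {M : 𝒩.Elem // N < M}, ‖compress N M.1 X‖) hε)
  refine ⟨M₀.1, M₀.2, fun M hM hMM => ?_⟩
  rw [iPlus, if_neg hN, abs_sub_lt_iff]
  have h1 := norm_compress_mono le_rfl hM.le hMM X
  have h2 := ciInf_le hb ⟨M, hM⟩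
  dsimp only at h2
  constructor <;> linarith

theorem iMinus_isLimit {N : 𝒩.Elem} (hN : N ≠ 𝒩.zero) (X : 𝒩.alg) {ε : ℝ} (hε : 0 < ε) :
    ∃ M₀ : 𝒩.Elem, M₀ < N ∧ ∀ M : 𝒩.Elem, M₀ ≤ M → M < N →
      |‖compress M N X‖ - iMinus N X| < ε := by
  have : Nonempty {M : 𝒩.Elem // M < N} := ⟨⟨𝒩.zero, zero_lt hN⟩⟩
  have hb : BddBelow (Set.range fun M : {M : 𝒩.Elem // M < N} => ‖compress M.1 N X‖) :=
    ⟨0, by rintro _ ⟨M, rfl⟩; exact norm_nonneg _⟩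
  obtain ⟨M₀, h0⟩ := exists_lt_of_ciInf_lt (lt_add_of_pos_right
    (⨅ M : {M : 𝒩.Elem // M < N}, ‖compress M.1 N X‖) hε)
  refine ⟨M₀.1, M₀.2, fun M hMM hM => ?_⟩
  rw [iMinus, if_neg hN, abs_sub_lt_iff]
  have h1 := norm_compress_mono hMM hM.le le_rfl X
  have h2 := ciInf_le hb ⟨M, hM⟩
  dsimp only at h2
  constructor <;> linarith

theorem jBoth_isLimit {N : 𝒩.Elem} (h0 : N ≠ 𝒩.zero) (h1 : N ≠ 𝒩.one) (X : 𝒩.alg)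
    {ε : ℝ} (hε : 0 < ε) :
    ∃ L₀ M₀ : 𝒩.Elem, L₀ < N ∧ N < M₀ ∧ ∀ L M : 𝒩.Elem, L₀ ≤ L → L < N → N < M → M ≤ M₀ →
      |‖compress L M X‖ - jBoth N X| < ε := by
  have : Nonempty {M : 𝒩.Elem // M < N} := ⟨⟨𝒩.zero, zero_lt h0⟩⟩
  have : Nonempty {M : 𝒩.Elem // N < M} := ⟨⟨𝒩.one, lt_one h1⟩⟩
  have hb : BddBelow (Set.range fun p : {L : 𝒩.Elem // L < N} × {M : 𝒩.Elem // N < M} =>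
      ‖compress p.1.1 p.2.1 X‖) :=
    ⟨0, by rintro _ ⟨M, rfl⟩; exact norm_nonneg _⟩
  obtain ⟨p, hp⟩ := exists_lt_of_ciInf_lt (lt_add_of_pos_right
    (⨅ p : {L : 𝒩.Elem // L < N} × {M : 𝒩.Elem // N < M}, ‖compress p.1.1 p.2.1 X‖) hε)
  refine ⟨p.1.1, p.2.1, p.1.2, p.2.2, fun L M hLL hL hM hMM => ?_⟩
  rw [jBoth, if_neg h0, if_neg h1, abs_sub_lt_iff]
  have h3 := norm_compress_mono hLL (hL.trans hM).le hMM X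
  have h2 := ciInf_le hb (⟨L, hL⟩, ⟨M, hM⟩)
  dsimp only at h2
  constructor <;> linarith

theorem essNorm_compress_mono {L L' M' M : 𝒩.Elem} (h1 : L ≤ L') (h2 : L' ≤ M') (h3 : M' ≤ M)
    (X : 𝒩.alg) : essNorm (compress L' M' X) ≤ essNorm (compress L M X) := by
  rw [compress_compress h1 h2 h3 X]
  exact essNorm_mul_le _ _ _ (norm_proj_sub_le h2) (norm_proj_sub_le h2)

theorem norm_compress_le {L M : 𝒩.Elem} (h : L ≤ M) (X : 𝒩.alg) : ‖compress L M X‖ ≤ ‖X‖ := by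
  have hp := norm_proj_sub_le h
  calc _ ≤ ‖proj M - proj L‖ * ‖(X : H →L[ℂ] H)‖ * ‖proj M - proj L‖ :=
        (norm_mul_le _ _).trans (by gcongr; exact norm_mul_le _ _)
    _ ≤ 1 * ‖(X : H →L[ℂ] H)‖ * 1 := by gcongr
    _ = ‖X‖ := by rw [one_mul, mul_one]; rfl

theorem ePlus_bdd (N M : 𝒩.Elem) (X : 𝒩.alg) :
    BddAbove (Set.range fun L : {L : 𝒩.Elem // N < L ∧ L < M} => essNorm (compress L.1 M X)) :=
  ⟨‖X‖, by rintro _ ⟨L, rfl⟩; exact (essNorm_le _).trans (norm_compress_le L.2.2.le X)⟩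

theorem eMinus_bdd (N M : 𝒩.Elem) (X : 𝒩.alg) :
    BddAbove (Set.range fun L : {L : 𝒩.Elem // M < L ∧ L < N} => essNorm (compress M L.1 X)) :=
  ⟨‖X‖, by rintro _ ⟨L, rfl⟩; exact (essNorm_le _).trans (norm_compress_le L.2.1.le X)⟩

theorem ePlus_isLimit {N : 𝒩.Elem} (hN : N ≠ 𝒩.one) (X : 𝒩.alg) {ε : ℝ} (hε : 0 < ε) :
    ∃ M₀ : 𝒩.Elem, N < M₀ ∧ ∀ M : 𝒩.Elem, N < M → M ≤ M₀ →
      |(⨆ L : {L : 𝒩.Elem // N < L ∧ L < M}, essNorm (compress L.1 M X)) - ePlus N X| < ε := by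
  have : Nonempty {M : 𝒩.Elem // N < M} := ⟨⟨𝒩.one, lt_one hN⟩⟩
  have hb : BddBelow (Set.range fun M : {M : 𝒩.Elem // N < M} =>
      ⨆ L : {L : 𝒩.Elem // N < L ∧ L < M.1}, essNorm (compress L.1 M.1 X)) :=
    ⟨0, by rintro _ ⟨M, rfl⟩; exact Real.iSup_nonneg fun _ => essNorm_nonneg _⟩
  obtain ⟨M₀, h0⟩ := exists_lt_of_ciInf_lt (lt_add_of_pos_right
    (⨅ M : {M : 𝒩.Elem // N < M}, ⨆ L : {L : 𝒩.Elem // N < L ∧ L < M.1},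
      essNorm (compress L.1 M.1 X)) hε)
  refine ⟨M₀.1, M₀.2, fun M hM hMM => ?_⟩
  rw [ePlus, if_neg hN, abs_sub_lt_iff]
  obtain ⟨K, hK⟩ := exists_between_of_lt hM
  have : Nonempty {L : 𝒩.Elem // N < L ∧ L < M} := ⟨⟨K, hK⟩⟩
  have h1 : (⨆ L : {L : 𝒩.Elem // N < L ∧ L < M}, essNorm (compress L.1 M X)) ≤
      ⨆ L : {L : 𝒩.Elem // N < L ∧ L < M₀.1}, essNorm (compress L.1 M₀.1 X) :=
    ciSup_le fun L => (essNorm_compress_mono le_rfl L.2.2.le hMM X).trans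
      (le_ciSup (ePlus_bdd N M₀.1 X) ⟨L.1, L.2.1, L.2.2.trans_le hMM⟩)
  have h2 := ciInf_le hb ⟨M, hM⟩
  dsimp only at h2
  constructor <;> linarith

theorem eMinus_isLimit {N : 𝒩.Elem} (hN : N ≠ 𝒩.zero) (X : 𝒩.alg) {ε : ℝ} (hε : 0 < ε) :
    ∃ M₀ : 𝒩.Elem, M₀ < N ∧ ∀ M : 𝒩.Elem, M₀ ≤ M → M < N →
      |(⨆ L : {L : 𝒩.Elem // M < L ∧ L < N}, essNorm (compress M L.1 X)) - eMinus N X| < ε := by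
  have : Nonempty {M : 𝒩.Elem // M < N} := ⟨⟨𝒩.zero, zero_lt hN⟩⟩
  have hb : BddBelow (Set.range fun M : {M : 𝒩.Elem // M < N} =>
      ⨆ L : {L : 𝒩.Elem // M.1 < L ∧ L < N}, essNorm (compress M.1 L.1 X)) :=
    ⟨0, by rintro _ ⟨M, rfl⟩; exact Real.iSup_nonneg fun _ => essNorm_nonneg _⟩
  obtain ⟨M₀, h0⟩ := exists_lt_of_ciInf_lt (lt_add_of_pos_right
    (⨅ M : {M : 𝒩.Elem // M < N}, ⨆ L : {L : 𝒩.Elem // M.1 < L ∧ L < N},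
      essNorm (compress M.1 L.1 X)) hε)
  refine ⟨M₀.1, M₀.2, fun M hMM hM => ?_⟩
  rw [eMinus, if_neg hN, abs_sub_lt_iff]
  obtain ⟨K, hK⟩ := exists_between_of_lt hM
  have : Nonempty {L : 𝒩.Elem // M < L ∧ L < N} := ⟨⟨K, hK⟩⟩
  have h1 : (⨆ L : {L : 𝒩.Elem // M < L ∧ L < N}, essNorm (compress M L.1 X)) ≤
      ⨆ L : {L : 𝒩.Elem // M₀.1 < L ∧ L < N}, essNorm (compress M₀.1 L.1 X) :=
    ciSup_le fun L => (essNorm_compress_mono hMM L.2.1.le le_rfl X).trans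
      (le_ciSup (eMinus_bdd N M₀.1 X) ⟨L.1, hMM.trans_lt L.2.1, L.2.2⟩)
  have h2 := ciInf_le hb ⟨M, hM⟩
  dsimp only at h2
  constructor <;> linarith

/-! Sanity facts: every value of a diagonal seminorm function at `X` lies in `[0, ‖X‖]`, so the
supremum over the nest is a genuine supremum. -/

theorem bddBelow_range_of_nonneg {ι : Type*} {f : ι → ℝ} (h : ∀ i, 0 ≤ f i) :
    BddBelow (Set.range f) :=
  ⟨0, by rintro _ ⟨i, rfl⟩; exact h i⟩

theorem iPlus_mem_Icc (N : 𝒩.Elem) (X : 𝒩.alg) : iPlus N X ∈ Set.Icc 0 ‖X‖ := by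
  unfold iPlus
  split_ifs with h
  · exact ⟨le_rfl, norm_nonneg _⟩
  · refine ⟨Real.iInf_nonneg fun _ => norm_nonneg _, ?_⟩
    exact (ciInf_le (bddBelow_range_of_nonneg (f := fun M : {M : 𝒩.Elem // N < M} => ‖compress N M.1 X‖)
      fun _ => norm_nonneg _) ⟨𝒩.one, lt_one h⟩).trans
      (norm_compress_le (lt_one h).le X)

theorem iMinus_mem_Icc (N : 𝒩.Elem) (X : 𝒩.alg) : iMinus N X ∈ Set.Icc 0 ‖X‖ := by
  unfold iMinus
  split_ifs with h
  · exact ⟨le_rfl, norm_nonneg _⟩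
  · refine ⟨Real.iInf_nonneg fun _ => norm_nonneg _, ?_⟩
    exact (ciInf_le (bddBelow_range_of_nonneg (f := fun M : {M : 𝒩.Elem // M < N} => ‖compress M.1 N X‖)
      fun _ => norm_nonneg _) ⟨𝒩.zero, zero_lt h⟩).trans
      (norm_compress_le (zero_lt h).le X)

theorem jBoth_mem_Icc (N : 𝒩.Elem) (X : 𝒩.alg) : jBoth N X ∈ Set.Icc 0 ‖X‖ := by
  unfold jBoth
  split_ifs with h h'
  · exact iPlus_mem_Icc N X
  · exact iMinus_mem_Icc N X
  · have hb : BddBelow (Set.range fun p : {L : 𝒩.Elem // L < N} × {M : 𝒩.Elem // N < M} =>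
        ‖compress p.1.1 p.2.1 X‖) :=
      ⟨0, by rintro _ ⟨M, rfl⟩; exact norm_nonneg _⟩
    have h2 := ciInf_le hb (⟨𝒩.zero, zero_lt h⟩, ⟨𝒩.one, lt_one h'⟩)
    have h3 : 𝒩.zero ≤ 𝒩.one := ((zero_lt h).trans (lt_one h')).le
    have h4 := norm_compress_le h3 X
    dsimp only at h2
    exact ⟨Real.iInf_nonneg fun p => norm_nonneg (compress p.1.1 p.2.1 X), h2.trans h4⟩

theorem ePlus_mem_Icc (N : 𝒩.Elem) (X : 𝒩.alg) : ePlus N X ∈ Set.Icc 0 ‖X‖ := by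
  unfold ePlus
  split_ifs with h
  · exact ⟨le_rfl, norm_nonneg _⟩
  · have hs : ∀ M : {M : 𝒩.Elem // N < M}, 0 ≤ ⨆ L : {L : 𝒩.Elem // N < L ∧ L < M.1},
        essNorm (compress L.1 M.1 X) := fun _ => Real.iSup_nonneg fun _ => essNorm_nonneg _
    refine ⟨Real.iInf_nonneg hs, ?_⟩
    exact (ciInf_le (bddBelow_range_of_nonneg hs) ⟨𝒩.one, lt_one h⟩).trans
      (Real.iSup_le (fun L => (essNorm_le _).trans (norm_compress_le L.2.2.le X)) (norm_nonneg _))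

theorem eMinus_mem_Icc (N : 𝒩.Elem) (X : 𝒩.alg) : eMinus N X ∈ Set.Icc 0 ‖X‖ := by
  unfold eMinus
  split_ifs with h
  · exact ⟨le_rfl, norm_nonneg _⟩
  · have hs : ∀ M : {M : 𝒩.Elem // M < N}, 0 ≤ ⨆ L : {L : 𝒩.Elem // M.1 < L ∧ L < N},
        essNorm (compress M.1 L.1 X) := fun _ => Real.iSup_nonneg fun _ => essNorm_nonneg _
    refine ⟨Real.iInf_nonneg hs, ?_⟩
    exact (ciInf_le (bddBelow_range_of_nonneg hs) ⟨𝒩.zero, zero_lt h⟩).trans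
      (Real.iSup_le (fun L => (essNorm_le _).trans (norm_compress_le L.2.1.le X)) (norm_nonneg _))

theorem DiagonalSeminormFunction.mem_Icc (δ : 𝒩.DiagonalSeminormFunction) (N : 𝒩.Elem)
    (X : 𝒩.alg) : δ.seminorm N X ∈ Set.Icc 0 ‖X‖ := by
  have hsup : ∀ {a b : ℝ}, a ∈ Set.Icc 0 ‖X‖ → b ∈ Set.Icc 0 ‖X‖ → a ⊔ b ∈ Set.Icc 0 ‖X‖ :=
    fun ha hb => ⟨ha.1.trans le_sup_left, sup_le ha.2 hb.2⟩
  have h1 := iPlus_mem_Icc N X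
  have h2 := iMinus_mem_Icc N X
  have h3 := ePlus_mem_Icc N X
  have h4 := eMinus_mem_Icc N X
  rcases δ.elementary N with h | h | h | h | h | h | h | h | h | h <;> rw [h]
  · exact ⟨le_rfl, norm_nonneg _⟩
  · exact h3
  · exact h4
  · exact h1
  · exact h2
  · exact jBoth_mem_Icc N X
  · exact hsup h3 h4
  · exact hsup h3 h2
  · exact hsup h1 h4
  · exact hsup h1 h2

end ContinuousNest

end NestAlgebra

end

/-!
The quotient norm is the distance from `X` to the ideal. Every elementary seminorm is Lipschitz
with constant one (`elementarySeminorm_le_add`), so an element `Y` of the ideal, on which some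
`δ` in the family is uniformly small, satisfies `sup_N δ_N(X) ≤ ‖X - Y‖ + ε`. This bounds the
distance from below.

For the bound from above, let `r > sup_N δ_N(X)`. It is enough to find `Y` with `‖X - Y‖ ≤ r + ε`
such that every elementary seminorm that is smaller than `r` on `X` vanishes on `Y`
(`exists_elementarySeminorms_eq_zero`), because then `δ_N(Y) = 0` for all `N`. The seminorms at
`N` vanish on operators that are compact on the relevant one-sided or two-sided intervals at `N`,
so `Y` should be compact there (`exists_locally_compact`).

Suppose first that a compression of `X` to an interval has norm less than `r`. Parrott's
completion theorem, applied corner by corner, gives one `Z` with `‖Z‖ ≤ r + ε` that agrees with `X`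
on all such intervals at once (`exists_completion`, `exists_interpolant`); then `X - Z` vanishes
on them. By strong continuity of the nest, a two-sided interval around `N` on which the essential
norm is less than `r` shrinks to one on which the norm is.

It remains to treat the points `N` next to which only the one-sided seminorms `e_N^±` are less than
`r`. There `X` is first replaced by `D X D'`. Each of `1 - D` and `1 - D'` is a sum of compact
operators of the nest algebra, supported on disjoint intervals; those that belong to one point `N`
form a sequence shrinking to `N`, from the right for `D` and from the left for `D'`. Hence
`X - D X D'` is compact on every closed interval that contains none of these points, whereas the compression
of `D X D'` to the whole one-sided interval at `N` has norm at most about `r`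
(`exists_right_correction`, `exists_left_correction`). The summands are approximate identities of
the interval, of the form `1 - (1 + λ V)⁻¹` with `V` a finite rank analogue of a Volterra operator
(`exists_approximate_identity`). They are chosen one after the other. The inductive step,
`exists_small_extension`, says that along vectors that nearly attain the norm only two
contributions survive: that of the weak limit, controlled by the blocks already present, and that
of the weakly null part, controlled by the essential norm of `X`.
-/

namespace NestAlgebra

open Filter Topology ContinuousLinearMap
open scoped InnerProductSpace

section HilbertSpace

variable {H : Type*} [NormedAddCommGroup H] [InnerProductSpace ℂ H] [CompleteSpace H]

/-! ### Weak limits along ultrafilters -/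

/-- A bounded family of vectors has a weak limit along every ultrafilter. -/
theorem exists_weak_limit {κ : Type*} (𝒰 : Ultrafilter κ) (v : κ → H) (C : ℝ)
    (hv : ∀ k, ‖v k‖ ≤ C) :
    ∃ w : H, ∀ y, Tendsto (fun k => ⟪y, v k⟫_ℂ) 𝒰 (𝓝 ⟪y, w⟫_ℂ) := by
  have key : ∀ y : H, ∃ c ∈ Metric.closedBall (0 : ℂ) (C * ‖y‖),
      Tendsto (fun k => ⟪v k, y⟫_ℂ) 𝒰 (𝓝 c) := by
    intro y
    obtain ⟨c, hc, h⟩ := (isCompact_closedBall (0 : ℂ) (C * ‖y‖)).ultrafilter_le_nhds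
      (𝒰.map fun k => ⟪v k, y⟫_ℂ) (by
        rw [le_principal_iff]
        refine Filter.mem_map.2 (Filter.univ_mem' fun k => ?_)
        simp only [Set.mem_preimage, mem_closedBall_zero_iff]
        exact (norm_inner_le_norm _ _).trans (by gcongr; exact hv k))
    exact ⟨c, hc, h⟩
  choose ℓ hℓ hlim using key
  let f : H →ₗ[ℂ] ℂ :=
    { toFun := ℓ
      map_add' := fun x y => tendsto_nhds_unique (hlim (x + y))
        (by simpa only [inner_add_right] using (hlim x).add (hlim y))
      map_smul' := fun c x => tendsto_nhds_unique (hlim (c • x))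
        (by simpa only [inner_smul_right, RingHom.id_apply, smul_eq_mul] using
          (hlim x).const_mul c) }
  let g : StrongDual ℂ H := f.mkContinuous C fun y => mem_closedBall_zero_iff.1 (hℓ y)
  refine ⟨(InnerProductSpace.toDual ℂ H).symm g, fun y => ?_⟩
  have h1 : ⟪(InnerProductSpace.toDual ℂ H).symm g, y⟫_ℂ = ℓ y := by
    rw [InnerProductSpace.toDual_symm_apply]; rfl
  have h2 := (Complex.continuous_conj.tendsto _).comp (hlim y)
  rw [← h1, inner_conj_symm] at h2
  simpa only [Function.comp_def, inner_conj_symm] using h2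

/-- A bounded net of operators has a weak operator cluster point, which inherits every
two-sided linear equation that holds eventually along the net. -/
theorem exists_weakOperator_limit {κ : Type*} (l : Filter κ) [l.NeBot] (T : κ → H →L[ℂ] H)
    (C : ℝ) (hT : ∀ k, ‖T k‖ ≤ C) :
    ∃ S : H →L[ℂ] H, ‖S‖ ≤ C ∧
      ∀ A B G : H →L[ℂ] H, (∀ᶠ k in l, A * T k * B = G) → A * S * B = G := by
  set 𝒰 := Ultrafilter.of l
  have h𝒰 : ↑𝒰 ≤ l := Ultrafilter.of_le l
  obtain ⟨k₀⟩ := l.nonempty_of_neBot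
  have hC : 0 ≤ C := (norm_nonneg _).trans (hT k₀)
  choose s hs using fun x : H => exists_weak_limit 𝒰 (fun k => T k x) (C * ‖x‖)
    fun k => (T k).le_of_opNorm_le (hT k) x
  let f : H →ₗ[ℂ] H :=
    { toFun := s
      map_add' := fun x y => ext_inner_left ℂ fun z => tendsto_nhds_unique (hs (x + y) z)
        (by simpa only [map_add, inner_add_right] using (hs x z).add (hs y z))
      map_smul' := fun c x => ext_inner_left ℂ fun z => tendsto_nhds_unique (hs (c • x) z)
        (by simpa only [map_smul, inner_smul_right, RingHom.id_apply] using
          (hs x z).const_mul c) }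
  have hf : ∀ x, ‖f x‖ ≤ C * ‖x‖ := by
    intro x
    have h1 : ‖⟪s x, s x⟫_ℂ‖ ≤ ‖s x‖ * (C * ‖x‖) :=
      le_of_tendsto (hs x (s x)).norm (Eventually.of_forall fun k =>
        (norm_inner_le_norm _ _).trans (by gcongr; exact (T k).le_of_opNorm_le (hT k) x))
    rw [inner_self_eq_norm_sq_to_K, norm_pow, RCLike.norm_ofReal, abs_norm, sq] at h1
    change ‖s x‖ ≤ _
    rcases (norm_nonneg (s x)).eq_or_lt with h | h
    · rw [← h]; positivity
    · exact le_of_mul_le_mul_left h1 h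
  refine ⟨f.mkContinuous C hf, f.mkContinuous_norm_le hC hf, fun A B G hG => ?_⟩
  ext x
  refine ext_inner_left ℂ fun y => ?_
  have h1 := hs (B x) (adjoint A y)
  have h2 : Tendsto (fun k => ⟪adjoint A y, T k (B x)⟫_ℂ) 𝒰 (𝓝 ⟪y, G x⟫_ℂ) := by
    refine tendsto_const_nhds.congr' ((hG.filter_mono h𝒰).mono fun k hk => ?_)
    change _ = ⟪adjoint A y, T k (B x)⟫_ℂ
    rw [adjoint_inner_left, ← hk]; rfl
  have h3 := tendsto_nhds_unique h1 h2
  rw [adjoint_inner_left] at h3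
  exact h3

/-- An operator `K` with `K* K` compact turns bounded weakly null families into norm null ones. -/
theorem tendsto_zero_of_weakly_null {κ : Type*} (𝒰 : Ultrafilter κ) {K : H →L[ℂ] H}
    (hK : IsCompactOperator (adjoint K * K)) {z : κ → H} {C : ℝ} (hz : ∀ k, ‖z k‖ ≤ C)
    (h0 : ∀ y, Tendsto (fun k => ⟪y, z k⟫_ℂ) 𝒰 (𝓝 0)) :
    Tendsto (fun k => ‖K (z k)‖) 𝒰 (𝓝 0) := by
  obtain ⟨S, hS, hsub⟩ := IsCompactOperator.image_closedBall_subset_compact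
    (f := ((adjoint K * K : H →L[ℂ] H) : H →ₗ[ℂ] H)) hK C
  obtain ⟨u, -, hu⟩ := hS.ultrafilter_le_nhds (𝒰.map fun k => adjoint K (K (z k))) (by
    rw [le_principal_iff]
    refine Filter.mem_map.2 (Filter.univ_mem' fun k => ?_)
    exact hsub ⟨z k, by simpa using hz k, rfl⟩)
  have hu' : Tendsto (fun k => adjoint K (K (z k))) 𝒰 (𝓝 u) := hu
  have hu0 : u = 0 := by
    refine ext_inner_left ℂ fun y => ?_
    have h1 : Tendsto (fun k => ⟪y, adjoint K (K (z k))⟫_ℂ) 𝒰 (𝓝 ⟪y, u⟫_ℂ) :=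
      tendsto_const_nhds.inner hu'
    have h2 := h0 (adjoint K (K y))
    rw [inner_zero_right]
    refine tendsto_nhds_unique h1 (h2.congr fun k => ?_)
    rw [adjoint_inner_left, adjoint_inner_right]
  rw [hu0] at hu'
  have h3 : Tendsto (fun k => ‖adjoint K (K (z k))‖ * C) 𝒰 (𝓝 0) := by
    simpa using hu'.norm.mul_const C
  have h4 : Tendsto (fun k => ‖K (z k)‖ ^ 2) 𝒰 (𝓝 0) := by
    refine squeeze_zero (fun k => by positivity) (fun k => ?_) h3
    have h5 : (‖K (z k)‖ ^ 2 : ℝ) = RCLike.re ⟪adjoint K (K (z k)), z k⟫_ℂ := by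
      rw [adjoint_inner_left, inner_self_eq_norm_sq]
    rw [h5]
    exact (re_inner_le_norm _ _).trans (by gcongr; exact hz k)
  have h6 := (Real.continuous_sqrt.tendsto _).comp h4
  simpa [Function.comp_def, Real.sqrt_sq] using h6

/-! ### Orthogonal blocks -/

theorem _root_.IsStarProjection.inner_left {P : H →L[ℂ] H} (hP : IsStarProjection P) (x y : H) :
    ⟪P x, y⟫_ℂ = ⟪x, P y⟫_ℂ := by
  have h := hP.isSelfAdjoint.star_eq
  rw [star_eq_adjoint] at h
  conv_lhs => rw [← h]
  exact adjoint_inner_left _ _ _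

theorem inner_eq_zero_of_mul_eq_zero {P Q : H →L[ℂ] H} (hP : IsStarProjection P)
    (hPQ : P * Q = 0) (x y : H) : ⟪P x, Q y⟫_ℂ = 0 := by
  rw [hP.inner_left]
  change ⟪x, (P * Q) y⟫_ℂ = 0
  rw [hPQ]; simp

theorem norm_sq_add_of_mul_eq_zero {P Q : H →L[ℂ] H} (hP : IsStarProjection P)
    (hPQ : P * Q = 0) (x y : H) : ‖P x + Q y‖ ^ 2 = ‖P x‖ ^ 2 + ‖Q y‖ ^ 2 := by
  rw [norm_add_sq (𝕜 := ℂ), inner_eq_zero_of_mul_eq_zero hP hPQ]; simp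

theorem norm_sq_eq_add {P : H →L[ℂ] H} (hP : IsStarProjection P) (x : H) :
    ‖x‖ ^ 2 = ‖P x‖ ^ 2 + ‖(1 - P) x‖ ^ 2 := by
  rw [← norm_sq_add_of_mul_eq_zero hP hP.mul_one_sub_self]; simp

theorem norm_sq_add_le {P Q : H →L[ℂ] H} (hP : IsStarProjection P) (hQ : IsStarProjection Q)
    (hPQ : P * Q = 0) (x : H) : ‖P x‖ ^ 2 + ‖Q x‖ ^ 2 ≤ ‖x‖ ^ 2 := by
  have h := hP.add hQ hPQ
  rw [← norm_sq_add_of_mul_eq_zero hP hPQ]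
  gcongr
  exact ((P + Q).le_of_opNorm_le (IsStarProjection.norm_le _ h) x).trans (by simp)

theorem norm_add_le_of_blocks {P Q A B : H →L[ℂ] H} {C : ℝ} (hP : IsStarProjection P)
    (hQ : IsStarProjection Q) (hPQ : P * Q = 0) (hA : P * A * P = A) (hB : Q * B * Q = B)
    (hAC : ‖A‖ ≤ C) (hBC : ‖B‖ ≤ C) : ‖A + B‖ ≤ C := by
  have hC : 0 ≤ C := (norm_nonneg _).trans hAC
  refine opNorm_le_bound _ hC fun x => ?_
  have e1 : A x = P (A (P x)) := congr($hA.symm x)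
  have e2 : B x = Q (B (Q x)) := congr($hB.symm x)
  have e1' : P (A (P x)) = A (P x) := by
    have := hP.isIdempotentElem.eq
    have h : A * P = A := by rw [← hA]; simp only [mul_assoc, this]
    exact (e1.symm.trans congr($h.symm x))
  have e2' : Q (B (Q x)) = B (Q x) := by
    have := hQ.isIdempotentElem.eq
    have h : B * Q = B := by rw [← hB]; simp only [mul_assoc, this]
    exact (e2.symm.trans congr($h.symm x))
  have h1 : ‖(A + B) x‖ ^ 2 ≤ (C * ‖x‖) ^ 2 := by
    calc ‖(A + B) x‖ ^ 2 = ‖P (A (P x)) + Q (B (Q x))‖ ^ 2 := by rw [add_apply, ← e1, ← e2]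
      _ = ‖A (P x)‖ ^ 2 + ‖B (Q x)‖ ^ 2 := by
        rw [norm_sq_add_of_mul_eq_zero hP hPQ, e1', e2']
      _ ≤ (C * ‖P x‖) ^ 2 + (C * ‖Q x‖) ^ 2 := by
        gcongr
        · exact A.le_of_opNorm_le hAC _
        · exact B.le_of_opNorm_le hBC _
      _ = C ^ 2 * (‖P x‖ ^ 2 + ‖Q x‖ ^ 2) := by ring
      _ ≤ C ^ 2 * ‖x‖ ^ 2 := by gcongr; exact norm_sq_add_le hP hQ hPQ x
      _ = _ := by ring
  exact le_of_sq_le_sq h1 (by positivity)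

theorem norm_one_sub_sum_le {ι : Type*} {P E : ι → H →L[ℂ] H} {C : ℝ} (hC : 1 ≤ C)
    (hP : ∀ i, IsStarProjection (P i)) (hPP : Pairwise fun i j => P i * P j = 0)
    (hE : ∀ i, P i * E i * P i = E i) (hn : ∀ i, ‖P i - E i‖ ≤ C) (s : Finset ι) :
    ‖1 - ∑ i ∈ s, E i‖ ≤ C := by
  classical
  have hPE : ∀ i j, i ≠ j → P i * E j = 0 := fun i j h => by
    rw [← hE j, ← mul_assoc, ← mul_assoc, hPP h, zero_mul, zero_mul]
  have hEP : ∀ i j, i ≠ j → E j * P i = 0 := fun i j h => by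
    rw [← hE j, mul_assoc, hPP h.symm, mul_zero]
  induction s using Finset.induction_on with
  | empty =>
    simp only [Finset.sum_empty, sub_zero]
    exact norm_id_le.trans hC
  | insert i s hi ih =>
    have h1 : P i * ∑ j ∈ s, E j = 0 := by
      rw [Finset.mul_sum]
      exact Finset.sum_eq_zero fun j hj => hPE i j fun h => hi (h ▸ hj)
    have h2 : (∑ j ∈ s, E j) * P i = 0 := by
      rw [Finset.sum_mul]
      exact Finset.sum_eq_zero fun j hj => hEP i j fun h => hi (h ▸ hj)
    have hq := (hP i).one_sub
    have hpp := (hP i).isIdempotentElem.eq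
    have hqp := (hP i).one_sub_mul_self
    have hpE : P i * E i = E i := by
      rw [← hE i]; simp only [← mul_assoc, hpp]
    have hEp : E i * P i = E i := by
      rw [← hE i]; simp only [mul_assoc, hpp]
    have e : 1 - ∑ j ∈ insert i s, E j =
        (1 - P i) * (1 - ∑ j ∈ s, E j) * (1 - P i) + (P i - E i) := by
      rw [Finset.sum_insert hi]
      simp only [sub_mul, mul_sub, one_mul, mul_one, h1, h2, hpp, zero_mul]
      abel
    rw [e]
    refine norm_add_le_of_blocks hq (hP i) hqp ?_ ?_ ?_ (hn i)
    · have := hq.isIdempotentElem.eq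
      calc _ = ((1 - P i) * (1 - P i)) * (1 - ∑ j ∈ s, E j) * ((1 - P i) * (1 - P i)) := by
            noncomm_ring
        _ = _ := by rw [this]
    · simp only [mul_sub, sub_mul, hpp, hpE, hEp]
    · have h := IsStarProjection.norm_le _ hq
      calc _ ≤ ‖1 - P i‖ * ‖1 - ∑ j ∈ s, E j‖ * ‖1 - P i‖ :=
            (norm_mul_le _ _).trans (by gcongr; exact norm_mul_le _ _)
        _ ≤ 1 * C * 1 := by gcongr
        _ = C := by ring

/-! ### Parrott's completion theorem -/

/-- Parrott's theorem, with an arbitrarily small loss in the norm: an operator that is given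
on its first column (the range of `p`) and on its last row (the range of `q`) has a completion
whose norm is the larger of the norms of the column and of the row. -/
theorem exists_completion {p q S T : H →L[ℂ] H} {ρ ρ' : ℝ} (hp : IsStarProjection p)
    (hq : IsStarProjection q) (hS : ‖S * p‖ ≤ ρ) (hT : ‖q * T‖ ≤ ρ)
    (hST : q * S * p = q * T * p) (hρ : ρ < ρ') :
    ∃ Z : H →L[ℂ] H, ‖Z‖ ≤ ρ' ∧ Z * p = S * p ∧ q * Z = q * T := by
  have h0 : 0 ≤ ρ := (norm_nonneg _).trans hS
  have hρ0 : 0 < ρ' := h0.trans_lt hρ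
  set A : H →L[ℂ] H := q * S * p with hA
  have hAn : ∀ x, ‖A x‖ ≤ ρ * ‖x‖ := fun x => by
    have h1 : ‖q (S (p x))‖ ≤ ‖S (p x)‖ :=
      (q.le_of_opNorm_le (IsStarProjection.norm_le _ hq) _).trans (by simp)
    exact h1.trans ((S * p).le_of_opNorm_le hS x)
  set M : H →L[ℂ] H := ((ρ' ^ 2 : ℝ) : ℂ) • (1 : H →L[ℂ] H) - adjoint A * A with hM
  have hMi : ∀ x y,
      RCLike.re ⟪x, M y⟫_ℂ = ρ' ^ 2 * RCLike.re ⟪x, y⟫_ℂ - RCLike.re ⟪A x, A y⟫_ℂ := by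
    intro x y
    have e : M y = ((ρ' ^ 2 : ℝ) : ℂ) • y - adjoint A (A y) := rfl
    rw [e, inner_sub_right, inner_smul_right, adjoint_inner_right, map_sub]
    congr 1
    exact Complex.re_ofReal_mul _ _
  have hunit : IsUnit M := by
    have hc : 0 < ρ' ^ 2 - ρ ^ 2 := by nlinarith
    refine isUnit_of_forall_le_norm_inner_map (c := ⟨ρ' ^ 2 - ρ ^ 2, hc.le⟩) M hc fun x => ?_
    rw [norm_inner_symm]
    refine le_trans ?_ (RCLike.re_le_norm _)
    rw [hMi, inner_self_eq_norm_sq, inner_self_eq_norm_sq]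
    have := pow_le_pow_left₀ (norm_nonneg _) (hAn x) 2
    change ‖x‖ ^ 2 * (ρ' ^ 2 - ρ ^ 2) ≤ _
    nlinarith
  obtain ⟨G, hG⟩ := hunit.exists_right_inv
  set B : H →L[ℂ] H := q * T * (1 - p) with hB
  have hpp := hp.isIdempotentElem.eq
  have hqq := hq.isIdempotentElem.eq
  -- The missing corner is `-C G A* B`, with `C = (1 - q) S p` and `G = (ρ'² - A* A)⁻¹`.
  refine ⟨S * p + B - (1 - q) * S * p * G * adjoint A * B, ?_, ?_, ?_⟩
  · refine opNorm_le_bound _ hρ0.le fun v => ?_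
    set x := p v
    set b := B v with hb
    set g := G (adjoint A b) with hg
    set u := b + A g
    have hMg : M g = adjoint A b := congr($hG (adjoint A b))
    have hApx : A x = A v := by
      change (A * p) v = A v
      rw [hA, mul_assoc, hpp]
    have hqb : q b = b := by
      change (q * B) v = B v
      rw [hB, ← mul_assoc, ← mul_assoc, hqq]
    have hqA : ∀ y, q (A y) = A y := fun y => by
      change (q * A) y = A y
      rw [hA, ← mul_assoc, ← mul_assoc, hqq]
    -- split the value into its components in the ranges of `q` and `1 - q`
    have hval : (S * p + B - (1 - q) * S * p * G * adjoint A * B) v =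
        q (A x + b) + (1 - q) (S (p (x - g))) := by
      have h1 : (S * p + B - (1 - q) * S * p * G * adjoint A * B) v =
        S (p v) + b - (1 - q) (S (p g)) := rfl
      have hpx : p x = p v := congr($hpp v)
      have h2 : A x = q (S (p v)) := by rw [hApx]; rfl
      rw [h1, map_add q, hqA, hqb, h2, map_sub p, map_sub S, map_sub (1 - q), hpx]
      simp only [sub_apply, one_apply_eq_self]
      abel
    have hnorm : ‖(S * p + B - (1 - q) * S * p * G * adjoint A * B) v‖ ^ 2 =
        ‖A x + b‖ ^ 2 + ‖(1 - q) (S (p (x - g)))‖ ^ 2 := by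
      rw [hval, norm_sq_add_of_mul_eq_zero hq hq.mul_one_sub_self, map_add, hqA, hqb]
    have h1 : ‖A (x - g)‖ ^ 2 + ‖(1 - q) (S (p (x - g)))‖ ^ 2 ≤ ρ' ^ 2 * ‖x - g‖ ^ 2 := by
      have e := norm_sq_eq_add hq (S (p (x - g)))
      have e2 : ‖S (p (x - g))‖ ≤ ρ' * ‖x - g‖ :=
        (S * p).le_of_opNorm_le (hS.trans hρ.le) (x - g)
      have e3 := pow_le_pow_left₀ (norm_nonneg _) e2 2
      rw [mul_pow, e] at e3
      exact e3
    have h2 := norm_sub_sq (𝕜 := ℂ) x g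
    have h3 := norm_sub_sq (𝕜 := ℂ) (A x) (A g)
    rw [← map_sub] at h3
    have h4 := norm_add_sq (𝕜 := ℂ) (A x) b
    have h5 := hMi x g
    rw [hMg, adjoint_inner_right] at h5
    have h6 := hMi g g
    rw [hMg, adjoint_inner_right, inner_self_eq_norm_sq, inner_self_eq_norm_sq] at h6
    -- the row `q T` controls `b`
    have hrow : RCLike.re ⟪b, u⟫_ℂ ≤ ρ' ^ 2 * ‖(1 - p) v‖ ^ 2 := by
      set t := adjoint (q * T) u
      have hA2 : A = q * T * p := hST
      have ht : ‖t‖ ≤ ρ' * ‖u‖ := by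
        refine (adjoint (q * T)).le_of_opNorm_le ?_ u
        rw [LinearIsometryEquiv.norm_map]; exact hT.trans hρ.le
      have ht2 := norm_sq_eq_add hp t
      have hAu : p t = adjoint A u := by
        refine ext_inner_left ℂ fun y => ?_
        rw [← hp.inner_left, adjoint_inner_right, adjoint_inner_right, hA2]; rfl
      have hBu : (1 - p) t = adjoint B u := by
        refine ext_inner_left ℂ fun y => ?_
        rw [← hp.one_sub.inner_left, adjoint_inner_right, adjoint_inner_right, hB]; rfl
      have hMg' : ((ρ' ^ 2 : ℝ) : ℂ) • g - adjoint A (A g) = adjoint A b := hMg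
      have hAu2 : adjoint A u = ((ρ' ^ 2 : ℝ) : ℂ) • g := by
        rw [map_add, ← hMg']; abel
      have k1 : ‖p t‖ ^ 2 = ρ' ^ 2 * RCLike.re ⟪A g, u⟫_ℂ := by
        rw [hAu, ← inner_self_eq_norm_sq (𝕜 := ℂ)]
        nth_rewrite 1 [hAu2]
        rw [inner_smul_left, adjoint_inner_right, Complex.conj_ofReal]
        exact Complex.re_ofReal_mul _ _
      have k2 : ‖u‖ ^ 2 = RCLike.re ⟪b, u⟫_ℂ + RCLike.re ⟪A g, u⟫_ℂ := by
        rw [← inner_self_eq_norm_sq (𝕜 := ℂ), ← map_add, ← inner_add_left]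
      have k3 : RCLike.re ⟪b, u⟫_ℂ ≤ ‖(1 - p) v‖ * ‖(1 - p) t‖ := by
        have : ⟪b, u⟫_ℂ = ⟪(1 - p) v, (1 - p) t⟫_ℂ := by
          rw [hp.one_sub.inner_left, hBu]
          have e : (1 - p) (adjoint B u) = adjoint B u := by
            rw [← hBu]; exact congr($(hp.one_sub.isIdempotentElem.eq) t)
          rw [e, adjoint_inner_right]
        rw [this]; exact re_inner_le_norm _ _
      have k4 := pow_le_pow_left₀ (norm_nonneg _) ht 2
      rw [mul_pow, ht2, k1, k2] at k4
      have k5 : ‖(1 - p) t‖ ^ 2 ≤ ρ' ^ 2 * (‖(1 - p) v‖ * ‖(1 - p) t‖) := by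
        nlinarith [sq_nonneg ρ']
      have k6 : ‖(1 - p) t‖ ≤ ρ' ^ 2 * ‖(1 - p) v‖ := by
        rcases (norm_nonneg ((1 - p) t)).eq_or_lt with h | h
        · rw [← h]; positivity
        · refine le_of_mul_le_mul_right ?_ h
          linarith
      calc _ ≤ _ := k3
        _ ≤ ‖(1 - p) v‖ * (ρ' ^ 2 * ‖(1 - p) v‖) := by gcongr
        _ = _ := by ring
    have hu : RCLike.re ⟪b, u⟫_ℂ = ‖b‖ ^ 2 + RCLike.re ⟪A g, b⟫_ℂ := by
      rw [inner_add_right, map_add, inner_self_eq_norm_sq, inner_re_symm b]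
    have hv := norm_sq_eq_add hp v
    refine le_of_sq_le_sq ?_ (by positivity)
    rw [hnorm, mul_pow, hv]
    change _ ≤ ρ' ^ 2 * (‖x‖ ^ 2 + _)
    rw [h2, h3] at h1
    rw [h4]
    nlinarith
  · have e : B * p = 0 := by rw [hB, mul_assoc, hp.one_sub_mul_self, mul_zero]
    rw [sub_mul, add_mul, mul_assoc _ B p, e, mul_zero, sub_zero, add_zero, mul_assoc, hpp]
  · have e : q * (1 - q) = 0 := hq.mul_one_sub_self
    have e2 : q * B = q * T * (1 - p) := by rw [hB, ← mul_assoc, ← mul_assoc, hqq]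
    calc q * (S * p + B - (1 - q) * S * p * G * adjoint A * B)
        = A + q * B - q * (1 - q) * (S * p * G * adjoint A * B) := by rw [hA]; noncomm_ring
      _ = q * T * p + q * T * (1 - p) - 0 := by rw [e, e2, hST, zero_mul]
      _ = q * T := by noncomm_ring

/-! ### Removing compact parts block by block -/

/-- The inductive step in removing compact parts. On `Q'` the operator `D' X` has norm at most `ρ`,
and `X` maps the kernel of `Q'` into itself. If the operators in `𝒟` are small on prescribed finite
sets, one of them extends `D'` at almost no cost in norm: along vectors that almost attain the norm,
the weak limit only feels `D' X`, and the weakly null remainder only feels `X` modulo compact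
operators. -/
theorem exists_small_extension {Q' R X D' A K : H →L[ℂ] H} {r C ρ ρ' : ℝ}
    (hQ' : IsStarProjection Q') (hR : IsStarProjection R) (hQR : Q' * R = 0)
    (hX : Q' * X = Q' * X * Q') (hAK : (Q' + R) * X * (Q' + R) = A + K) (hA : ‖A‖ ≤ r)
    (hK : IsCompactOperator (adjoint K * K)) (hD' : Q' * D' * Q' = D') (hD'C : ‖D'‖ ≤ C)
    (hρ : ‖D' * X * Q'‖ ≤ ρ) (hCr : C * r ≤ ρ) (hρρ : ρ < ρ') (𝒟 : Set (H →L[ℂ] H))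
    (h𝒟 : ∀ D ∈ 𝒟, R * D * R = D ∧ ‖D‖ ≤ C)
    (hsmall : ∀ F : Finset H, ∀ ε : ℝ, 0 < ε → ∃ D ∈ 𝒟, ∀ x ∈ F, ‖D x‖ < ε) :
    ∃ D ∈ 𝒟, ‖(D' + D) * X * (Q' + R)‖ ≤ ρ' := by
  classical
  by_contra! hcon
  have hC0 : 0 ≤ C := (norm_nonneg _).trans hD'C
  have hr0 : 0 ≤ r := (norm_nonneg _).trans hA
  have hρ0 : 0 ≤ ρ := (norm_nonneg _).trans hρ
  have hqq := hQ'.isIdempotentElem.eq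
  have hrr := hR.isIdempotentElem.eq
  have hRQ : R * Q' = 0 := by
    have := congr(star $hQR)
    rwa [star_mul, hQ'.isSelfAdjoint.star_eq, hR.isSelfAdjoint.star_eq, star_zero] at this
  choose d hd hdx using fun k : Finset H × ℕ => hsmall k.1 (1 / (k.2 + 1)) (by positivity)
  choose v hv1 hv2 using fun k => exists_lt_apply_of_lt_opNorm _ (hcon (d k) (hd k))
  set Y := (Q' + R) * X * (Q' + R) with hY
  have hD'q : D' * Q' = D' := by rw [← hD']; simp only [mul_assoc, hqq]
  have hD'l : Q' * D' = D' := by rw [← hD']; simp only [← mul_assoc, hqq]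
  have hD'R : D' * R = 0 := by rw [← hD'q, mul_assoc, hQR, mul_zero]
  have hDl : ∀ k, R * d k = d k := fun k => by
    rw [← (h𝒟 _ (hd k)).1]; simp only [← mul_assoc, hrr]
  have hDR : ∀ k, d k * R = d k := fun k => by
    rw [← (h𝒟 _ (hd k)).1]; simp only [mul_assoc, hrr]
  have hDq : ∀ k, d k * Q' = 0 := fun k => by rw [← hDR k, mul_assoc, hRQ, mul_zero]
  have hDY : ∀ k, (D' + d k) * X * (Q' + R) = (D' + d k) * Y := fun k => by
    have : (D' + d k) * (Q' + R) = D' + d k := by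
      rw [mul_add, add_mul, add_mul, hD'q, hDq, hD'R, hDR]; abel
    rw [hY, ← mul_assoc, ← mul_assoc, this]
  have hD'Y : D' * Y = D' * X * Q' := by
    have h1 : D' * (Q' + R) = D' := by rw [mul_add, hD'q, hD'R, add_zero]
    have h3 : D' * X * R = 0 := by
      rw [← hD'q, mul_assoc D', hX, mul_assoc, mul_assoc (Q' * X), hQR, mul_zero, mul_zero]
    rw [hY, ← mul_assoc, ← mul_assoc, h1, mul_add, h3, add_zero]
  have hDn : ∀ k, ‖D' + d k‖ ≤ C := fun k =>
    norm_add_le_of_blocks hQ' hR hQR hD' (h𝒟 _ (hd k)).1 hD'C (h𝒟 _ (hd k)).2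
  set 𝒰 := Ultrafilter.of (atTop : Filter (Finset H × ℕ))
  have h𝒰 : ↑𝒰 ≤ (atTop : Filter (Finset H × ℕ)) := Ultrafilter.of_le _
  -- the operators `d k` tend to zero strongly
  have hd0 : ∀ x, Tendsto (fun k => d k x) 𝒰 (𝓝 0) := by
    intro x
    rw [tendsto_zero_iff_norm_tendsto_zero]
    have h2 : Tendsto (fun k : Finset H × ℕ => (1 : ℝ) / (k.2 + 1)) 𝒰 (𝓝 0) := by
      have h3 : Tendsto (fun k : Finset H × ℕ => k.2) 𝒰 atTop := by
        refine Tendsto.mono_left ?_ h𝒰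
        rw [← prod_atTop_atTop_eq]; exact tendsto_snd
      exact tendsto_one_div_add_atTop_nhds_zero_nat.comp h3
    refine squeeze_zero' (Eventually.of_forall fun _ => norm_nonneg _) ?_ h2
    refine Filter.Eventually.filter_mono h𝒰 ?_
    filter_upwards [eventually_ge_atTop (({x}, 0) : Finset H × ℕ)] with k hk
    exact (hdx k x (hk.1 (Finset.mem_singleton_self x))).le
  obtain ⟨w, hw⟩ := exists_weak_limit 𝒰 v 1 fun k => (hv1 k).le
  set z := fun k => v k - w with hz
  have hz0 : ∀ y, Tendsto (fun k => ⟪y, z k⟫_ℂ) 𝒰 (𝓝 0) := fun y => by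
    have := (hw y).sub_const ⟪y, w⟫_ℂ
    simpa only [hz, inner_sub_right, sub_self] using this
  have hzb : ∀ k, ‖z k‖ ≤ 1 + ‖w‖ := fun k =>
    (norm_sub_le _ _).trans (by gcongr; exact (hv1 k).le)
  have hKz := tendsto_zero_of_weakly_null 𝒰 hK hzb hz0
  -- the norms of the weakly null remainders converge
  obtain ⟨ℓ, hℓ⟩ : ∃ ℓ, Tendsto (fun k => ‖z k‖) 𝒰 (𝓝 ℓ) := by
    obtain ⟨ℓ, -, h⟩ := (isCompact_Icc (a := (0 : ℝ)) (b := 1 + ‖w‖)).ultrafilter_le_nhds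
      (𝒰.map fun k => ‖z k‖) (by
        rw [le_principal_iff]
        exact Filter.mem_map.2 (Filter.univ_mem' fun k => ⟨norm_nonneg _, hzb k⟩))
    exact ⟨ℓ, h⟩
  have hwℓ : ‖w‖ ^ 2 + ℓ ^ 2 ≤ 1 := by
    have h1 : Tendsto (fun k => ‖w‖ ^ 2 + 2 * RCLike.re ⟪w, z k⟫_ℂ + ‖z k‖ ^ 2) 𝒰
        (𝓝 (‖w‖ ^ 2 + 2 * RCLike.re (0 : ℂ) + ℓ ^ 2)) :=
      (((RCLike.continuous_re.tendsto _).comp (hz0 w)).const_mul 2 |>.const_add _).add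
        (hℓ.pow 2)
    have h2 : ∀ k, ‖w‖ ^ 2 + 2 * RCLike.re ⟪w, z k⟫_ℂ + ‖z k‖ ^ 2 ≤ 1 := fun k => by
      rw [← norm_add_sq (𝕜 := ℂ)]
      have : w + z k = v k := by simp [hz]
      rw [this]
      exact pow_le_one₀ (norm_nonneg _) (hv1 k).le
    have h3 := le_of_tendsto h1 (Eventually.of_forall h2)
    simpa using h3
  set f := fun k => ((D' + d k) * Y) w with hf
  set g := fun k => ((D' + d k) * Y) (z k) with hg
  have hfl : Tendsto f 𝒰 (𝓝 ((D' * Y) w)) := by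
    have := (hd0 (Y w)).const_add (D' (Y w))
    rw [add_zero] at this
    exact this
  have hgb : ∀ k, ‖g k‖ ≤ C * (r * ‖z k‖ + ‖K (z k)‖) := fun k => by
    refine ((D' + d k).le_of_opNorm_le (hDn k) _).trans ?_
    gcongr
    have : Y (z k) = A (z k) + K (z k) := congr($hAK (z k))
    change ‖Y (z k)‖ ≤ _
    rw [this]
    exact (norm_add_le _ _).trans (by gcongr; exact A.le_of_opNorm_le hA _)
  have hgl : Tendsto (fun k => C * (r * ‖z k‖ + ‖K (z k)‖)) 𝒰 (𝓝 (C * (r * ℓ + 0))) :=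
    ((hℓ.const_mul r).add hKz).const_mul C
  have hfg : Tendsto (fun k => RCLike.re ⟪f k, g k⟫_ℂ) 𝒰 (𝓝 0) := by
    have h1 : Tendsto (fun k => ⟪f k - (D' * Y) w, g k⟫_ℂ) 𝒰 (𝓝 0) := by
      have h2 : Tendsto (fun k => ‖f k - (D' * Y) w‖ * (C * (r * ‖z k‖ + ‖K (z k)‖))) 𝒰
          (𝓝 0) := by
        have := (tendsto_iff_norm_sub_tendsto_zero.1 hfl).mul hgl
        rwa [zero_mul] at this
      refine squeeze_zero_norm (fun k => (norm_inner_le_norm _ _).trans ?_) h2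
      gcongr
      exact hgb k
    have h3 : Tendsto (fun k => ⟪(D' * Y) w, g k⟫_ℂ) 𝒰 (𝓝 0) := by
      refine (hz0 (adjoint (D' * Y) ((D' * Y) w))).congr fun k => ?_
      rw [adjoint_inner_left]
      have e1 : g k = (D' * Y) (z k) + d k (Y (z k)) := rfl
      have e2 : ⟪(D' * Y) w, d k (Y (z k))⟫_ℂ = 0 := by
        have e3 : (D' * Y) w = Q' ((D' * Y) w) := by
          change _ = (Q' * D') (Y w); rw [hD'l]; rfl
        have e4 : d k (Y (z k)) = R (d k (Y (z k))) := congr($((hDl k).symm) (Y (z k)))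
        rw [e3, e4]
        exact inner_eq_zero_of_mul_eq_zero hQ' hQR _ _
      rw [e1, inner_add_right, e2, add_zero]
    have h4 := (RCLike.continuous_re.tendsto _).comp (h1.add h3)
    simp only [add_zero, map_zero] at h4
    refine h4.congr fun k => ?_
    simp only [Function.comp_def]
    rw [← inner_add_left, sub_add_cancel]
  have hfin : Tendsto (fun k => ‖f k‖ ^ 2 + 2 * RCLike.re ⟪f k, g k⟫_ℂ +
      (C * (r * ‖z k‖ + ‖K (z k)‖)) ^ 2) 𝒰
      (𝓝 (‖(D' * Y) w‖ ^ 2 + 2 * 0 + (C * (r * ℓ + 0)) ^ 2)) :=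
    ((hfl.norm.pow 2).add (hfg.const_mul 2)).add (hgl.pow 2)
  have hlow : ∀ k, ρ' ^ 2 ≤ ‖f k‖ ^ 2 + 2 * RCLike.re ⟪f k, g k⟫_ℂ +
      (C * (r * ‖z k‖ + ‖K (z k)‖)) ^ 2 := fun k => by
    have e : ((D' + d k) * X * (Q' + R)) (v k) = f k + g k := by
      rw [hDY, hf, hg]
      simp only
      rw [← map_add]; simp [hz]
    have h1 : ρ' ^ 2 ≤ ‖f k + g k‖ ^ 2 := by
      rw [← e]; exact pow_le_pow_left₀ (hρ0.trans hρρ.le) (hv2 k).le 2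
    rw [norm_add_sq (𝕜 := ℂ)] at h1
    have h2 := pow_le_pow_left₀ (norm_nonneg _) (hgb k) 2
    linarith
  have hlim := ge_of_tendsto hfin (Eventually.of_forall hlow)
  have hDYw : ‖(D' * Y) w‖ ≤ ρ * ‖w‖ := by
    rw [hD'Y]; exact le_of_opNorm_le _ hρ w
  have hℓ0 : 0 ≤ ℓ := ge_of_tendsto hℓ (Eventually.of_forall fun _ => norm_nonneg _)
  have h1 := pow_le_pow_left₀ (norm_nonneg _) hDYw 2
  have h2 : (C * (r * ℓ + 0)) ^ 2 ≤ (ρ * ℓ) ^ 2 := by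
    refine pow_le_pow_left₀ (by positivity) ?_ 2
    rw [add_zero, ← mul_assoc]; gcongr
  have h3 : ρ' ^ 2 ≤ ρ ^ 2 * (‖w‖ ^ 2 + ℓ ^ 2) := by nlinarith
  have h4 : ρ ^ 2 * (‖w‖ ^ 2 + ℓ ^ 2) ≤ ρ ^ 2 * 1 := by gcongr
  nlinarith

/-- Let `Q k` increase, let `X` be triangular with respect to the blocks `Q (k + 1) - Q k`, and let
each `Q k * X * Q k` be within `r` of a compact operator. Then block operators `d k` of norm at most
`C`, from families that contain strongly small ones, can be picked so that all corners of `(∑ d) X`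
have norm at most `C r + ε`. -/
theorem exists_blocks_norm_le {Q : ℕ → H →L[ℂ] H} {X : H →L[ℂ] H} {r C ε : ℝ}
    (hQ : ∀ k, IsStarProjection (Q k)) (hQQ : ∀ k, Q k * Q (k + 1) = Q k)
    (hX : ∀ k, Q k * X = Q k * X * Q k)
    (hess : ∀ k, ∃ A K, Q k * X * Q k = A + K ∧ ‖A‖ ≤ r ∧ IsCompactOperator (adjoint K * K))
    (hr : 0 ≤ r) (hC : 0 ≤ C) (hε : 0 < ε) (𝒟 : ℕ → Set (H →L[ℂ] H))
    (h𝒟 : ∀ k, ∀ D ∈ 𝒟 k, (Q (k + 1) - Q k) * D * (Q (k + 1) - Q k) = D ∧ ‖D‖ ≤ C)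
    (hsmall : ∀ k, ∀ F : Finset H, ∀ η : ℝ, 0 < η → ∃ D ∈ 𝒟 k, ∀ x ∈ F, ‖D x‖ < η) :
    ∃ d : ℕ → H →L[ℂ] H, (∀ k, d k ∈ 𝒟 k) ∧
      ∀ k, ‖(∑ j ∈ Finset.range k, d j) * X * Q k‖ ≤ C * r + ε := by
  let Good : ℕ → (H →L[ℂ] H) → Prop := fun k S =>
    Q k * S * Q k = S ∧ ‖S‖ ≤ C ∧ ‖S * X * Q k‖ ≤ C * r + ε * (1 - (1 / 2) ^ k)
  have step : ∀ k S, Good k S → ∃ D ∈ 𝒟 k, Good (k + 1) (S + D) := by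
    rintro k S ⟨h1, h2, h3⟩
    have hR : IsStarProjection (Q (k + 1) - Q k) := (hQ k).sub_of_mul_eq_left (hQ _) (hQQ k)
    have hQR : Q k * (Q (k + 1) - Q k) = 0 := by
      rw [mul_sub, hQQ, (hQ k).isIdempotentElem.eq, sub_self]
    have hRQ : (Q (k + 1) - Q k) * Q k = 0 := by
      have := congr(star $hQR)
      rwa [star_mul, (hQ k).isSelfAdjoint.star_eq, hR.isSelfAdjoint.star_eq, star_zero] at this
    have hsum : Q k + (Q (k + 1) - Q k) = Q (k + 1) := by abel
    obtain ⟨A, K, hAK, hA, hK⟩ := hess (k + 1)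
    have hpow : (0 : ℝ) < (1 / 2) ^ k := by positivity
    have hpow1 : ((1 : ℝ) / 2) ^ k ≤ 1 := pow_le_one₀ (by norm_num) (by norm_num)
    obtain ⟨D, hD, hDn⟩ := exists_small_extension (hQ k) hR hQR (hX k)
      (by rw [hsum]; exact hAK) hA hK h1 h2 h3 (ρ' := C * r + ε * (1 - (1 / 2) ^ (k + 1)))
      (by nlinarith) (by rw [pow_succ]; nlinarith) (𝒟 k) (h𝒟 k) (hsmall k)
    obtain ⟨hD1, hD2⟩ := h𝒟 k D hD
    refine ⟨D, hD, ?_, norm_add_le_of_blocks (hQ k) hR hQR h1 hD1 h2 hD2, by rwa [hsum] at hDn⟩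
    have hq := (hQ k).isIdempotentElem.eq
    have hrr := hR.isIdempotentElem.eq
    set R := Q (k + 1) - Q k
    have a1 : Q k * S = S := by rw [← h1]; simp only [← mul_assoc, hq]
    have a2 : S * Q k = S := by rw [← h1]; simp only [mul_assoc, hq]
    have a3 : R * D = D := by rw [← hD1]; simp only [← mul_assoc, hrr]
    have a4 : D * R = D := by rw [← hD1]; simp only [mul_assoc, hrr]
    have a5 : Q k * D = 0 := by rw [← a3, ← mul_assoc, hQR, zero_mul]
    have a6 : D * Q k = 0 := by rw [← a4, mul_assoc, hRQ, mul_zero]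
    have a7 : R * S = 0 := by rw [← a1, ← mul_assoc, hRQ, zero_mul]
    have a8 : S * R = 0 := by rw [← a2, mul_assoc, hQR, mul_zero]
    rw [← hsum]
    simp only [add_mul, mul_add, a1, a2, a3, a4, a5, a6, a7, a8, zero_mul]
    abel
  have good0 : Good 0 0 := ⟨by simp, by simpa using hC, by simpa using mul_nonneg hC hr⟩
  choose! next hnext1 hnext2 using step
  let σ : ∀ k : ℕ, {S // Good k S} := fun k =>
    Nat.rec ⟨0, good0⟩ (fun k S => ⟨S.1 + next k S.1, hnext2 k S.1 S.2⟩) k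
  refine ⟨fun k => next k (σ k).1, fun k => hnext1 k _ (σ k).2, fun k => ?_⟩
  have hs : ∀ k, ∑ j ∈ Finset.range k, next j (σ j).1 = (σ k).1 := by
    intro k
    induction k with
    | zero => rfl
    | succ k ih => rw [Finset.sum_range_succ, ih]
  rw [hs]
  refine (σ k).2.2.2.trans ?_
  have hpow : (0 : ℝ) < (1 / 2) ^ k := by positivity
  nlinarith

/-! ### Compact operators -/

omit [CompleteSpace H] in
theorem isCompactOperator_rankOne (u v : H) :
    IsCompactOperator (InnerProductSpace.rankOne ℂ u v : H →L[ℂ] H) := by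
  have h : IsCompactOperator (innerSL ℂ v : H →L[ℂ] ℂ) :=
    isCompactOperator_of_locallyCompactSpace_dom (innerSL ℂ v)
  exact h.clm_comp (toSpanSingleton ℂ u)

omit [CompleteSpace H] in
/-- On contractions, smallness on a finite set controls the norm of the product with a given
compact operator. -/
theorem exists_finset_norm_mul_le {K : H →L[ℂ] H} (hK : IsCompactOperator K) {ε : ℝ}
    (hε : 0 < ε) : ∃ F : Finset H, ∀ T : H →L[ℂ] H, ‖T‖ ≤ 1 → (∀ x ∈ F, ‖T x‖ < ε / 2) →
      ‖T * K‖ ≤ ε := by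
  obtain ⟨S, hS, hsub⟩ := IsCompactOperator.image_closedBall_subset_compact
    (f := (K : H →ₗ[ℂ] H)) hK 1
  obtain ⟨t, ht, hcov⟩ := Metric.totallyBounded_iff.1 hS.totallyBounded (ε / 2) (by positivity)
  refine ⟨ht.toFinset, fun T hT hx => opNorm_le_of_unit_norm hε.le fun x hx1 => ?_⟩
  have hxS : K x ∈ S := hsub ⟨x, by simp [hx1], rfl⟩
  obtain ⟨y, hy, hxy⟩ := Set.mem_iUnion₂.1 (hcov hxS)
  rw [Metric.mem_ball, dist_eq_norm] at hxy
  have h1 : ‖T (K x - y)‖ ≤ ‖K x - y‖ := (T.le_of_opNorm_le hT _).trans (by simp)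
  have h2 := hx y (ht.mem_toFinset.2 hy)
  calc ‖(T * K) x‖ = ‖T (K x - y) + T y‖ := by rw [← map_add, sub_add_cancel]; rfl
    _ ≤ ‖T (K x - y)‖ + ‖T y‖ := norm_add_le _ _
    _ ≤ ε := by linarith

omit [CompleteSpace H] in
theorem exists_compact_of_essNorm_lt {X : H →L[ℂ] H} {r : ℝ} (h : essNorm X < r) :
    ∃ A K : H →L[ℂ] H, X = A + K ∧ ‖A‖ < r ∧ IsCompactOperator K := by
  obtain ⟨A, hA, hn⟩ := Submodule.Quotient.norm_mk_lt
    (Submodule.Quotient.mk X : (H →L[ℂ] H) ⧸ compactOperator (RingHom.id ℂ) H H)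
    (sub_pos.2 h)
  refine ⟨A, X - A, by abel, ?_, (Submodule.Quotient.eq _).1 hA.symm⟩
  have : ‖(Submodule.Quotient.mk X : (H →L[ℂ] H) ⧸ compactOperator (RingHom.id ℂ) H H)‖ =
    essNorm X := rfl
  linarith

theorem essNorm_eq_zero_of_isCompactOperator {K : H →L[ℂ] H} (hK : IsCompactOperator K) :
    essNorm K = 0 := by
  have h : (Submodule.Quotient.mk K : (H →L[ℂ] H) ⧸ compactOperator (RingHom.id ℂ) H H) = 0 :=
    (Submodule.Quotient.mk_eq_zero _).2 hK
  unfold essNorm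
  rw [h, norm_zero]

omit [CompleteSpace H] in
/-- If `T` is coercive with an additional term along `u`, a solution of `T y = u` is small. -/
theorem norm_sq_le_of_coercive {T : H →L[ℂ] H} {c lam : ℝ} (hlam : 0 < lam) {u y : H}
    (hy : T y = u) (h : c * ‖y‖ ^ 2 + lam / 2 * ‖⟪u, y⟫_ℂ‖ ^ 2 ≤ RCLike.re ⟪T y, y⟫_ℂ) :
    c * ‖y‖ ^ 2 ≤ 2 / lam := by
  rw [hy] at h
  have h1 : RCLike.re ⟪u, y⟫_ℂ ≤ ‖⟪u, y⟫_ℂ‖ := RCLike.re_le_norm _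
  set t := ‖⟪u, y⟫_ℂ‖
  have h2 : t - lam / 2 * t ^ 2 ≤ 2 / lam := by
    rw [le_div_iff₀ hlam]
    nlinarith [sq_nonneg (lam * t - 1)]
  linarith

end HilbertSpace

namespace ContinuousNest

variable {H : Type*} [NormedAddCommGroup H] [InnerProductSpace ℂ H] [CompleteSpace H]
  {𝒩 : ContinuousNest H}

/-! ### Order and strong continuity of the nest -/

noncomputable instance : LinearOrder 𝒩.Elem :=
  { (inferInstance : PartialOrder 𝒩.Elem) with
    le_total := fun L M => (lt_or_le L M).imp le_of_lt id
    toDecidableLE := Classical.decRel _ }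

theorem ne_zero_of_lt {L N : 𝒩.Elem} (h : L < N) : N ≠ 𝒩.zero := by
  have h0 : 𝒩.zero < N := lt_of_le_of_lt (show 𝒩.zero.1 ≤ L.1 from bot_le) h
  exact h0.ne'

theorem ne_one_of_lt {N M : 𝒩.Elem} (h : N < M) : N ≠ 𝒩.one := by
  have h1 : N < 𝒩.one := lt_of_lt_of_le h (show M.1 ≤ 𝒩.one.1 from le_top)
  exact h1.ne

theorem isStarProjection_proj (N : 𝒩.Elem) : IsStarProjection (proj N) := by
  have : CompleteSpace N.1.toSubmodule := N.1.isClosed.completeSpace_coe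
  exact isStarProjection_starProjection

theorem proj_eq_self_iff {N : 𝒩.Elem} {x : H} : proj N x = x ↔ x ∈ N.1 := by
  have : CompleteSpace N.1.toSubmodule := N.1.isClosed.completeSpace_coe
  exact Submodule.starProjection_eq_self_iff

theorem proj_apply_mem (N : 𝒩.Elem) (x : H) : proj N x ∈ N.1 := by
  have : CompleteSpace N.1.toSubmodule := N.1.isClosed.completeSpace_coe
  exact Submodule.starProjection_apply_mem _ x

theorem isStarProjection_sub {L M : 𝒩.Elem} (h : L ≤ M) :
    IsStarProjection (proj M - proj L) :=
  (isStarProjection_proj L).sub_of_mul_eq_left (isStarProjection_proj M) (proj_mul_of_le h)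

theorem mem_alg_iff {X : H →L[ℂ] H} :
    X ∈ 𝒩.alg ↔ ∀ N : 𝒩.Elem, proj N * X * proj N = X * proj N := by
  constructor
  · intro h N
    ext x
    exact proj_eq_self_iff.2 (h N.1 N.2 _ (proj_apply_mem N x))
  · intro h N hN x hx
    have h1 := congr($(h ⟨N, hN⟩) x)
    have h2 : proj (𝒩 := 𝒩) ⟨N, hN⟩ x = x := proj_eq_self_iff.2 hx
    change proj _ (X (proj _ x)) = X (proj _ x) at h1
    rw [h2] at h1
    exact proj_eq_self_iff.1 h1

/-- Projections of a continuous nest are strongly continuous from the left. -/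
theorem exists_lt_norm_sub_lt {N : 𝒩.Elem} (hN : N ≠ 𝒩.zero) (x : H) {ε : ℝ} (hε : 0 < ε) :
    ∃ L < N, ∀ L', L ≤ L' → L' ≤ N → ‖(proj N - proj L') x‖ < ε := by
  have hmem : proj N x ∈ sSup {L | L ∈ 𝒩.carrier ∧ L < N.1} := by
    rw [𝒩.continuous N.1 N.2]; exact proj_apply_mem N x
  rw [ClosedSubmodule.mem_sSup] at hmem
  obtain ⟨u, hu, hxu⟩ := Metric.mem_closure_iff.1 hmem ε hε
  rw [dist_eq_norm] at hxu
  have hdir : DirectedOn (· ≤ ·)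
      ((fun L : ClosedSubmodule ℂ H => L.toSubmodule) '' {L | L ∈ 𝒩.carrier ∧ L < N.1}) := by
    rintro _ ⟨A, hA, rfl⟩ _ ⟨B, hB, rfl⟩
    rcases 𝒩.isChain.total hA.1 hB.1 with h | h
    · exact ⟨_, ⟨B, hB, rfl⟩, h, le_rfl⟩
    · exact ⟨_, ⟨A, hA, rfl⟩, le_rfl, h⟩
  have hu' : u ∈ sSup ((fun L : ClosedSubmodule ℂ H => L.toSubmodule) ''
      {L | L ∈ 𝒩.carrier ∧ L < N.1}) := by rw [sSup_image]; exact hu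
  have hne : ((fun L : ClosedSubmodule ℂ H => L.toSubmodule) ''
      {L | L ∈ 𝒩.carrier ∧ L < N.1}).Nonempty := ⟨_, ⊥, ⟨𝒩.bot_mem, zero_lt hN⟩, rfl⟩
  rw [Submodule.mem_sSup_of_directed hne hdir] at hu'
  obtain ⟨_, ⟨L, hL, rfl⟩, huL⟩ := hu'
  refine ⟨⟨L, hL.1⟩, hL.2, fun L' hLL' hL'N => ?_⟩
  have hu2 : proj L' u = u := proj_eq_self_iff.2 (hLL' huL)
  have e : (proj N - proj L') x = (1 - proj L') (proj N x - u) := by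
    have h1 : proj L' (proj N x) = proj L' x := congr($(proj_mul_of_le hL'N) x)
    simp only [sub_apply, map_sub, one_apply_eq_self, h1, hu2]; abel
  rw [e]
  exact (((1 - proj L').le_of_opNorm_le (IsStarProjection.norm_le _
    (isStarProjection_proj L').one_sub) _).trans (by simp)).trans_lt hxu

/-- Projections of a continuous nest are strongly continuous from the right: a weak limit of
`(M - N) x` as `M` decreases to `N` lies in every `M`, hence in `N`, and is orthogonal to `N`. -/
theorem exists_gt_norm_sub_lt {N : 𝒩.Elem} (hN : N ≠ 𝒩.one) (x : H) {ε : ℝ} (hε : 0 < ε) :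
    ∃ M > N, ∀ M', N ≤ M' → M' ≤ M → ‖(proj M' - proj N) x‖ < ε := by
  have hne : Nonempty {M : 𝒩.Elem // N < M} := ⟨⟨𝒩.one, lt_one hN⟩⟩
  set 𝒰 := Ultrafilter.of (atBot : Filter {M : 𝒩.Elem // N < M})
  have h𝒰 : ↑𝒰 ≤ (atBot : Filter {M : 𝒩.Elem // N < M}) := Ultrafilter.of_le _
  have hb : ∀ M : {M : 𝒩.Elem // N < M}, ‖(proj M.1 - proj N) x‖ ≤ ‖x‖ := fun M =>
    ((proj M.1 - proj N).le_of_opNorm_le (norm_proj_sub_le M.2.le) _).trans (by simp)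
  obtain ⟨w, hw⟩ := exists_weak_limit 𝒰 (fun M => (proj M.1 - proj N) x) ‖x‖ hb
  have hwM : ∀ M : 𝒩.Elem, N < M → w ∈ M.1 := by
    intro M hM
    rw [← proj_eq_self_iff]
    refine ext_inner_left ℂ fun y => ?_
    rw [← (isStarProjection_proj M).inner_left]
    refine tendsto_nhds_unique (hw (proj M y)) ((hw y).congr' ?_)
    refine Filter.Eventually.filter_mono h𝒰 ?_
    filter_upwards [eventually_le_atBot (⟨M, hM⟩ : {M : 𝒩.Elem // N < M})] with M' hM'
    rw [(isStarProjection_proj M).inner_left]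
    have h1 : proj M * (proj M'.1 - proj N) = proj M'.1 - proj N := by
      rw [mul_sub, mul_proj_of_le hM', mul_proj_of_le hM.le]
    exact congr(⟪y, $h1.symm x⟫_ℂ)
  have hwN : w ∈ N.1 := by
    set I : 𝒩.Elem := ⟨sInf {M | ∃ h : M ∈ 𝒩.carrier, N < ⟨M, h⟩},
      𝒩.sInf_mem _ fun M hM => hM.1⟩
    have hI : w ∈ I.1 := ClosedSubmodule.mem_sInf.2 fun M ⟨h, hM⟩ => hwM ⟨M, h⟩ hM
    rcases lt_or_le N I with h | h
    · obtain ⟨K, hNK, hKI⟩ := exists_between_of_lt h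
      exact absurd (show I.1 ≤ K.1 from sInf_le ⟨K.2, hNK⟩) (not_le_of_gt hKI)
    · exact h hI
  have hw0 : w = 0 := by
    rw [← proj_eq_self_iff.2 hwN]
    refine ext_inner_left ℂ fun y => ?_
    rw [← (isStarProjection_proj N).inner_left, inner_zero_right]
    refine tendsto_nhds_unique (hw (proj N y)) (tendsto_const_nhds.congr fun M => ?_)
    have h1 : proj N * (proj M.1 - proj N) = 0 := by
      rw [mul_sub, proj_mul_of_le M.2.le, (isStarProjection_proj N).isIdempotentElem.eq, sub_self]
    exact (inner_eq_zero_of_mul_eq_zero (isStarProjection_proj N) h1 y x).symm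
  have hlim : Tendsto (fun M : {M : 𝒩.Elem // N < M} => ‖⟪x, (proj M.1 - proj N) x⟫_ℂ‖) 𝒰
      (𝓝 0) := by simpa [hw0] using (hw x).norm
  obtain ⟨M, hM⟩ := (hlim.eventually_lt_const (show 0 < ε ^ 2 by positivity)).exists
  refine ⟨M.1, M.2, fun M' h1 h2 => ?_⟩
  have hs := isStarProjection_sub M.2.le
  have e1 : ‖(proj M.1 - proj N) x‖ ^ 2 < ε ^ 2 := by
    refine lt_of_le_of_lt ?_ hM
    rw [← inner_self_eq_norm_sq (𝕜 := ℂ), hs.inner_left]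
    have : (proj M.1 - proj N) ((proj M.1 - proj N) x) = (proj M.1 - proj N) x :=
      congr($(hs.isIdempotentElem.eq) x)
    rw [this]
    exact RCLike.re_le_norm _
  have e2 : (proj M' - proj N) * (proj M.1 - proj N) = proj M' - proj N := by
    simp only [mul_sub, sub_mul, proj_mul_of_le h2, proj_mul_of_le M.2.le, mul_proj_of_le h1,
      (isStarProjection_proj N).isIdempotentElem.eq]
    abel
  have e3 : ‖(proj M' - proj N) x‖ ≤ ‖(proj M.1 - proj N) x‖ := by
    calc _ = ‖(proj M' - proj N) ((proj M.1 - proj N) x)‖ := congr(‖$e2.symm x‖)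
      _ ≤ _ := ((proj M' - proj N).le_of_opNorm_le (norm_proj_sub_le h1) _).trans (by simp)
  exact e3.trans_lt (lt_of_pow_lt_pow_left₀ 2 hε.le e1)

theorem exists_lt_forall_norm_sub_lt {N : 𝒩.Elem} (hN : N ≠ 𝒩.zero) (F : Finset H) {ε : ℝ}
    (hε : 0 < ε) :
    ∃ L < N, ∀ L', L ≤ L' → L' ≤ N → ∀ x ∈ F, ‖(proj N - proj L') x‖ < ε := by
  classical
  induction F using Finset.induction_on with
  | empty => exact ⟨𝒩.zero, zero_lt hN, by simp⟩
  | insert x F _ ih =>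
    obtain ⟨L₁, h1, h2⟩ := ih
    obtain ⟨L₂, h3, h4⟩ := exists_lt_norm_sub_lt hN x hε
    refine ⟨max L₁ L₂, max_lt h1 h3, fun L' hL hLN y hy => ?_⟩
    rcases Finset.mem_insert.1 hy with rfl | hy
    · exact h4 L' ((le_max_right _ _).trans hL) hLN
    · exact h2 L' ((le_max_left _ _).trans hL) hLN y hy

theorem exists_gt_forall_norm_sub_lt {N : 𝒩.Elem} (hN : N ≠ 𝒩.one) (F : Finset H) {ε : ℝ}
    (hε : 0 < ε) :
    ∃ M > N, ∀ M', N ≤ M' → M' ≤ M → ∀ x ∈ F, ‖(proj M' - proj N) x‖ < ε := by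
  classical
  induction F using Finset.induction_on with
  | empty => exact ⟨𝒩.one, lt_one hN, by simp⟩
  | insert x F _ ih =>
    obtain ⟨M₁, h1, h2⟩ := ih
    obtain ⟨M₂, h3, h4⟩ := exists_gt_norm_sub_lt hN x hε
    refine ⟨min M₁ M₂, lt_min h1 h3, fun M' hL hLN y hy => ?_⟩
    rcases Finset.mem_insert.1 hy with rfl | hy
    · exact h4 M' hL (hLN.trans (min_le_right _ _))
    · exact h2 M' hL (hLN.trans (min_le_left _ _)) y hy

/-- Local-to-global principle on a nest: if short steps at every point satisfy `p`, any two
members are joined by a finite chain of such steps. -/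
theorem reflTransGen_of_local (p : 𝒩.Elem → 𝒩.Elem → Prop) {a b : 𝒩.Elem} (hab : a ≤ b)
    (hleft : ∀ N, a < N → N ≤ b → ∃ L < N, ∀ s, L ≤ s → s < N → p s N)
    (hright : ∀ N, a ≤ N → N < b → ∃ M > N, ∀ t, N < t → t ≤ M → p N t) :
    Relation.ReflTransGen (fun s t => s ≤ t ∧ p s t) a b := by
  set S : Set 𝒩.Elem := {c | a ≤ c ∧ c ≤ b ∧ Relation.ReflTransGen (fun s t => s ≤ t ∧ p s t) a c}
  have haS : a ∈ S := ⟨le_rfl, hab, .refl⟩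
  set σ : 𝒩.Elem := ⟨sSup (Subtype.val '' S), 𝒩.sSup_mem _ (by rintro _ ⟨c, -, rfl⟩; exact c.2)⟩
  have hle : ∀ c ∈ S, c ≤ σ := fun c hc => show c.1 ≤ σ.1 from le_sSup ⟨c, hc, rfl⟩
  have hlub : ∀ c, (∀ s ∈ S, s ≤ c) → σ ≤ c := fun c hc => show σ.1 ≤ c.1 from
    sSup_le (by rintro _ ⟨s, hs, rfl⟩; exact hc s hs)
  have haσ : a ≤ σ := hle a haS
  have hσb : σ ≤ b := hlub b fun c hc => hc.2.1
  have hσS : σ ∈ S := by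
    rcases haσ.eq_or_lt with h | h
    · rwa [← h]
    · obtain ⟨L, hL, hLp⟩ := hleft σ h hσb
      obtain ⟨c, hc, hLc⟩ : ∃ c ∈ S, L < c := by
        by_contra! hcon
        exact absurd (hlub L hcon) (not_le_of_gt hL)
      rcases (hle c hc).eq_or_lt with h' | h'
      · rwa [← h']
      · exact ⟨haσ, hσb, hc.2.2.tail ⟨h'.le, hLp c hLc.le h'⟩⟩
  rcases hσb.eq_or_lt with h | h
  · rw [← h]; exact hσS.2.2
  · obtain ⟨M, hM, hMp⟩ := hright σ haσ h
    have hm : σ < min M b := lt_min hM h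
    have : min M b ∈ S := ⟨haσ.trans hm.le, min_le_right _ _,
      hσS.2.2.tail ⟨hm.le, hMp _ hm (min_le_left _ _)⟩⟩
    exact absurd (hle _ this) (not_le_of_gt hm)

/-! ### Algebra of intervals of the nest -/

theorem mem_alg_iff_one_sub {X : H →L[ℂ] H} :
    X ∈ 𝒩.alg ↔ ∀ N : 𝒩.Elem, (1 - proj N) * X * proj N = 0 := by
  rw [mem_alg_iff]
  refine forall_congr' fun N => ?_
  rw [sub_mul, sub_mul, one_mul, sub_eq_zero, eq_comm]

theorem interval_mul_interval {L L' M' M : 𝒩.Elem} (h1 : L ≤ L') (h2 : L' ≤ M') (h3 : M' ≤ M) :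
    (proj M - proj L) * (proj M' - proj L') = proj M' - proj L' := by
  simp only [mul_sub, sub_mul, mul_proj_of_le h3, proj_mul_of_le h1,
    proj_mul_of_le (h1.trans h2), mul_proj_of_le (h2.trans h3)]
  abel

theorem interval_mul_interval' {L L' M' M : 𝒩.Elem} (h1 : L ≤ L') (h2 : L' ≤ M') (h3 : M' ≤ M) :
    (proj M' - proj L') * (proj M - proj L) = proj M' - proj L' := by
  simp only [mul_sub, sub_mul, proj_mul_of_le h3, mul_proj_of_le h1,
    mul_proj_of_le (h1.trans h2), proj_mul_of_le (h2.trans h3)]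
  abel

theorem interval_mul_self {L M : 𝒩.Elem} (h : L ≤ M) :
    (proj M - proj L) * (proj M - proj L) = proj M - proj L :=
  interval_mul_interval le_rfl h le_rfl

theorem interval_mul_eq_zero {L M L' M' : 𝒩.Elem} (h1 : L ≤ M) (h2 : L' ≤ M')
    (h : M ≤ L' ∨ M' ≤ L) : (proj M - proj L) * (proj M' - proj L') = 0 := by
  rcases h with h | h
  · simp only [mul_sub, sub_mul, proj_mul_of_le h, proj_mul_of_le (h.trans h2),
      proj_mul_of_le (h1.trans h), proj_mul_of_le ((h1.trans h).trans h2)]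
    abel
  · simp only [mul_sub, sub_mul, mul_proj_of_le h, mul_proj_of_le (h.trans h1),
      mul_proj_of_le (h2.trans h), mul_proj_of_le ((h2.trans h).trans h1)]
    abel

/-- The range of an interval of the nest absorbs an operator supported on a smaller interval. -/
theorem interval_support_mono {L L' M' M : 𝒩.Elem} (h1 : L ≤ L') (h2 : L' ≤ M') (h3 : M' ≤ M)
    {A : H →L[ℂ] H} (hA : (proj M' - proj L') * A * (proj M' - proj L') = A) :
    (proj M - proj L) * A * (proj M - proj L) = A := by
  rw [← hA]
  calc _ = ((proj M - proj L) * (proj M' - proj L')) * A *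
        ((proj M' - proj L') * (proj M - proj L)) := by simp only [mul_assoc]
    _ = _ := by rw [interval_mul_interval h1 h2 h3, interval_mul_interval' h1 h2 h3]

theorem interval_support_eq_zero {L M L' M' : 𝒩.Elem} (h1 : L ≤ M) (h2 : L' ≤ M')
    (h : M ≤ L' ∨ M' ≤ L) {A : H →L[ℂ] H}
    (hA : (proj M' - proj L') * A * (proj M' - proj L') = A) :
    (proj M - proj L) * A * (proj M - proj L) = 0 := by
  rw [← hA]
  calc _ = ((proj M - proj L) * (proj M' - proj L')) * A *
        ((proj M' - proj L') * (proj M - proj L)) := by simp only [mul_assoc]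
    _ = _ := by rw [interval_mul_eq_zero h1 h2 h, zero_mul, zero_mul]

theorem interval_eq_mul {L M : 𝒩.Elem} (h : L ≤ M) :
    proj M - proj L = proj M * (1 - proj L) := by
  rw [mul_sub, mul_one, mul_proj_of_le h]

theorem interval_mul_mul_proj {L M : 𝒩.Elem} (h : L ≤ M) {A : H →L[ℂ] H} (hA : A ∈ 𝒩.alg) :
    (proj M - proj L) * A * proj L = 0 := by
  rw [interval_eq_mul h, mul_assoc, mul_assoc, ← mul_assoc (1 - proj L),
    mem_alg_iff_one_sub.1 hA L, mul_zero]

theorem one_sub_mul_mul_interval {L M : 𝒩.Elem} (h : L ≤ M) {A : H →L[ℂ] H} (hA : A ∈ 𝒩.alg) :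
    (1 - proj M) * A * (proj M - proj L) = 0 := by
  rw [interval_eq_mul h, ← mul_assoc, mem_alg_iff_one_sub.1 hA M, zero_mul]

/-- Compression to an interval is multiplicative on the nest algebra. -/
theorem interval_compress_mul {L M : 𝒩.Elem} (h : L ≤ M) {A B : H →L[ℂ] H}
    (hA : A ∈ 𝒩.alg) (hB : B ∈ 𝒩.alg) :
    (proj M - proj L) * (A * B) * (proj M - proj L) =
      ((proj M - proj L) * A * (proj M - proj L)) *
        ((proj M - proj L) * B * (proj M - proj L)) := by
  calc (proj M - proj L) * (A * B) * (proj M - proj L)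
      = (proj M - proj L) * A * (proj M - proj L) * B * (proj M - proj L) +
        (proj M - proj L) * A * proj L * B * (proj M - proj L) +
        (proj M - proj L) * A * ((1 - proj M) * B * (proj M - proj L)) := by noncomm_ring
    _ = (proj M - proj L) * A * (proj M - proj L) * B * (proj M - proj L) := by
        rw [interval_mul_mul_proj h hA, one_sub_mul_mul_interval h hB]; simp
    _ = (proj M - proj L) * A * ((proj M - proj L) * (proj M - proj L)) * B *
        (proj M - proj L) := by rw [interval_mul_self h]
    _ = _ := by simp only [mul_assoc]

theorem interval_mul_mul_proj_right {L M : 𝒩.Elem} (h : L ≤ M) {X : H →L[ℂ] H}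
    (hX : X ∈ 𝒩.alg) :
    (proj M - proj L) * X * proj M = (proj M - proj L) * X * (proj M - proj L) := by
  rw [mul_sub, interval_mul_mul_proj h hX, sub_zero]

theorem one_sub_mul_mul_interval_left {L M : 𝒩.Elem} (h : L ≤ M) {X : H →L[ℂ] H}
    (hX : X ∈ 𝒩.alg) :
    (1 - proj L) * X * (proj M - proj L) = (proj M - proj L) * X * (proj M - proj L) := by
  have e : (1 - proj L : H →L[ℂ] H) = (proj M - proj L) + (1 - proj M) := by abel
  rw [e, add_mul, add_mul, one_sub_mul_mul_interval h hX, add_zero]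

theorem one_sub_mul_mul_proj {L M : 𝒩.Elem} (h : L ≤ M) {X : H →L[ℂ] H} (hX : X ∈ 𝒩.alg) :
    (1 - proj L) * X * proj M = (proj M - proj L) * X * (proj M - proj L) := by
  have e : proj M = (proj M - proj L) + proj L := by abel
  calc (1 - proj L) * X * proj M = (1 - proj L) * X * ((proj M - proj L) + proj L) := by
        rw [← e]
    _ = _ := by rw [mul_add, mem_alg_iff_one_sub.1 hX L, add_zero,
        one_sub_mul_mul_interval_left h hX]

theorem norm_interval_mono {L L' M' M : 𝒩.Elem} (h1 : L ≤ L') (h2 : L' ≤ M') (h3 : M' ≤ M)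
    (A : H →L[ℂ] H) : ‖(proj M' - proj L') * A * (proj M' - proj L')‖ ≤
      ‖(proj M - proj L) * A * (proj M - proj L)‖ := by
  have hp := norm_proj_sub_le h2
  have e : (proj M' - proj L') * A * (proj M' - proj L') = (proj M' - proj L') *
      ((proj M - proj L) * A * (proj M - proj L)) * (proj M' - proj L') := by
    nth_rewrite 1 [← interval_mul_interval' h1 h2 h3]
    nth_rewrite 2 [← interval_mul_interval h1 h2 h3]
    simp only [mul_assoc]
  rw [e]
  calc _ ≤ ‖proj M' - proj L'‖ * ‖(proj M - proj L) * A * (proj M - proj L)‖ *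
        ‖proj M' - proj L'‖ := (norm_mul_le _ _).trans (by gcongr; exact norm_mul_le _ _)
    _ ≤ 1 * ‖(proj M - proj L) * A * (proj M - proj L)‖ * 1 := by gcongr
    _ = _ := by ring

theorem norm_interval_mul_mul_le {L M : 𝒩.Elem} (h : L ≤ M) (A : H →L[ℂ] H) :
    ‖(proj M - proj L) * A * (proj M - proj L)‖ ≤ ‖A‖ := by
  have hp := norm_proj_sub_le h
  calc _ ≤ ‖proj M - proj L‖ * ‖A‖ * ‖proj M - proj L‖ :=
        (norm_mul_le _ _).trans (by gcongr; exact norm_mul_le _ _)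
    _ ≤ 1 * ‖A‖ * 1 := by gcongr
    _ = _ := by ring

omit [CompleteSpace H] in
theorem isCompactOperator_mul_mul {K : H →L[ℂ] H} (hK : IsCompactOperator K) (A B : H →L[ℂ] H) :
    IsCompactOperator (A * K * B) :=
  (hK.clm_comp A).comp_clm B

/-! ### Approximate identities of compact operators in the nest algebra -/

theorem rankOne_mem_alg {s : 𝒩.Elem} {u v : H} (hu : u ∈ s.1) (hv : proj s v = 0) :
    InnerProductSpace.rankOne ℂ u v ∈ 𝒩.alg := by
  intro N hN y hy
  rw [InnerProductSpace.rankOne_apply]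
  rcases lt_or_le s ⟨N, hN⟩ with h | h
  · exact N.toSubmodule.smul_mem _ (h.le hu)
  · have hys : proj s y = y := proj_eq_self_iff.2 (h hy)
    rw [← hys, ← (isStarProjection_proj s).inner_left, hv, inner_zero_left, zero_smul]
    exact N.toSubmodule.zero_mem

/-- On an interval of the nest there is a finite rank operator in the nest algebra whose real
part is close to half the sum of the rank one projections onto given vectors `x`. It is the
discrete version of the Volterra type integral `∫ N x ⊗ d(N x)`. -/
theorem exists_compact_accretive {a b : 𝒩.Elem} (hab : a ≤ b) (F : Finset H) {ε : ℝ}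
    (hε : 0 < ε) :
    ∃ V ∈ 𝒩.alg, IsCompactOperator V ∧ (proj b - proj a) * V * (proj b - proj a) = V ∧
      ∀ y, 1 / 2 * ∑ x ∈ F, ‖⟪(proj b - proj a) x, y⟫_ℂ‖ ^ 2 -
        1 / 2 * (F.card * ε ^ 2) * ‖(proj b - proj a) y‖ ^ 2 ≤ RCLike.re ⟪V y, y⟫_ℂ := by
  have hchain := reflTransGen_of_local (𝒩 := 𝒩)
    (fun s t => ∀ x ∈ F, ‖(proj t - proj s) x‖ < ε) hab
    (fun N haN _ => by
      obtain ⟨L, hL, h⟩ := exists_lt_forall_norm_sub_lt (N := N)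
        (ne_zero_of_lt haN) F hε
      exact ⟨L, hL, fun s h1 h2 => h s h1 h2.le⟩)
    (fun N _ hNb => by
      obtain ⟨M, hM, h⟩ := exists_gt_forall_norm_sub_lt (N := N)
        (ne_one_of_lt hNb) F hε
      exact ⟨M, hM, fun t h1 h2 => h t h1.le h2⟩)
  suffices h : a ≤ b ∧ ∃ V ∈ 𝒩.alg, IsCompactOperator V ∧
      (proj b - proj a) * V * (proj b - proj a) = V ∧
      ∀ y, 1 / 2 * ∑ x ∈ F, ‖⟪(proj b - proj a) x, y⟫_ℂ‖ ^ 2 -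
        1 / 2 * (F.card * ε ^ 2) * ‖(proj b - proj a) y‖ ^ 2 ≤ RCLike.re ⟪V y, y⟫_ℂ from h.2
  clear hab
  induction hchain with
  | refl => exact ⟨le_rfl, 0, 𝒩.alg.zero_mem, isCompactOperator_zero, by simp, by simp⟩
  | @tail s t _ hst ih =>
    obtain ⟨has, V, hV, hVc, hVs, hVre⟩ := ih
    obtain ⟨hst, hsmall⟩ := hst
    have hat := has.trans hst
    have hps := isStarProjection_sub hst
    refine ⟨hat, V + ∑ x ∈ F, InnerProductSpace.rankOne ℂ ((proj s - proj a) x)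
      ((proj t - proj s) x), ?_, ?_, ?_, fun y => ?_⟩
    · refine 𝒩.alg.add_mem hV (sum_mem fun x _ => rankOne_mem_alg (s := s) ?_ ?_)
      · rw [← proj_eq_self_iff]
        have : proj s * (proj s - proj a) = proj s - proj a := by
          rw [mul_sub, mul_proj_of_le le_rfl, mul_proj_of_le has]
        exact congr($this x)
      · have : proj s * (proj t - proj s) = 0 := by
          rw [mul_sub, proj_mul_of_le le_rfl, proj_mul_of_le hst, sub_self]
        exact congr($this x)
    · have : ∀ G : Finset H, IsCompactOperator (∑ x ∈ G, InnerProductSpace.rankOne ℂ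
          ((proj s - proj a) x) ((proj t - proj s) x) : H →L[ℂ] H) := fun G =>
        Submodule.sum_mem (compactOperator (RingHom.id ℂ) H H)
          fun x _ => isCompactOperator_rankOne _ _
      exact hVc.add (this F)
    · rw [mul_add, add_mul, interval_support_mono le_rfl has hst hVs, Finset.mul_sum,
        Finset.sum_mul]
      congr 1
      refine Finset.sum_congr rfl fun x _ => ?_
      ext y
      have e1 : (proj t - proj a) ((proj s - proj a) x) = (proj s - proj a) x :=
        congr($(interval_mul_interval le_rfl has hst) x)
      have e2 : (proj t - proj a) ((proj t - proj s) x) = (proj t - proj s) x :=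
        congr($(interval_mul_interval has hst le_rfl) x)
      change (proj t - proj a) (InnerProductSpace.rankOne ℂ _ _ ((proj t - proj a) y)) = _
      rw [InnerProductSpace.rankOne_apply, InnerProductSpace.rankOne_apply, map_smul, e1,
        ← (isStarProjection_sub hat).inner_left, e2]
    · have hsplit : ‖(proj t - proj a) y‖ ^ 2 =
          ‖(proj t - proj s) y‖ ^ 2 + ‖(proj s - proj a) y‖ ^ 2 := by
        rw [← norm_sq_add_of_mul_eq_zero hps (interval_mul_eq_zero hst has (Or.inr le_rfl))]
        congr 2
        simp only [sub_apply]; abel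
      have hterm : ∀ x ∈ F, 1 / 2 * ‖⟪(proj t - proj a) x, y⟫_ℂ‖ ^ 2 ≤
          1 / 2 * ‖⟪(proj s - proj a) x, y⟫_ℂ‖ ^ 2 + RCLike.re
            ⟪InnerProductSpace.rankOne ℂ ((proj s - proj a) x) ((proj t - proj s) x) y, y⟫_ℂ +
          1 / 2 * (ε ^ 2 * ‖(proj t - proj s) y‖ ^ 2) := fun x hx => by
        rw [InnerProductSpace.rankOne_apply, inner_smul_left]
        set α := ⟪(proj s - proj a) x, y⟫_ℂ with hα
        set β := ⟪(proj t - proj s) x, y⟫_ℂ with hβ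
        have hαβ : ⟪(proj t - proj a) x, y⟫_ℂ = α + β := by
          rw [hα, hβ, ← inner_add_left]
          congr 1
          simp only [sub_apply]; abel
        have hβn : ‖β‖ ≤ ε * ‖(proj t - proj s) y‖ := by
          have : β = ⟪(proj t - proj s) x, (proj t - proj s) y⟫_ℂ := by
            rw [← hps.inner_left]
            have : (proj t - proj s) ((proj t - proj s) x) = (proj t - proj s) x :=
              congr($(hps.isIdempotentElem.eq) x)
            rw [this]
          rw [this]
          exact (norm_inner_le_norm _ _).trans (by gcongr; exact (hsmall x hx).le)
        have hβ2 := pow_le_pow_left₀ (norm_nonneg _) hβn 2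
        have hexp : ‖α + β‖ ^ 2 = ‖α‖ ^ 2 + 2 * RCLike.re ((starRingEnd ℂ) β * α) + ‖β‖ ^ 2 := by
          rw [Complex.sq_norm, Complex.sq_norm, Complex.sq_norm, Complex.normSq_apply,
            Complex.normSq_apply, Complex.normSq_apply]
          simp only [Complex.add_re, Complex.add_im, RCLike.re_eq_complex_re, Complex.mul_re,
            Complex.conj_re, Complex.conj_im]
          ring
        rw [hαβ, hexp]
        rw [mul_pow] at hβ2
        linarith
      have hsum := Finset.sum_le_sum hterm
      simp only [Finset.sum_add_distrib, ← Finset.mul_sum, Finset.sum_const, nsmul_eq_mul] at hsum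
      have hVy := hVre y
      rw [add_apply, inner_add_left, map_add, sum_apply, sum_inner, map_sum, hsplit]
      nlinarith

/-- Compact operators of the nest algebra supported on an interval approximate the projection
`P` onto it, strongly together with adjoints, and with `‖P - E‖` close to one. For `T = 1 + λ V`
with `V` accretive up to a small error, `E = 1 - T⁻¹` has these properties when `λ` is large. -/
theorem exists_approximate_identity {a b : 𝒩.Elem} (hab : a ≤ b) (F : Finset H) {ε : ℝ}
    (hε : 0 < ε) :
    ∃ E ∈ 𝒩.alg, IsCompactOperator E ∧ (proj b - proj a) * E * (proj b - proj a) = E ∧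
      ‖(proj b - proj a) - E‖ ≤ 1 + ε ∧
      ∀ x ∈ F, ‖((proj b - proj a) - E) x‖ < ε ∧
        ‖adjoint ((proj b - proj a) - E) x‖ < ε := by
  set P := proj b - proj a with hPdef
  have hP : IsStarProjection P := isStarProjection_sub hab
  have hPP := hP.isIdempotentElem.eq
  -- `lam` makes `T⁻¹` smaller than `ε` on `F`, and `η` keeps the error of `lam • V` below `1 - c`
  set lam : ℝ := 4 * (1 + ε) / ε ^ 2 with hlam
  have hlam0 : 0 < lam := by positivity
  set η : ℝ := 2 * ε / ((1 + ε) * lam * (F.card + 1)) with hη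
  have hη0 : 0 < η := by positivity
  obtain ⟨V, hV, hVc, hVs, hVre⟩ := exists_compact_accretive hab F (Real.sqrt_pos.2 hη0)
  rw [Real.sq_sqrt hη0.le] at hVre
  rw [← hPdef] at hVs hVre
  set c : ℝ := 1 / (1 + ε) with hc
  have hc0 : 0 < c := by positivity
  set T : H →L[ℂ] H := 1 + (lam : ℂ) • V with hT
  have hTre : ∀ y, c * ‖y‖ ^ 2 + lam / 2 * ∑ x ∈ F, ‖⟪P x, y⟫_ℂ‖ ^ 2 ≤ RCLike.re ⟪T y, y⟫_ℂ := by
    intro y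
    have e1 : RCLike.re ⟪T y, y⟫_ℂ = ‖y‖ ^ 2 + lam * RCLike.re ⟪V y, y⟫_ℂ := by
      have : T y = y + (lam : ℂ) • V y := rfl
      rw [this, inner_add_left, inner_smul_left, map_add, inner_self_eq_norm_sq,
        Complex.conj_ofReal]
      congr 1
      exact Complex.re_ofReal_mul _ _
    have e2 : ‖P y‖ ^ 2 ≤ ‖y‖ ^ 2 := by
      rw [norm_sq_eq_add hP y]; nlinarith [sq_nonneg ‖(1 - P) y‖]
    have e3 : lam * (1 / 2 * (F.card * η)) ≤ 1 - c := by
      have h1 : lam * η * (F.card + 1) = 2 * (1 - c) := by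
        rw [hη, hc]; field_simp; ring
      nlinarith [mul_pos hlam0 hη0]
    have e4 : lam * (1 / 2 * (F.card * η)) * ‖P y‖ ^ 2 ≤ (1 - c) * ‖y‖ ^ 2 := by
      have : 0 ≤ lam * (1 / 2 * (F.card * η)) := by positivity
      exact mul_le_mul e3 e2 (by positivity) (this.trans e3)
    have e5 := mul_le_mul_of_nonneg_left (hVre y) hlam0.le
    rw [e1]
    nlinarith
  have hTre' : ∀ y, c * ‖y‖ ^ 2 ≤ RCLike.re ⟪T y, y⟫_ℂ := fun y =>
    le_trans (le_add_of_nonneg_right (by positivity)) (hTre y)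
  have hunit : IsUnit T := isUnit_of_forall_le_norm_inner_map (c := ⟨c, hc0.le⟩) T hc0 fun y => by
    rw [mul_comm]; exact (hTre' y).trans (RCLike.re_le_norm _)
  obtain ⟨D, hTD⟩ := hunit.exists_right_inv
  have hDT : D * T = 1 := by
    obtain ⟨D', hD'⟩ := hunit.exists_left_inv
    rwa [← left_inv_eq_right_inv hD' hTD]
  have hDn : ‖D‖ ≤ 1 + ε := by
    refine opNorm_le_bound _ (by positivity) fun y => ?_
    have h1 := hTre' (D y)
    have h2 : T (D y) = y := congr($hTD y)
    rw [h2] at h1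
    have h3 : RCLike.re ⟪y, D y⟫_ℂ ≤ ‖y‖ * ‖D y‖ := re_inner_le_norm _ _
    rcases (norm_nonneg (D y)).eq_or_lt with h | h
    · rw [← h]; positivity
    · have h4 : c * ‖D y‖ ≤ ‖y‖ := le_of_mul_le_mul_right (by nlinarith) h
      rw [hc, div_mul_eq_mul_div, one_mul, div_le_iff₀ (by positivity)] at h4
      linarith
  have hDsmall : ∀ (S D' : H →L[ℂ] H), S * D' = 1 →
      (∀ y, RCLike.re ⟪S y, y⟫_ℂ = RCLike.re ⟪T y, y⟫_ℂ) → ∀ x ∈ F, ‖D' (P x)‖ < ε := by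
    intro S D' hSD hre x hx
    have h1 : S (D' (P x)) = P x := congr($hSD (P x))
    have h2 : c * ‖D' (P x)‖ ^ 2 ≤ 2 / lam := by
      refine norm_sq_le_of_coercive hlam0 h1 ?_
      rw [hre]
      refine le_trans ?_ (hTre _)
      gcongr
      exact Finset.single_le_sum (f := fun x => ‖⟪P x, D' (P _)⟫_ℂ‖ ^ 2)
        (fun _ _ => by positivity) hx
    have h3 : 2 / lam = c * (ε ^ 2 / 2) := by rw [hlam, hc]; field_simp; norm_num
    rw [h3] at h2
    have h4 := le_of_mul_le_mul_left h2 hc0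
    exact lt_of_pow_lt_pow_left₀ 2 hε.le (by nlinarith [sq_pos_of_pos hε])
  have hTadj : ∀ y, RCLike.re ⟪adjoint T y, y⟫_ℂ = RCLike.re ⟪T y, y⟫_ℂ := fun y => by
    rw [adjoint_inner_left, inner_re_symm]
  have hDadj : adjoint T * adjoint D = 1 := by
    have := congr(star $hDT)
    rwa [star_mul, star_one] at this
  have hPV : P * V = V := by rw [← hVs]; simp only [← mul_assoc, hPP]
  have hVP : V * P = V := by rw [← hVs]; simp only [mul_assoc, hPP]
  have hE1 : 1 - D = ((lam : ℂ) • V) * D := by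
    have : T * D - D = ((lam : ℂ) • V) * D := by rw [hT, add_mul, one_mul]; abel
    rw [← this, hTD]
  have hE2 : 1 - D = D * ((lam : ℂ) • V) := by
    have : D * T - D = D * ((lam : ℂ) • V) := by rw [hT, mul_add, mul_one]; abel
    rw [← this, hDT]
  have hPE : P * (1 - D) = 1 - D := by
    rw [hE1, ← mul_assoc, mul_smul_comm, hPV]
  have hEP : (1 - D) * P = 1 - D := by
    rw [hE2, mul_assoc, smul_mul_assoc, hVP]
  have hPD : P - (1 - D) = P * D := by
    rw [← hPE]; noncomm_ring
  have hPD' : P - (1 - D) = D * P := by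
    rw [← hEP]; noncomm_ring
  have hPadj : adjoint P = P := hP.isSelfAdjoint.star_eq
  have hTalg : T ∈ 𝒩.alg := 𝒩.alg.add_mem 𝒩.alg.one_mem (𝒩.alg.smul_mem hV _)
  refine ⟨1 - D, 𝒩.alg.sub_mem 𝒩.alg.one_mem ?_, ?_, ?_, ?_, fun x hx => ⟨?_, ?_⟩⟩
  · -- coercivity keeps the resolvent in the nest algebra
    rw [mem_alg_iff_one_sub]
    intro N
    ext y
    set z := D (proj N y)
    have hN := (isStarProjection_proj N).one_sub
    have h1 : T z = proj N y := congr($hTD (proj N y))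
    have h2 : (1 - proj N) (T ((1 - proj N) z)) = 0 := by
      have e1 : (1 - proj N) * T * (1 - proj N) = (1 - proj N) * T := by
        rw [mul_sub, mul_one, mem_alg_iff_one_sub.1 hTalg N, sub_zero]
      have e2 : (1 - proj N) (T ((1 - proj N) z)) = (1 - proj N) (T z) := congr($e1 z)
      rw [e2, h1]
      exact congr($((isStarProjection_proj N).one_sub_mul_self) y)
    have h3 := hTre' ((1 - proj N) z)
    have h4 : ⟪T ((1 - proj N) z), (1 - proj N) z⟫_ℂ = 0 := by
      rw [← hN.inner_left, h2, inner_zero_left]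
    rw [h4, map_zero] at h3
    have h5 : ‖(1 - proj N) z‖ ^ 2 ≤ 0 := nonpos_of_mul_nonpos_right h3 hc0
    have h6 : ‖(1 - proj N) z‖ = 0 := by
      have := sq_nonneg ‖(1 - proj N) z‖
      exact pow_eq_zero_iff two_ne_zero |>.1 (le_antisymm h5 this)
    exact norm_eq_zero.1 h6
  · rw [hE1]
    exact (hVc.smul (lam : ℂ)).comp_clm D
  · rw [hPE, hEP]
  · rw [hPD]
    calc _ ≤ ‖P‖ * ‖D‖ := norm_mul_le _ _
      _ ≤ 1 * (1 + ε) := by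
        gcongr
        exact IsStarProjection.norm_le _ hP
      _ = _ := one_mul _
  · rw [hPD']
    exact hDsmall T D hTD (fun _ => rfl) x hx
  · have e : adjoint (P - (1 - D)) = adjoint D * P := by
      rw [hPD]
      have : star (P * D) = star D * star P := star_mul _ _
      rw [star_eq_adjoint, star_eq_adjoint, star_eq_adjoint, hPadj] at this
      exact this
    rw [e]
    exact hDsmall _ _ hDadj hTadj x hx

/-! ### Interpolation on intervals -/

/-- Interpolation on finitely many corners `(1 - c) X d`. The corners are added in increasing
order of `c`. A new corner that is no wider than an earlier one is a part of it; otherwise the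
columns of the earlier corners and the rows of the new one agree where they meet, so that they
have a common completion by Parrott's theorem. -/
theorem exists_interpolant_finset {X : H →L[ℂ] H} {ρ : ℝ} (hρ : 0 ≤ ρ)
    (s : Finset (𝒩.Elem × 𝒩.Elem)) (hs : ∀ p ∈ s, ‖(1 - proj p.1) * X * proj p.2‖ ≤ ρ) :
    ∀ ρ' > ρ, ∃ Z : H →L[ℂ] H, ‖Z‖ ≤ ρ' ∧
      ∀ p ∈ s, (1 - proj p.1) * Z * proj p.2 = (1 - proj p.1) * X * proj p.2 := by
  classical
  have hone : ∀ {c c' : 𝒩.Elem}, c' ≤ c → (1 - proj c) * (1 - proj c') = 1 - proj c := by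
    intro c c' h
    rw [mul_sub, mul_one, sub_mul, one_mul, mul_proj_of_le h]; abel
  induction s using Finset.induction_on_max_value (fun p : 𝒩.Elem × 𝒩.Elem => p.1) with
  | empty => exact fun ρ' h => ⟨0, by simpa using hρ.trans h.le, by simp⟩
  | insert q s hq hmax ih =>
    intro ρ' hρ'
    obtain ⟨Z, hZ, hZs⟩ := ih (fun p hp => hs p (Finset.mem_insert_of_mem hp)) ((ρ + ρ') / 2)
      (by linarith)
    have hqX := hs q (Finset.mem_insert_self _ _)
    have hqc := (isStarProjection_proj q.1).one_sub
    by_cases hcase : ∃ p ∈ s, q.2 ≤ p.2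
    · obtain ⟨p, hp, hpd⟩ := hcase
      refine ⟨Z, by linarith, fun p' hp' => ?_⟩
      rcases Finset.mem_insert.1 hp' with rfl | hp'
      · have e : ∀ Y : H →L[ℂ] H, (1 - proj p'.1) * Y * proj p'.2 =
            (1 - proj p'.1) * ((1 - proj p.1) * Y * proj p.2) * proj p'.2 := fun Y => by
          rw [← mul_assoc, ← mul_assoc, hone (hmax p hp), mul_assoc _ (proj p.2),
            mul_proj_of_le hpd]
        rw [e Z, e X, hZs p hp]
      · exact hZs p' hp'
    · push Not at hcase
      rcases s.eq_empty_or_nonempty with rfl | hne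
      · refine ⟨(1 - proj q.1) * X * proj q.2, by linarith, fun p hp => ?_⟩
        obtain rfl : p = q := by simpa using hp
        have e1 := hqc.isIdempotentElem.eq
        have e2 := (isStarProjection_proj p.2).isIdempotentElem.eq
        rw [← mul_assoc, ← mul_assoc, e1, mul_assoc _ _ (proj p.2), e2]
      · obtain ⟨m, hm, hmm⟩ := s.exists_max_image (fun p => p.2) hne
        have hmd : m.2 ≤ q.2 := (hcase m hm).le
        have hST : (1 - proj q.1) * Z * proj m.2 =
            (1 - proj q.1) * (X * proj q.2) * proj m.2 := by
          have e : ∀ Y : H →L[ℂ] H, (1 - proj q.1) * Y * proj m.2 =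
              (1 - proj q.1) * ((1 - proj m.1) * Y * proj m.2) := fun Y => by
            rw [← mul_assoc, ← mul_assoc, hone (hmax m hm)]
          rw [e Z, hZs m hm, ← e X, mul_assoc, mul_assoc, mul_assoc, mul_proj_of_le hmd]
        obtain ⟨W, hW, hW1, hW2⟩ := exists_completion (isStarProjection_proj m.2) hqc
          (S := Z) (T := X * proj q.2) (ρ := (ρ + ρ') / 2) (ρ' := ρ')
          (by
            calc _ ≤ ‖Z‖ * ‖proj m.2‖ := norm_mul_le _ _
              _ ≤ (ρ + ρ') / 2 * 1 := by
                gcongr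
                · linarith
                · exact IsStarProjection.norm_le _ (isStarProjection_proj m.2)
              _ = _ := mul_one _)
          (by rw [← mul_assoc]; linarith) hST (by linarith)
        refine ⟨W, hW, fun p hp => ?_⟩
        rcases Finset.mem_insert.1 hp with rfl | hp
        · rw [hW2, mul_assoc, mul_assoc, (isStarProjection_proj p.2).isIdempotentElem.eq,
            mul_assoc]
        · have e : ∀ Y : H →L[ℂ] H, (1 - proj p.1) * Y * proj p.2 =
              (1 - proj p.1) * (Y * proj m.2) * proj p.2 := fun Y => by
            rw [mul_assoc _ (Y * _), mul_assoc Y, mul_proj_of_le (hmm p hp), mul_assoc]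
          rw [e W, hW1, ← e Z, hZs p hp]

/-- Simultaneous interpolation, a form of Arveson's distance formula: some operator of norm
at most `ρ'` agrees with `X` on every corner `(1 - c) X d` of norm at most `ρ < ρ'`. -/
theorem exists_interpolant (𝒩 : ContinuousNest H) (X : H →L[ℂ] H) {ρ ρ' : ℝ} (hρ : 0 ≤ ρ)
    (hρρ : ρ < ρ') :
    ∃ Z : H →L[ℂ] H, ‖Z‖ ≤ ρ' ∧ ∀ c d : 𝒩.Elem, ‖(1 - proj c) * X * proj d‖ ≤ ρ →
      (1 - proj c) * Z * proj d = (1 - proj c) * X * proj d := by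
  classical
  choose Z hZ hZs using fun s :
      Finset {p : 𝒩.Elem × 𝒩.Elem // ‖(1 - proj p.1) * X * proj p.2‖ ≤ ρ} =>
    exists_interpolant_finset (X := X) hρ (s.map (Function.Embedding.subtype _))
      (fun p hp => by
        obtain ⟨p', -, rfl⟩ := Finset.mem_map.1 hp
        exact p'.2) ρ' hρρ
  obtain ⟨W, hW, h⟩ := exists_weakOperator_limit atTop Z ρ' hZ
  refine ⟨W, hW, fun c d hcd => h _ _ _ ?_⟩
  filter_upwards [eventually_ge_atTop {⟨(c, d), hcd⟩}] with s hs
  exact hZs s (c, d) (Finset.mem_map.2 ⟨⟨(c, d), hcd⟩, hs (Finset.mem_singleton_self _), rfl⟩)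

/-! ### One-sided limits along the nest -/

theorem le_of_proj_sub_eq_zero {a s : 𝒩.Elem} {D : Set H} (hD : Dense D)
    (h : ∀ x ∈ D, (proj s - proj a) x = 0) : s ≤ a := by
  have h1 : proj s - proj a = 0 := by
    refine ContinuousLinearMap.coeFn_injective ?_
    exact Continuous.ext_on hD (proj s - proj a).continuous continuous_const h
  intro x hx
  have h2 : (proj s - proj a) x = 0 := by rw [h1]; rfl
  rw [sub_apply, proj_eq_self_iff.2 hx, sub_eq_zero] at h2
  rw [h2]
  exact proj_apply_mem a x

theorem norm_interval_apply_mono {L L' M' M : 𝒩.Elem} (h1 : L ≤ L') (h2 : L' ≤ M') (h3 : M' ≤ M)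
    (x : H) : ‖(proj M' - proj L') x‖ ≤ ‖(proj M - proj L) x‖ := by
  calc _ = ‖(proj M' - proj L') ((proj M - proj L) x)‖ :=
        congr(‖$((interval_mul_interval' h1 h2 h3).symm) x‖)
    _ ≤ _ := ((proj M' - proj L').le_of_opNorm_le (norm_proj_sub_le h2) _).trans (by simp)

/-- Separability makes the nest first countable from the right. -/
theorem exists_strictAnti_seq [TopologicalSpace.SeparableSpace H] {a M : 𝒩.Elem} (haM : a < M) :
    ∃ l : ℕ → 𝒩.Elem, l 0 = M ∧ StrictAnti l ∧ (∀ k, a < l k) ∧ ∀ s, a < s → ∃ k, l k < s := by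
  have step : ∀ (k : ℕ) (c : 𝒩.Elem), a < c → ∃ c', a < c' ∧ c' < c ∧
      ∀ i ≤ k, ‖(proj c' - proj a) (TopologicalSpace.denseSeq H i)‖ < 1 / (k + 1) := by
    intro k c hc
    classical
    obtain ⟨B, hB, h⟩ := exists_gt_forall_norm_sub_lt
      (ne_one_of_lt hc)
      ((Finset.range (k + 1)).image (TopologicalSpace.denseSeq H))
      (show (0 : ℝ) < 1 / (k + 1) by positivity)
    obtain ⟨c', h1, h2⟩ := exists_between_of_lt (lt_min hB hc)
    exact ⟨c', h1, h2.trans_le (min_le_right _ _), fun i hi =>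
      h c' h1.le (h2.le.trans (min_le_left _ _)) _
        (Finset.mem_image_of_mem _ (Finset.mem_range.2 (Nat.lt_succ_of_le hi)))⟩
  choose! nxt h1 h2 h3 using step
  let σ : ℕ → {c // a < c} := fun k =>
    Nat.rec ⟨M, haM⟩ (fun k c => ⟨nxt k c.1, h1 k c.1 c.2⟩) k
  refine ⟨fun k => (σ k).1, rfl, strictAnti_nat_of_succ_lt fun k => h2 k _ (σ k).2,
    fun k => (σ k).2, fun s hs => ?_⟩
  by_contra! hcon
  refine absurd (le_of_proj_sub_eq_zero (TopologicalSpace.denseRange_denseSeq H) ?_)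
    (not_le_of_gt hs)
  rintro _ ⟨i, rfl⟩
  refine norm_le_zero_iff.1 (ge_of_tendsto tendsto_one_div_add_atTop_nhds_zero_nat ?_)
  filter_upwards [eventually_ge_atTop i] with k hk
  exact (norm_interval_apply_mono le_rfl hs.le (hcon (k + 1)) _).trans
    (h3 k (σ k).1 (σ k).2 i hk).le

/-- Separability makes the nest first countable from the left. -/
theorem exists_strictMono_seq [TopologicalSpace.SeparableSpace H] {L b : 𝒩.Elem} (hLb : L < b) :
    ∃ l : ℕ → 𝒩.Elem, l 0 = L ∧ StrictMono l ∧ (∀ k, l k < b) ∧ ∀ s, s < b → ∃ k, s < l k := by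
  have step : ∀ (k : ℕ) (c : 𝒩.Elem), c < b → ∃ c', c' < b ∧ c < c' ∧
      ∀ i ≤ k, ‖(proj b - proj c') (TopologicalSpace.denseSeq H i)‖ < 1 / (k + 1) := by
    intro k c hc
    classical
    obtain ⟨B, hB, h⟩ := exists_lt_forall_norm_sub_lt
      (ne_zero_of_lt hc)
      ((Finset.range (k + 1)).image (TopologicalSpace.denseSeq H))
      (show (0 : ℝ) < 1 / (k + 1) by positivity)
    obtain ⟨c', h1, h2⟩ := exists_between_of_lt (max_lt hB hc)
    exact ⟨c', h2, (le_max_right _ _).trans_lt h1, fun i hi =>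
      h c' ((le_max_left _ _).trans h1.le) h2.le _
        (Finset.mem_image_of_mem _ (Finset.mem_range.2 (Nat.lt_succ_of_le hi)))⟩
  choose! nxt h1 h2 h3 using step
  let σ : ℕ → {c // c < b} := fun k =>
    Nat.rec ⟨L, hLb⟩ (fun k c => ⟨nxt k c.1, h1 k c.1 c.2⟩) k
  refine ⟨fun k => (σ k).1, rfl, strictMono_nat_of_lt_succ fun k => h2 k _ (σ k).2,
    fun k => (σ k).2, fun s hs => ?_⟩
  by_contra! hcon
  refine absurd (le_of_proj_sub_eq_zero (TopologicalSpace.denseRange_denseSeq H) ?_)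
    (not_le_of_gt hs)
  rintro _ ⟨i, rfl⟩
  refine norm_le_zero_iff.1 (ge_of_tendsto tendsto_one_div_add_atTop_nhds_zero_nat ?_)
  filter_upwards [eventually_ge_atTop i] with k hk
  exact (norm_interval_apply_mono (hcon (k + 1)) hs.le le_rfl _).trans
    (h3 k (σ k).1 (σ k).2 i hk).le

omit [CompleteSpace H] in
theorem norm_mul_mul_apply_le_of_split {P Q W : H →L[ℂ] H}
    (hQ : ‖Q‖ ≤ 1) (hP : P = Q + W) {Y : H →L[ℂ] H} {x : H} {ε ρ : ℝ}
    (h : ‖Q * Y * Q‖ ≤ ρ) (h1 : ‖W (Y (P x))‖ ≤ ε)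
    (h2 : ‖W x‖ ≤ ε) :
    ‖(P * Y * P) x‖ ≤ ρ * ‖x‖ + (1 + ‖Y‖) * ε := by
  have e : (P * Y * P) x = (Q * Y * Q) x + Q (Y (W x)) +
      W (Y (P x)) := by
    have e1 : (P * Y * P) x = Q (Y (P x)) + W (Y (P x)) := by
      nth_rewrite 1 [hP]; rfl
    have e2 : P x = Q x + W x := by rw [hP]; rfl
    rw [e1]
    congr 1
    rw [e2, map_add, map_add]; rfl
  have h3 : ‖Q (Y (W x))‖ ≤ ‖Y‖ * ε := by
    calc _ ≤ 1 * ‖Y (W x)‖ := Q.le_of_opNorm_le hQ _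
      _ ≤ 1 * (‖Y‖ * ‖W x‖) := by gcongr; exact Y.le_opNorm _
      _ ≤ _ := by rw [one_mul]; gcongr
  rw [e]
  calc _ ≤ ‖(Q * Y * Q) x‖ + ‖Q (Y (W x))‖ + ‖W (Y (P x))‖ :=
        norm_add₃_le
    _ ≤ ρ * ‖x‖ + ‖Y‖ * ε + ε := by gcongr; exact le_of_opNorm_le _ h x
    _ = _ := by ring

/-- Strong right continuity of the nest carries a bound on compressions to the end point. -/
theorem norm_interval_le_of_right {a M : 𝒩.Elem} (haM : a < M) {Y : H →L[ℂ] H} {ρ : ℝ}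
    (hρ : 0 ≤ ρ) (h : ∀ L, a < L → L ≤ M → ‖(proj M - proj L) * Y * (proj M - proj L)‖ ≤ ρ) :
    ‖(proj M - proj a) * Y * (proj M - proj a)‖ ≤ ρ := by
  classical
  refine opNorm_le_bound _ hρ fun x => le_of_forall_pos_le_add fun ε hε => ?_
  have hε' : 0 < ε / (1 + ‖Y‖) := by positivity
  obtain ⟨B, hB, hs⟩ := exists_gt_forall_norm_sub_lt
    (ne_one_of_lt haM)
    {x, Y ((proj M - proj a) x)} hε'
  have hm := lt_min hB haM
  have hs' := hs (min B M) hm.le (min_le_left _ _)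
  have := norm_mul_mul_apply_le_of_split (norm_proj_sub_le (min_le_right B M))
    (P := proj M - proj a) (by abel) (h _ hm (min_le_right _ _)) (hs' _ (by simp)).le
    (hs' x (by simp)).le
  rwa [mul_div_cancel₀ _ (by positivity)] at this

/-- Strong left continuity of the nest carries a bound on compressions to the end point. -/
theorem norm_interval_le_of_left {L b : 𝒩.Elem} (hLb : L < b) {Y : H →L[ℂ] H} {ρ : ℝ}
    (hρ : 0 ≤ ρ) (h : ∀ s, L ≤ s → s < b → ‖(proj s - proj L) * Y * (proj s - proj L)‖ ≤ ρ) :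
    ‖(proj b - proj L) * Y * (proj b - proj L)‖ ≤ ρ := by
  classical
  refine opNorm_le_bound _ hρ fun x => le_of_forall_pos_le_add fun ε hε => ?_
  have hε' : 0 < ε / (1 + ‖Y‖) := by positivity
  obtain ⟨B, hB, hs⟩ := exists_lt_forall_norm_sub_lt
    (ne_zero_of_lt hLb)
    {x, Y ((proj b - proj L) x)} hε'
  have hm := max_lt hB hLb
  have hs' := hs (max B L) (le_max_left _ _) hm.le
  have := norm_mul_mul_apply_le_of_split (norm_proj_sub_le (le_max_right B L))
    (P := proj b - proj L) (by abel) (h _ (le_max_right _ _) hm) (hs' _ (by simp)).le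
    (hs' x (by simp)).le
  rwa [mul_div_cancel₀ _ (by positivity)] at this

/-! ### Compact blocks and their sums -/

/-- A compact operator of the nest algebra that is supported on the interval from `s` to `t`
and is within `C` of the projection onto that interval. -/
structure IsBlock (s t : 𝒩.Elem) (C : ℝ) (E : H →L[ℂ] H) : Prop where
  le : s ≤ t
  mem : E ∈ 𝒩.alg
  compact : IsCompactOperator E
  support : (proj t - proj s) * E * (proj t - proj s) = E
  norm_le : ‖(proj t - proj s) - E‖ ≤ C

theorem IsBlock.support_sub {s t : 𝒩.Elem} {C : ℝ} {E : H →L[ℂ] H} (h : IsBlock s t C E) :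
    (proj t - proj s) * ((proj t - proj s) - E) * (proj t - proj s) = (proj t - proj s) - E := by
  rw [mul_sub (proj t - proj s), sub_mul _ _ (proj t - proj s), h.support, interval_mul_self h.le,
    interval_mul_self h.le]

/-- Blocks over pairwise disjoint intervals can be subtracted from the identity all at once. -/
theorem exists_one_sub_sum_blocks {ι : Type*} {s t : ι → 𝒩.Elem} {E : ι → H →L[ℂ] H} {C : ℝ}
    (hC : 1 ≤ C) (hE : ∀ i, IsBlock (s i) (t i) C (E i))
    (hdisj : Pairwise fun i j => t i ≤ s j ∨ t j ≤ s i) :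
    ∃ D ∈ 𝒩.alg, ‖D‖ ≤ C ∧ ∀ c d, c ≤ d → ∀ F : Finset ι, (∀ i ∉ F, t i ≤ c ∨ d ≤ s i) →
      (proj d - proj c) * D * (proj d - proj c) = (proj d - proj c) -
        ∑ i ∈ F, (proj d - proj c) * E i * (proj d - proj c) := by
  classical
  obtain ⟨D, hD, h⟩ := exists_weakOperator_limit (atTop : Filter (Finset ι))
    (fun F => 1 - ∑ i ∈ F, E i) C fun F => norm_one_sub_sum_le hC
      (P := fun i => proj (t i) - proj (s i)) (fun i => isStarProjection_sub (hE i).le)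
      (fun i j hij => interval_mul_eq_zero (hE i).le (hE j).le (hdisj hij))
      (fun i => (hE i).support) (fun i => (hE i).norm_le) F
  refine ⟨D, mem_alg_iff_one_sub.2 fun N => h _ _ _ (Eventually.of_forall fun F => ?_), hD,
    fun c d hcd F hF => h _ _ _ ?_⟩
  · exact mem_alg_iff_one_sub.1 (𝒩.alg.sub_mem 𝒩.alg.one_mem
      (sum_mem fun i _ => (hE i).mem)) N
  · filter_upwards [eventually_ge_atTop F] with G hG
    rw [mul_sub (proj d - proj c), sub_mul _ _ (proj d - proj c), mul_one, interval_mul_self hcd,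
      Finset.mul_sum, Finset.sum_mul]
    congr 1
    refine (Finset.sum_subset hG fun i _ hi => ?_).symm
    exact interval_support_eq_zero hcd (hE i).le ((hF i hi).symm) (hE i).support

/-- Near the right of `a`, compact blocks can be subtracted from the identity, on intervals
accumulating only at `a`, so that the norm of `X` drops to its local essential norm. -/
theorem exists_blocks_right [TopologicalSpace.SeparableSpace H] {X : H →L[ℂ] H} (hX : X ∈ 𝒩.alg)
    {a M : 𝒩.Elem} (haM : a < M) {r ε : ℝ} (hr : 0 ≤ r) (hε : 0 < ε)
    (hess : ∀ L, a < L → L < M → essNorm ((proj M - proj L) * X * (proj M - proj L)) < r) :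
    ∃ (l : ℕ → 𝒩.Elem) (E : ℕ → H →L[ℂ] H), l 0 = M ∧ StrictAnti l ∧ (∀ k, a < l k) ∧
      (∀ s, a < s → ∃ k, l k < s) ∧ (∀ k, IsBlock (l (k + 1)) (l k) (1 + ε) (E k)) ∧
      ∀ k, ‖((proj M - proj (l k)) - ∑ j ∈ Finset.range k, E j) * X * (proj M - proj (l k))‖ ≤
        (1 + ε) * r + ε := by
  obtain ⟨l, hl0, hl, hal, hcof⟩ := exists_strictAnti_seq haM
  have hlM : ∀ k, l k ≤ M := fun k => hl0 ▸ hl.antitone (Nat.zero_le k)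
  have hss : ∀ k, l (k + 1) ≤ l k := fun k => (hl (Nat.lt_succ_self k)).le
  set Q : ℕ → H →L[ℂ] H := fun k => proj M - proj (l k) with hQdef
  have hQ : ∀ k, IsStarProjection (Q k) := fun k => isStarProjection_sub (hlM k)
  have hR : ∀ k, Q (k + 1) - Q k = proj (l k) - proj (l (k + 1)) := fun k => by
    simp only [hQdef]; abel
  have hXM : ∀ k, X * proj M * Q k = X * Q k := fun k => by
    rw [mul_assoc]; congr 1
    simp only [hQdef]
    rw [mul_sub, mul_proj_of_le le_rfl, mul_proj_of_le (hlM k)]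
  obtain ⟨d, hd, hdn⟩ := exists_blocks_norm_le (Q := Q) (X := X * proj M) (r := r) (C := 1 + ε)
    (ε := ε) hQ (fun k => interval_mul_interval' (hss k) (hlM k) le_rfl)
    (fun k => by
      rw [mul_assoc, hXM, ← mul_assoc, ← mul_assoc]
      exact interval_mul_mul_proj_right (hlM k) hX)
    (fun k => by
      rw [mul_assoc, hXM, ← mul_assoc]
      rcases (hlM k).eq_or_lt with h | h
      · refine ⟨0, 0, ?_, by simpa using hr, by simpa using isCompactOperator_zero⟩
        simp [hQdef, h]
      · obtain ⟨A, K, hAK, hA, hK⟩ := exists_compact_of_essNorm_lt (hess _ (hal k) h)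
        exact ⟨A, K, hAK, hA.le, show IsCompactOperator (adjoint K ∘ K) from hK.clm_comp _⟩)
    hr (by positivity) hε
    (fun k => {D | ∃ E, IsBlock (l (k + 1)) (l k) (1 + ε) E ∧
      D = (proj (l k) - proj (l (k + 1))) - E})
    (by
      rintro k _ ⟨E, hE, rfl⟩
      refine ⟨?_, hE.norm_le⟩
      rw [hR, hE.support_sub])
    (by
      intro k F η hη
      obtain ⟨E, h1, h2, h3, h4, h5⟩ := exists_approximate_identity (hss k) F (lt_min hε hη)
      refine ⟨_, ⟨E, ⟨hss k, h1, h2, h3, h4.trans (by gcongr; exact min_le_left _ _)⟩, rfl⟩,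
        fun x hx => (h5 x hx).1.trans_le (min_le_right _ _)⟩)
  choose E hE hdE using hd
  refine ⟨l, E, hl0, hl, hal, hcof, hE, fun k => ?_⟩
  have hsum : ∑ j ∈ Finset.range k, d j = Q k - ∑ j ∈ Finset.range k, E j := by
    simp only [hdE, ← hR, Finset.sum_sub_distrib]
    rw [← Finset.sum_sub_distrib, Finset.sum_range_sub]
    simp [hQdef, hl0]
  have := hdn k
  rwa [hsum, mul_assoc, hXM, ← mul_assoc] at this

/-- The mirror image of `exists_blocks_right`, obtained by passing to adjoints. -/
theorem exists_blocks_left [TopologicalSpace.SeparableSpace H] {X : H →L[ℂ] H} (hX : X ∈ 𝒩.alg)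
    {L b : 𝒩.Elem} (hLb : L < b) {r ε : ℝ} (hr : 0 ≤ r) (hε : 0 < ε)
    (hess : ∀ s, L < s → s < b → essNorm ((proj s - proj L) * X * (proj s - proj L)) < r) :
    ∃ (l : ℕ → 𝒩.Elem) (E : ℕ → H →L[ℂ] H), l 0 = L ∧ StrictMono l ∧ (∀ k, l k < b) ∧
      (∀ s, s < b → ∃ k, s < l k) ∧ (∀ k, IsBlock (l k) (l (k + 1)) (1 + ε) (E k)) ∧
      ∀ k, ‖(proj (l k) - proj L) * X * ((proj (l k) - proj L) - ∑ j ∈ Finset.range k, E j)‖ ≤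
        (1 + ε) * r + ε := by
  obtain ⟨l, hl0, hl, hlb, hcof⟩ := exists_strictMono_seq hLb
  have hLl : ∀ k, L ≤ l k := fun k => hl0 ▸ hl.monotone (Nat.zero_le k)
  have hss : ∀ k, l k ≤ l (k + 1) := fun k => (hl (Nat.lt_succ_self k)).le
  set Q : ℕ → H →L[ℂ] H := fun k => proj (l k) - proj L with hQdef
  have hQ : ∀ k, IsStarProjection (Q k) := fun k => isStarProjection_sub (hLl k)
  have hQs : ∀ k, star (Q k) = Q k := fun k => (hQ k).isSelfAdjoint.star_eq
  have hR : ∀ k, Q (k + 1) - Q k = proj (l (k + 1)) - proj (l k) := fun k => by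
    simp only [hQdef]; abel
  have hRs : ∀ k, star (proj (l (k + 1)) - proj (l k)) = proj (l (k + 1)) - proj (l k) :=
    fun k => (isStarProjection_sub (hss k)).isSelfAdjoint.star_eq
  have hQL : ∀ k, Q k * ((1 - proj L) * X) = Q k * X := fun k => by
    rw [← mul_assoc]; congr 1
    simp only [hQdef]
    rw [mul_sub, mul_one, sub_mul, mul_proj_of_le (hLl k), mul_proj_of_le le_rfl, sub_self,
      sub_zero]
  have hQXQ : ∀ k, Q k * star ((1 - proj L) * X) * Q k = star (Q k * X * Q k) := fun k => by
    rw [← hQL, star_mul _ (Q k), star_mul (Q k) ((1 - proj L) * X), hQs, mul_assoc]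
  obtain ⟨d, hd, hdn⟩ := exists_blocks_norm_le (Q := Q) (X := star ((1 - proj L) * X)) (r := r)
    (C := 1 + ε) (ε := ε) hQ (fun k => interval_mul_interval' le_rfl (hLl k) (hss k))
    (fun k => by
      rw [hQXQ, ← one_sub_mul_mul_interval_left (hLl k) hX, star_mul _ (proj (l k) - proj L)]
      congr 1
      exact (hQs k).symm)
    (fun k => by
      rw [hQXQ]
      rcases (hLl k).eq_or_lt with h | h
      · refine ⟨0, 0, ?_, by simpa using hr, by simpa using isCompactOperator_zero⟩
        simp [hQdef, ← h]
      · obtain ⟨A, K, hAK, hA, hK⟩ := exists_compact_of_essNorm_lt (hess _ h (hlb k))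
        refine ⟨star A, star K, by rw [← star_add, ← hAK], by rw [norm_star]; exact hA.le, ?_⟩
        rw [← star_eq_adjoint, star_star]
        exact hK.comp_clm _)
    hr (by positivity) hε
    (fun k => {D | ∃ E, IsBlock (l k) (l (k + 1)) (1 + ε) E ∧
      D = star ((proj (l (k + 1)) - proj (l k)) - E)})
    (by
      rintro k _ ⟨E, hE, rfl⟩
      refine ⟨?_, by rw [norm_star]; exact hE.norm_le⟩
      have h1 : star ((Q (k + 1) - Q k) * ((proj (l (k + 1)) - proj (l k)) - E) *
          (Q (k + 1) - Q k)) = star ((proj (l (k + 1)) - proj (l k)) - E) := by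
        rw [hR, hE.support_sub]
      rw [star_mul, star_mul, hR, hRs, ← mul_assoc] at h1
      rw [hR]
      exact h1)
    (by
      intro k F η hη
      obtain ⟨E, h1, h2, h3, h4, h5⟩ := exists_approximate_identity (hss k) F (lt_min hε hη)
      refine ⟨_, ⟨E, ⟨hss k, h1, h2, h3, h4.trans (by gcongr; exact min_le_left _ _)⟩, rfl⟩,
        fun x hx => (h5 x hx).2.trans_le (min_le_right _ _)⟩)
  choose E hE hdE using hd
  refine ⟨l, E, hl0, hl, hlb, hcof, hE, fun k => ?_⟩
  have hsum : ∑ j ∈ Finset.range k, d j = star (Q k - ∑ j ∈ Finset.range k, E j) := by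
    simp only [hdE, ← hR]
    rw [← star_sum, Finset.sum_sub_distrib, Finset.sum_range_sub]
    simp [hQdef, hl0]
  have h1 := hdn k
  rw [hsum, ← hQs k, ← norm_star] at h1
  simp only [star_mul, star_star, hQs] at h1
  have h2 : Q k * ((1 - proj L) * X * (Q k - ∑ j ∈ Finset.range k, E j)) =
      Q k * X * (Q k - ∑ j ∈ Finset.range k, E j) := by
    rw [← mul_assoc, hQL]
  rwa [h2] at h1

/-! ### Block corrections -/

theorem isCompactOperator_sub_sub_sum {ι : Type*} {c d : 𝒩.Elem} (hcd : c ≤ d) {D : H →L[ℂ] H}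
    {E : ι → H →L[ℂ] H} (hE : ∀ i, IsCompactOperator (E i)) {F : Finset ι}
    (h : (proj d - proj c) * D * (proj d - proj c) = (proj d - proj c) -
        ∑ i ∈ F, (proj d - proj c) * E i * (proj d - proj c)) :
    IsCompactOperator ((proj d - proj c) * (1 - D) * (proj d - proj c) : H →L[ℂ] H) := by
  have e : (proj d - proj c) * (1 - D) * (proj d - proj c) =
      ∑ i ∈ F, (proj d - proj c) * E i * (proj d - proj c) := by
    rw [mul_sub (proj d - proj c), sub_mul _ _ (proj d - proj c), h, mul_one,
      interval_mul_self hcd]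
    abel
  rw [e]
  exact Submodule.sum_mem (compactOperator (RingHom.id ℂ) H H)
    fun i _ => isCompactOperator_mul_mul (hE i) _ _

/-- Multiplication by a single operator `D` reduces `X` to its local essential norm on the right
of every point of `A`, while `1 - D` is compact on every interval that contains no point of `A`
except possibly its right end point. -/
theorem exists_right_correction [TopologicalSpace.SeparableSpace H] {X : H →L[ℂ] H}
    (hX : X ∈ 𝒩.alg) {r ε : ℝ} (hr : 0 ≤ r) (hε : 0 < ε) (A : Set 𝒩.Elem) (M : A → 𝒩.Elem)
    (haM : ∀ a : A, a.1 < M a) (hsep : ∀ a a' : A, a.1 < a'.1 → M a ≤ a'.1)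
    (hess : ∀ (a : A) (L : 𝒩.Elem), a.1 < L → L < M a →
      essNorm ((proj (M a) - proj L) * X * (proj (M a) - proj L)) < r) :
    ∃ D ∈ 𝒩.alg, ‖D‖ ≤ 1 + ε ∧
      (∀ c d : 𝒩.Elem, c ≤ d → (∀ a ∈ A, c ≤ a → ¬ a < d) →
        IsCompactOperator ((proj d - proj c) * (1 - D) * (proj d - proj c) : H →L[ℂ] H)) ∧
      ∀ a : A, ‖(proj (M a) - proj a.1) * (D * X) * (proj (M a) - proj a.1)‖ ≤
        (1 + ε) * r + ε := by
  classical
  choose l E hl0 hl hal hcof hE hn using fun a : A =>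
    exists_blocks_right hX (haM a) hr hε (hess a)
  have hlM : ∀ a k, l a k ≤ M a := fun a k => by
    rw [← hl0 a]; exact (hl a).antitone (Nat.zero_le k)
  have hlt : ∀ (a a' : A) (j k : ℕ), a.1 < a'.1 → l a j ≤ l a' k := fun a a' j k h =>
    (hlM a j).trans ((hsep a a' h).trans (hal a' k).le)
  obtain ⟨D, hD, hDn, hDF⟩ := exists_one_sub_sum_blocks (ι := A × ℕ)
    (s := fun i => l i.1 (i.2 + 1)) (t := fun i => l i.1 i.2) (E := fun i => E i.1 i.2)
    (C := 1 + ε) (by linarith) (fun i => hE i.1 i.2) (by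
      rintro ⟨a, j⟩ ⟨a', k⟩ hne
      rcases lt_trichotomy a.1 a'.1 with h | h | h
      · exact Or.inl (hlt _ _ _ _ h)
      · obtain rfl : a = a' := Subtype.ext h
        rcases lt_trichotomy j k with h' | h' | h'
        · exact Or.inr ((hl a).antitone h')
        · exact absurd (by rw [h']) hne
        · exact Or.inl ((hl a).antitone h')
      · exact Or.inr (hlt _ _ _ _ h))
  refine ⟨D, hD, hDn, fun c d hcd hA => ?_, fun a => ?_⟩
  · by_cases hex : ∃ a : A, a.1 < c ∧ c < M a
    · obtain ⟨a, hac, hcM⟩ := hex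
      obtain ⟨k, hk⟩ := hcof a c hac
      refine isCompactOperator_sub_sub_sum hcd (fun i : A × ℕ => (hE i.1 i.2).compact)
        (hDF c d hcd ((Finset.range k).image fun j => (a, j)) ?_)
      rintro ⟨a', j⟩ hi
      rcases lt_trichotomy a'.1 a.1 with h | h | h
      · exact Or.inl ((hlM a' j).trans ((hsep _ _ h).trans hac.le))
      · obtain rfl : a' = a := Subtype.ext h
        have hj : k ≤ j := by
          by_contra! hj
          exact hi (Finset.mem_image_of_mem _ (Finset.mem_range.2 hj))
        exact Or.inl (((hl a').antitone hj).trans hk.le)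
      · have h1 := not_lt.1 (hA a'.1 a'.2 (hcM.le.trans (hsep _ _ h)))
        exact Or.inr (h1.trans (hal a' _).le)
    · push Not at hex
      refine isCompactOperator_sub_sub_sum hcd (fun i : A × ℕ => (hE i.1 i.2).compact)
        (hDF c d hcd ∅ ?_)
      rintro ⟨a', j⟩ -
      rcases lt_or_ge a'.1 c with h | h
      · exact Or.inl ((hlM a' j).trans (hex a' h))
      · exact Or.inr ((not_lt.1 (hA a'.1 a'.2 h)).trans (hal a' _).le)
  · refine norm_interval_le_of_right (haM a) (by positivity) fun L haL hLM => ?_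
    obtain ⟨k, hk⟩ := hcof a L haL
    refine (norm_interval_mono hk.le hLM le_rfl (D * X)).trans ?_
    rw [interval_compress_mul (hlM a k) hD hX, hDF _ _ (hlM a k)
      ((Finset.range k).image fun j => (a, j)) ?_, Finset.sum_image (by simp)]
    · have hsup : ∀ j ∈ Finset.range k, (proj (M a) - proj (l a k)) * E a j *
          (proj (M a) - proj (l a k)) = E a j := fun j hj =>
        interval_support_mono ((hl a).antitone (Finset.mem_range.1 hj))
          ((hl a).antitone (Nat.le_succ j)) (hlM a j) (hE a j).support
      have h1 := Finset.sum_congr rfl hsup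
      have h2 : ((proj (M a) - proj (l a k)) - ∑ j ∈ Finset.range k, E a j) *
          (proj (M a) - proj (l a k)) =
          (proj (M a) - proj (l a k)) - ∑ j ∈ Finset.range k, E a j := by
        have h3 := interval_mul_self (hlM a k)
        rw [← h1, sub_mul _ _ (proj (M a) - proj (l a k)), h3, Finset.sum_mul]
        congr 1
        refine Finset.sum_congr rfl fun j _ => ?_
        rw [mul_assoc _ (proj (M a) - proj (l a k)) (proj (M a) - proj (l a k)), h3]
      rw [h1, ← mul_assoc, ← mul_assoc, h2]
      exact hn a k
    · rintro ⟨a', j⟩ hi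
      rcases lt_trichotomy a'.1 a.1 with h | h | h
      · exact Or.inl (hlt _ _ _ _ h)
      · obtain rfl : a' = a := Subtype.ext h
        have hj : k ≤ j := by
          by_contra! hj
          exact hi (Finset.mem_image_of_mem _ (Finset.mem_range.2 hj))
        exact Or.inl ((hl a').antitone hj)
      · exact Or.inr ((hsep _ _ h).trans (hal a' _).le)

/-- The mirror image of `exists_right_correction`. -/
theorem exists_left_correction [TopologicalSpace.SeparableSpace H] {X : H →L[ℂ] H}
    (hX : X ∈ 𝒩.alg) {r ε : ℝ} (hr : 0 ≤ r) (hε : 0 < ε) (B : Set 𝒩.Elem) (L : B → 𝒩.Elem)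
    (hLb : ∀ b : B, L b < b.1) (hsep : ∀ b b' : B, b.1 < b'.1 → b.1 ≤ L b')
    (hess : ∀ (b : B) (s : 𝒩.Elem), L b < s → s < b.1 →
      essNorm ((proj s - proj (L b)) * X * (proj s - proj (L b))) < r) :
    ∃ D ∈ 𝒩.alg, ‖D‖ ≤ 1 + ε ∧
      (∀ c d : 𝒩.Elem, c ≤ d → (∀ b ∈ B, c < b → ¬ b ≤ d) →
        IsCompactOperator ((proj d - proj c) * (1 - D) * (proj d - proj c) : H →L[ℂ] H)) ∧
      ∀ b : B, ‖(proj b.1 - proj (L b)) * (X * D) * (proj b.1 - proj (L b))‖ ≤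
        (1 + ε) * r + ε := by
  classical
  choose l E hl0 hl hlb hcof hE hn using fun b : B =>
    exists_blocks_left hX (hLb b) hr hε (hess b)
  have hLl : ∀ b k, L b ≤ l b k := fun b k => by
    rw [← hl0 b]; exact (hl b).monotone (Nat.zero_le k)
  have hlt : ∀ (b b' : B) (j k : ℕ), b.1 < b'.1 → l b j ≤ l b' k := fun b b' j k h =>
    (hlb b j).le.trans ((hsep b b' h).trans (hLl b' k))
  obtain ⟨D, hD, hDn, hDF⟩ := exists_one_sub_sum_blocks (ι := B × ℕ)
    (s := fun i => l i.1 i.2) (t := fun i => l i.1 (i.2 + 1)) (E := fun i => E i.1 i.2)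
    (C := 1 + ε) (by linarith) (fun i => hE i.1 i.2) (by
      rintro ⟨b, j⟩ ⟨b', k⟩ hne
      rcases lt_trichotomy b.1 b'.1 with h | h | h
      · exact Or.inl (hlt _ _ _ _ h)
      · obtain rfl : b = b' := Subtype.ext h
        rcases lt_trichotomy j k with h' | h' | h'
        · exact Or.inl ((hl b).monotone h')
        · exact absurd (by rw [h']) hne
        · exact Or.inr ((hl b).monotone h')
      · exact Or.inr (hlt _ _ _ _ h))
  refine ⟨D, hD, hDn, fun c d hcd hB => ?_, fun b => ?_⟩
  · by_cases hex : ∃ b : B, d < b.1 ∧ L b < d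
    · obtain ⟨b, hdb, hLd⟩ := hex
      obtain ⟨k, hk⟩ := hcof b d hdb
      refine isCompactOperator_sub_sub_sum hcd (fun i : B × ℕ => (hE i.1 i.2).compact)
        (hDF c d hcd ((Finset.range k).image fun j => (b, j)) ?_)
      rintro ⟨b', j⟩ hi
      rcases lt_trichotomy b'.1 b.1 with h | h | h
      · have h1 : b'.1 ≤ c := by
          by_contra! h1
          exact hB b'.1 b'.2 h1 ((hsep _ _ h).trans hLd.le)
        exact Or.inl ((hlb b' _).le.trans h1)
      · obtain rfl : b' = b := Subtype.ext h
        have hj : k ≤ j := by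
          by_contra! hj
          exact hi (Finset.mem_image_of_mem _ (Finset.mem_range.2 hj))
        exact Or.inr (hk.le.trans ((hl b').monotone hj))
      · exact Or.inr (hdb.le.trans ((hsep _ _ h).trans (hLl b' j)))
    · push Not at hex
      refine isCompactOperator_sub_sub_sum hcd (fun i : B × ℕ => (hE i.1 i.2).compact)
        (hDF c d hcd ∅ ?_)
      rintro ⟨b', j⟩ -
      rcases lt_or_ge d b'.1 with h | h
      · exact Or.inr ((hex b' h).trans (hLl b' j))
      · have h1 : b'.1 ≤ c := by
          by_contra! h1
          exact hB b'.1 b'.2 h1 h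
        exact Or.inl ((hlb b' _).le.trans h1)
  · refine norm_interval_le_of_left (hLb b) (by positivity) fun s hLs hsb => ?_
    obtain ⟨k, hk⟩ := hcof b s hsb
    refine (norm_interval_mono le_rfl hLs hk.le (X * D)).trans ?_
    rw [interval_compress_mul (hLl b k) hX hD, hDF _ _ (hLl b k)
      ((Finset.range k).image fun j => (b, j)) ?_, Finset.sum_image (by simp)]
    · have hsup : ∀ j ∈ Finset.range k, (proj (l b k) - proj (L b)) * E b j *
          (proj (l b k) - proj (L b)) = E b j := fun j hj =>
        interval_support_mono (hLl b j) ((hl b).monotone (Nat.le_succ j))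
          ((hl b).monotone (Finset.mem_range.1 hj)) (hE b j).support
      have h1 := Finset.sum_congr rfl hsup
      have h2 : (proj (l b k) - proj (L b)) *
          ((proj (l b k) - proj (L b)) - ∑ j ∈ Finset.range k, E b j) =
          (proj (l b k) - proj (L b)) - ∑ j ∈ Finset.range k, E b j := by
        have h3 := interval_mul_self (hLl b k)
        rw [← h1, mul_sub (proj (l b k) - proj (L b)), h3, Finset.mul_sum]
        congr 1
        refine Finset.sum_congr rfl fun j _ => ?_
        rw [← mul_assoc, ← mul_assoc, h3]
      rw [h1, mul_assoc _ (proj (l b k) - proj (L b)), h2]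
      exact hn b k
    · rintro ⟨b', j⟩ hi
      rcases lt_trichotomy b'.1 b.1 with h | h | h
      · exact Or.inl ((hlb b' _).le.trans (hsep _ _ h))
      · obtain rfl : b' = b := Subtype.ext h
        have hj : k ≤ j := by
          by_contra! hj
          exact hi (Finset.mem_image_of_mem _ (Finset.mem_range.2 hj))
        exact Or.inr ((hl b').monotone hj)
      · exact Or.inr (hlt _ _ _ _ h)

/-! ### Compact operators and the elementary seminorms -/

theorem norm_compress_add_le {L M : 𝒩.Elem} (h : L ≤ M) (A K : H →L[ℂ] H) :
    ‖(proj M - proj L) * (A + K) * (proj M - proj L)‖ ≤ ‖A‖ + ‖(proj M - proj L) * K‖ := by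
  have hp := norm_proj_sub_le h
  rw [mul_add, add_mul]
  refine (norm_add_le _ _).trans (add_le_add (norm_interval_mul_mul_le h A) ?_)
  calc _ ≤ ‖(proj M - proj L) * K‖ * ‖proj M - proj L‖ := norm_mul_le _ _
    _ ≤ ‖(proj M - proj L) * K‖ * 1 := by gcongr
    _ = _ := mul_one _

theorem exists_norm_compress_lt_right {N M : 𝒩.Elem} (hNM : N < M) {X : 𝒩.alg} {r : ℝ}
    (h : essNorm (compress N M X) < r) :
    ∃ M', N < M' ∧ M' < M ∧ ‖compress N M' X‖ < r := by
  obtain ⟨A, K, hAK, hA, hK⟩ := exists_compact_of_essNorm_lt h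
  obtain ⟨F, hF⟩ := exists_finset_norm_mul_le hK (show 0 < (r - ‖A‖) / 2 by linarith)
  obtain ⟨M₁, h1, h2⟩ := exists_gt_forall_norm_sub_lt
    (ne_one_of_lt hNM) F
    (show 0 < (r - ‖A‖) / 2 / 2 by linarith)
  obtain ⟨M', h3, h4⟩ := exists_between_of_lt (lt_min h1 hNM)
  refine ⟨M', h3, h4.trans_le (min_le_right _ _), ?_⟩
  rw [compress_compress le_rfl h3.le (h4.le.trans (min_le_right _ _)), hAK]
  have h5 := hF _ (norm_proj_sub_le h3.le) (h2 M' h3.le (h4.le.trans (min_le_left _ _)))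
  linarith [norm_compress_add_le h3.le A K]

theorem exists_norm_compress_lt_left {L N : 𝒩.Elem} (hLN : L < N) {X : 𝒩.alg} {r : ℝ}
    (h : essNorm (compress L N X) < r) :
    ∃ L', L < L' ∧ L' < N ∧ ‖compress L' N X‖ < r := by
  obtain ⟨A, K, hAK, hA, hK⟩ := exists_compact_of_essNorm_lt h
  obtain ⟨F, hF⟩ := exists_finset_norm_mul_le hK (show 0 < (r - ‖A‖) / 2 by linarith)
  obtain ⟨L₁, h1, h2⟩ := exists_lt_forall_norm_sub_lt
    (ne_zero_of_lt hLN) F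
    (show 0 < (r - ‖A‖) / 2 / 2 by linarith)
  obtain ⟨L', h3, h4⟩ := exists_between_of_lt (max_lt h1 hLN)
  refine ⟨L', (le_max_right _ _).trans_lt h3, h4, ?_⟩
  rw [compress_compress ((le_max_right _ _).trans h3.le) h4.le le_rfl, hAK]
  have h5 := hF _ (norm_proj_sub_le h4.le) (h2 L' ((le_max_left _ _).trans h3.le) h4.le)
  linarith [norm_compress_add_le h4.le A K]

theorem exists_norm_compress_lt {L N M : 𝒩.Elem} (hLN : L < N) (hNM : N < M) {X : 𝒩.alg} {r : ℝ}
    (h : essNorm (compress L M X) < r) :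
    ∃ L' M', L < L' ∧ L' < N ∧ N < M' ∧ M' < M ∧ ‖compress L' M' X‖ < r := by
  obtain ⟨A, K, hAK, hA, hK⟩ := exists_compact_of_essNorm_lt h
  obtain ⟨F, hF⟩ := exists_finset_norm_mul_le hK (show 0 < (r - ‖A‖) / 2 by linarith)
  obtain ⟨L₁, h1, h2⟩ := exists_lt_forall_norm_sub_lt
    (ne_zero_of_lt hLN) F
    (show 0 < (r - ‖A‖) / 2 / 4 by linarith)
  obtain ⟨M₁, h3, h4⟩ := exists_gt_forall_norm_sub_lt
    (ne_one_of_lt hNM) F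
    (show 0 < (r - ‖A‖) / 2 / 4 by linarith)
  obtain ⟨L', h5, h6⟩ := exists_between_of_lt (max_lt h1 hLN)
  obtain ⟨M', h7, h8⟩ := exists_between_of_lt (lt_min h3 hNM)
  have hLM : L' ≤ M' := (h6.trans h7).le
  refine ⟨L', M', (le_max_right _ _).trans_lt h5, h6, h7, h8.trans_le (min_le_right _ _), ?_⟩
  rw [compress_compress ((le_max_right _ _).trans h5.le) hLM (h8.le.trans (min_le_right _ _)), hAK]
  have h9 := hF _ (norm_proj_sub_le hLM) fun x hx => by
    have e1 := h2 L' ((le_max_left _ _).trans h5.le) h6.le x hx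
    have e2 := h4 M' h7.le (h8.le.trans (min_le_left _ _)) x hx
    have e3 : (proj M' - proj L') x = (proj M' - proj N) x + (proj N - proj L') x := by
      simp only [sub_apply]; abel
    rw [e3]
    linarith [norm_add_le ((proj M' - proj N) x) ((proj N - proj L') x)]
  linarith [norm_compress_add_le hLM A K]

theorem compress_compact_mono {L L' M' M : 𝒩.Elem} (h1 : L ≤ L') (h2 : L' ≤ M') (h3 : M' ≤ M)
    {X : 𝒩.alg} (h : IsCompactOperator (compress L M X)) :
    IsCompactOperator (compress L' M' X) := by
  rw [compress_compress h1 h2 h3]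
  exact isCompactOperator_mul_mul h _ _

theorem iPlus_le {N M : 𝒩.Elem} (h : N < M) (X : 𝒩.alg) : iPlus N X ≤ ‖compress N M X‖ := by
  rw [iPlus, if_neg (ne_one_of_lt h)]
  exact ciInf_le (bddBelow_range_of_nonneg
    (f := fun M : {M : 𝒩.Elem // N < M} => ‖compress N M.1 X‖) fun _ => norm_nonneg _) ⟨M, h⟩

theorem iMinus_le {L N : 𝒩.Elem} (h : L < N) (X : 𝒩.alg) : iMinus N X ≤ ‖compress L N X‖ := by
  rw [iMinus, if_neg (ne_zero_of_lt h)]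
  exact ciInf_le (bddBelow_range_of_nonneg
    (f := fun M : {M : 𝒩.Elem // M < N} => ‖compress M.1 N X‖) fun _ => norm_nonneg _) ⟨L, h⟩

theorem jBoth_le {L N M : 𝒩.Elem} (hL : L < N) (hM : N < M) (X : 𝒩.alg) :
    jBoth N X ≤ ‖compress L M X‖ := by
  rw [jBoth, if_neg (ne_zero_of_lt hL),
    if_neg (ne_one_of_lt hM)]
  exact ciInf_le (bddBelow_range_of_nonneg
    (f := fun p : {L : 𝒩.Elem // L < N} × {M : 𝒩.Elem // N < M} => ‖compress p.1.1 p.2.1 X‖)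
    fun _ => norm_nonneg _) (⟨L, hL⟩, ⟨M, hM⟩)

theorem iPlus_eq_zero {N M : 𝒩.Elem} (h : N < M) {X : 𝒩.alg}
    (hX : IsCompactOperator (compress N M X)) : iPlus N X = 0 := by
  refine le_antisymm (le_of_forall_pos_le_add fun ε hε => ?_) (iPlus_mem_Icc N X).1
  obtain ⟨M', h1, -, h2⟩ := exists_norm_compress_lt_right h
    ((essNorm_eq_zero_of_isCompactOperator hX).trans_lt hε)
  rw [zero_add]
  exact (iPlus_le h1 X).trans h2.le

theorem iMinus_eq_zero {L N : 𝒩.Elem} (h : L < N) {X : 𝒩.alg}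
    (hX : IsCompactOperator (compress L N X)) : iMinus N X = 0 := by
  refine le_antisymm (le_of_forall_pos_le_add fun ε hε => ?_) (iMinus_mem_Icc N X).1
  obtain ⟨L', -, h1, h2⟩ := exists_norm_compress_lt_left h
    ((essNorm_eq_zero_of_isCompactOperator hX).trans_lt hε)
  rw [zero_add]
  exact (iMinus_le h1 X).trans h2.le

theorem jBoth_eq_zero {L N M : 𝒩.Elem} (hL : L < N) (hM : N < M) {X : 𝒩.alg}
    (hX : IsCompactOperator (compress L M X)) : jBoth N X = 0 := by
  refine le_antisymm (le_of_forall_pos_le_add fun ε hε => ?_) (jBoth_mem_Icc N X).1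
  obtain ⟨L', M', -, h1, h2, -, h3⟩ := exists_norm_compress_lt hL hM
    ((essNorm_eq_zero_of_isCompactOperator hX).trans_lt hε)
  rw [zero_add]
  exact (jBoth_le h1 h2 X).trans h3.le

theorem ePlus_eq_zero {N M : 𝒩.Elem} (h : N < M) {X : 𝒩.alg}
    (hX : ∀ L, N < L → L < M → IsCompactOperator (compress L M X)) : ePlus N X = 0 := by
  refine le_antisymm ?_ (ePlus_mem_Icc N X).1
  rw [ePlus, if_neg (ne_one_of_lt h)]
  refine (ciInf_le (bddBelow_range_of_nonneg (f := fun M : {M : 𝒩.Elem // N < M} =>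
    ⨆ L : {L : 𝒩.Elem // N < L ∧ L < M.1}, essNorm (compress L.1 M.1 X))
    fun _ => Real.iSup_nonneg fun _ => essNorm_nonneg _) ⟨M, h⟩).trans ?_
  exact Real.iSup_le (fun L => (essNorm_eq_zero_of_isCompactOperator (hX L.1 L.2.1 L.2.2)).le)
    le_rfl

theorem eMinus_eq_zero {L N : 𝒩.Elem} (h : L < N) {X : 𝒩.alg}
    (hX : ∀ s, L < s → s < N → IsCompactOperator (compress L s X)) : eMinus N X = 0 := by
  refine le_antisymm ?_ (eMinus_mem_Icc N X).1
  rw [eMinus, if_neg (ne_zero_of_lt h)]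
  refine (ciInf_le (bddBelow_range_of_nonneg (f := fun M : {M : 𝒩.Elem // M < N} =>
    ⨆ L : {L : 𝒩.Elem // M.1 < L ∧ L < N}, essNorm (compress M.1 L.1 X))
    fun _ => Real.iSup_nonneg fun _ => essNorm_nonneg _) ⟨L, h⟩).trans ?_
  exact Real.iSup_le (fun s => (essNorm_eq_zero_of_isCompactOperator (hX s.1 s.2.1 s.2.2)).le)
    le_rfl

theorem exists_of_iPlus_lt {N : 𝒩.Elem} (hN : N ≠ 𝒩.one) {X : 𝒩.alg} {r : ℝ}
    (h : iPlus N X < r) : ∃ M, N < M ∧ ‖compress N M X‖ < r := by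
  have : Nonempty {M : 𝒩.Elem // N < M} := ⟨⟨𝒩.one, lt_one hN⟩⟩
  rw [iPlus, if_neg hN] at h
  obtain ⟨M, hM⟩ := exists_lt_of_ciInf_lt h
  exact ⟨M.1, M.2, hM⟩

theorem exists_of_iMinus_lt {N : 𝒩.Elem} (hN : N ≠ 𝒩.zero) {X : 𝒩.alg} {r : ℝ}
    (h : iMinus N X < r) : ∃ L, L < N ∧ ‖compress L N X‖ < r := by
  have : Nonempty {M : 𝒩.Elem // M < N} := ⟨⟨𝒩.zero, zero_lt hN⟩⟩
  rw [iMinus, if_neg hN] at h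
  obtain ⟨M, hM⟩ := exists_lt_of_ciInf_lt h
  exact ⟨M.1, M.2, hM⟩

theorem exists_of_ePlus_lt {N : 𝒩.Elem} (hN : N ≠ 𝒩.one) {X : 𝒩.alg} {r : ℝ}
    (h : ePlus N X < r) :
    ∃ M, N < M ∧ ∀ L, N < L → L < M → essNorm (compress L M X) < r := by
  have : Nonempty {M : 𝒩.Elem // N < M} := ⟨⟨𝒩.one, lt_one hN⟩⟩
  rw [ePlus, if_neg hN] at h
  obtain ⟨M, hM⟩ := exists_lt_of_ciInf_lt h
  exact ⟨M.1, M.2, fun L h1 h2 => (le_ciSup (ePlus_bdd N M.1 X) ⟨L, h1, h2⟩).trans_lt hM⟩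

theorem exists_of_eMinus_lt {N : 𝒩.Elem} (hN : N ≠ 𝒩.zero) {X : 𝒩.alg} {r : ℝ}
    (h : eMinus N X < r) :
    ∃ L, L < N ∧ ∀ s, L < s → s < N → essNorm (compress L s X) < r := by
  have : Nonempty {M : 𝒩.Elem // M < N} := ⟨⟨𝒩.zero, zero_lt hN⟩⟩
  rw [eMinus, if_neg hN] at h
  obtain ⟨M, hM⟩ := exists_lt_of_ciInf_lt h
  exact ⟨M.1, M.2, fun L h1 h2 => (le_ciSup (eMinus_bdd N M.1 X) ⟨L, h1, h2⟩).trans_lt hM⟩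

/-! ### Distance to the operators with vanishing seminorms -/

/-- The essential norm of `X` is smaller than `r` on a neighbourhood of `N`. -/
def LocallyEssLT (X : 𝒩.alg) (r : ℝ) (N : 𝒩.Elem) : Prop :=
  ∃ L M, L < N ∧ N < M ∧ essNorm (compress L M X) < r

theorem locallyEssLT_of_right {X : 𝒩.alg} {r : ℝ} {a N M : 𝒩.Elem}
    (h : ∀ L, a < L → L < M → essNorm (compress L M X) < r) (h1 : a < N) (h2 : N < M) :
    LocallyEssLT X r N := by
  obtain ⟨L, hL1, hL2⟩ := exists_between_of_lt h1
  exact ⟨L, M, hL2, h2, h L hL1 (hL2.trans h2)⟩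

theorem locallyEssLT_of_left {X : 𝒩.alg} {r : ℝ} {L N b : 𝒩.Elem}
    (h : ∀ s, L < s → s < b → essNorm (compress L s X) < r) (h1 : L < N) (h2 : N < b) :
    LocallyEssLT X r N := by
  obtain ⟨s, hs1, hs2⟩ := exists_between_of_lt h2
  exact ⟨L, s, h1, hs1, h s (h1.trans hs1) hs2⟩

/-- On an interval where `1 - D` and `1 - D'` are compact, `X` agrees with `D * X * D'` up to a
compact operator. -/
theorem isCompactOperator_compress_sub {c d : 𝒩.Elem} (hcd : c ≤ d) {X Z : 𝒩.alg}
    {D D' : H →L[ℂ] H} (hD : D ∈ 𝒩.alg) (hD' : D' ∈ 𝒩.alg)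
    (hZ : (proj d - proj c) * (Z : H →L[ℂ] H) * (proj d - proj c) =
      (proj d - proj c) * (D * X * D') * (proj d - proj c))
    (hDc : IsCompactOperator ((proj d - proj c) * (1 - D) * (proj d - proj c) : H →L[ℂ] H))
    (hDc' : IsCompactOperator ((proj d - proj c) * (1 - D') * (proj d - proj c) : H →L[ℂ] H)) :
    IsCompactOperator (compress c d (X - Z)) := by
  have hDX : D * X ∈ 𝒩.alg := 𝒩.alg.mul_mem hD X.2
  have e1 : compress c d (X - Z) = (proj d - proj c) * (X : H →L[ℂ] H) * (proj d - proj c) -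
      (proj d - proj c) * (Z : H →L[ℂ] H) * (proj d - proj c) := by
    change (proj d - proj c) * ((X : H →L[ℂ] H) - Z) * (proj d - proj c) = _
    noncomm_ring
  have e2 : compress c d (X - Z) =
      (proj d - proj c) * ((1 - D) * X) * (proj d - proj c) +
      (proj d - proj c) * ((D * X) * (1 - D')) * (proj d - proj c) := by
    rw [e1, hZ]
    noncomm_ring
  rw [e2, interval_compress_mul hcd (𝒩.alg.sub_mem 𝒩.alg.one_mem hD) X.2,
    interval_compress_mul hcd hDX (𝒩.alg.sub_mem 𝒩.alg.one_mem hD')]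
  have k1 := hDc.comp_clm ((proj d - proj c) * (X : H →L[ℂ] H) * (proj d - proj c))
  have k2 := hDc'.clm_comp ((proj d - proj c) * (D * (X : H →L[ℂ] H)) * (proj d - proj c))
  exact k1.add k2

/-- Every `X` is within about `r` of some `Y` in the nest algebra that is compact wherever the
corresponding seminorm of `X` is smaller than `r`. -/
theorem exists_locally_compact [TopologicalSpace.SeparableSpace H] (X : 𝒩.alg) {r ε : ℝ}
    (hr : 0 < r) (hε : 0 < ε) :
    ∃ Y : 𝒩.alg, ‖X - Y‖ ≤ r + ε ∧
      (∀ N, LocallyEssLT X r N → ∃ L M, L < N ∧ N < M ∧ IsCompactOperator (compress L M Y)) ∧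
      (∀ N, N ≠ 𝒩.one → iPlus N X < r → ∃ M, N < M ∧ IsCompactOperator (compress N M Y)) ∧
      (∀ N, N ≠ 𝒩.zero → iMinus N X < r → ∃ L, L < N ∧ IsCompactOperator (compress L N Y)) ∧
      (∀ N, N ≠ 𝒩.one → ePlus N X < r →
        ∃ M, N < M ∧ ∀ L, N < L → L < M → IsCompactOperator (compress L M Y)) ∧
      (∀ N, N ≠ 𝒩.zero → eMinus N X < r →
        ∃ L, L < N ∧ ∀ s, L < s → s < N → IsCompactOperator (compress L s Y)) := by
  -- the points next to which only the essential norm of `X` is small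
  set A : Set 𝒩.Elem :=
    {a | a ≠ 𝒩.one ∧ ¬ LocallyEssLT X r a ∧ ePlus a X < r ∧ r ≤ iPlus a X} with hA
  set B : Set 𝒩.Elem :=
    {b | b ≠ 𝒩.zero ∧ ¬ LocallyEssLT X r b ∧ eMinus b X < r ∧ r ≤ iMinus b X} with hB
  choose M haM hMess using fun a : A => exists_of_ePlus_lt a.2.1 a.2.2.2.1
  choose L hLb hLess using fun b : B => exists_of_eMinus_lt b.2.1 b.2.2.2.1
  -- `e` is so small that `ρ + e ≤ r + ε` for the bound `ρ` on the corrected operator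
  set e : ℝ := min 1 (ε / (3 * r + 3)) with he
  have he0 : 0 < e := lt_min one_pos (by positivity)
  have he1 : e ≤ 1 := min_le_left _ _
  have he2 : e * (3 * r + 3) ≤ ε := by
    rw [← le_div_iff₀ (by positivity)]; exact min_le_right _ _
  obtain ⟨D, hD, hDn, hDc, hDA⟩ := exists_right_correction X.2 hr.le he0 A M haM
    (fun a a' h => by
      by_contra! hcon
      exact a'.2.2.1 (locallyEssLT_of_right (hMess a) h hcon)) hMess
  obtain ⟨D', hD', hD'n, hD'c, hD'B⟩ := exists_left_correction X.2 hr.le he0 B L hLb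
    (fun b b' h => by
      by_contra! hcon
      exact b.2.2.1 (locallyEssLT_of_left (hLess b') hcon h)) hLess
  set X' : H →L[ℂ] H := D * X * D' with hX'
  have hDX : D * X ∈ 𝒩.alg := 𝒩.alg.mul_mem hD X.2
  have hXD' : (X : H →L[ℂ] H) * D' ∈ 𝒩.alg := 𝒩.alg.mul_mem X.2 hD'
  have hX'alg : X' ∈ 𝒩.alg := 𝒩.alg.mul_mem hDX hD'
  set ρ : ℝ := ((1 + e) * r + e) * (1 + e) with hρ
  have hρ0 : 0 ≤ ρ := by positivity
  obtain ⟨Z, hZ, hZX⟩ := exists_interpolant 𝒩 X' hρ0 (show ρ < ρ + e by linarith)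
  have hZX' : ∀ c d : 𝒩.Elem, c ≤ d → ‖(proj d - proj c) * X' * (proj d - proj c)‖ ≤ ρ →
      (1 - proj c) * Z * proj d = (1 - proj c) * X' * proj d := fun c d hcd h =>
    hZX c d (by rwa [one_sub_mul_mul_proj hcd hX'alg])
  have hZalg : Z ∈ 𝒩.alg := mem_alg_iff_one_sub.2 fun N => by
    rw [hZX' N N le_rfl (by simpa using hρ0)]
    exact mem_alg_iff_one_sub.1 hX'alg N
  obtain ⟨Y, hY⟩ : ∃ Y, Y = X - ⟨Z, hZalg⟩ := ⟨_, rfl⟩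
  have hXY : ‖X - Y‖ ≤ r + ε := by
    rw [hY, sub_sub_cancel]
    have h1 : e * e ≤ e := mul_le_of_le_one_left he0.le he1
    have h2 : e * e * r ≤ e * r := mul_le_mul_of_nonneg_right h1 hr.le
    refine hZ.trans ?_
    linear_combination h1 + h2 + he2
  -- where `X'` is small, `X - Z` agrees with `X - X'`, which is compact on intervals that meet
  -- neither `A` nor `B`, except that the right end may lie in `A` and the left end in `B`
  have key : ∀ c d : 𝒩.Elem, c ≤ d → ‖(proj d - proj c) * X' * (proj d - proj c)‖ ≤ ρ →
      (∀ a ∈ A, c ≤ a → ¬ a < d) → (∀ b ∈ B, c < b → ¬ b ≤ d) →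
      IsCompactOperator (compress c d Y) := by
    intro c d hcd hn hAcd hBcd
    rw [hY]
    refine isCompactOperator_compress_sub hcd hD hD' ?_ (hDc c d hcd hAcd) (hD'c c d hcd hBcd)
    rw [← one_sub_mul_mul_proj hcd hZalg, hZX' c d hcd hn, one_sub_mul_mul_proj hcd hX'alg]
  have hsmall : ∀ c d : 𝒩.Elem, c ≤ d → ‖compress c d X‖ < r →
      ‖(proj d - proj c) * X' * (proj d - proj c)‖ ≤ ρ := by
    intro c d hcd h
    rw [hX', interval_compress_mul hcd hDX hD', interval_compress_mul hcd hD X.2]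
    have h1 := (norm_interval_mul_mul_le hcd D).trans hDn
    have h2 := (norm_interval_mul_mul_le hcd D').trans hD'n
    calc _ ≤ ‖(proj d - proj c) * D * (proj d - proj c)‖ * ‖compress c d X‖ *
          ‖(proj d - proj c) * D' * (proj d - proj c)‖ :=
          (norm_mul_le _ _).trans (by gcongr; exact norm_mul_le _ _)
      _ ≤ ((1 + e) * r) * (1 + e) := by gcongr
      _ ≤ ρ := by rw [hρ]; gcongr; linarith
  have hA' : ∀ a : A, ‖(proj (M a) - proj a.1) * X' * (proj (M a) - proj a.1)‖ ≤ ρ := by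
    intro a
    rw [hX', interval_compress_mul (haM a).le hDX hD']
    refine (norm_mul_le _ _).trans ?_
    have h2 := (norm_interval_mul_mul_le (haM a).le D').trans hD'n
    exact mul_le_mul (hDA a) h2 (norm_nonneg _) (by positivity)
  have hB' : ∀ b : B, ‖(proj b.1 - proj (L b)) * X' * (proj b.1 - proj (L b))‖ ≤ ρ := by
    intro b
    rw [hX', mul_assoc D, interval_compress_mul (hLb b).le hD hXD', hρ, mul_comm _ (1 + e)]
    refine (norm_mul_le _ _).trans ?_
    have h2 := (norm_interval_mul_mul_le (hLb b).le D).trans hDn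
    exact mul_le_mul h2 (hD'B b) (norm_nonneg _) (by positivity)
  have c1 : ∀ N, LocallyEssLT X r N →
      ∃ L M, L < N ∧ N < M ∧ IsCompactOperator (compress L M Y) := by
    rintro N ⟨L₀, M₀, h1, h2, h3⟩
    obtain ⟨L', M', k1, k2, k3, k4, k5⟩ := exists_norm_compress_lt h1 h2 h3
    have hU : ∀ s, L' ≤ s → s ≤ M' → LocallyEssLT X r s := fun s hs1 hs2 =>
      ⟨L₀, M₀, k1.trans_le hs1, hs2.trans_lt k4, h3⟩
    exact ⟨L', M', k2, k3, key L' M' (k2.trans k3).le (hsmall _ _ (k2.trans k3).le k5)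
      (fun a ha h h' => ha.2.1 (hU a h h'.le)) (fun b hb h h' => hb.2.1 (hU b h.le h'))⟩
  have c2 : ∀ N, N ≠ 𝒩.one → iPlus N X < r →
      ∃ M, N < M ∧ IsCompactOperator (compress N M Y) := by
    intro N hN hi
    obtain ⟨M₀, h1, h2⟩ := exists_of_iPlus_lt hN hi
    obtain ⟨M', h3, h4⟩ := exists_between_of_lt h1
    have hU : ∀ s, N < s → s ≤ M' → LocallyEssLT X r s := fun s hs1 hs2 =>
      ⟨N, M₀, hs1, hs2.trans_lt h4, (essNorm_le _).trans_lt h2⟩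
    refine ⟨M', h3, key N M' h3.le (hsmall _ _ h3.le ?_) (fun a ha h h' => ?_)
      (fun b hb h h' => hb.2.1 (hU b h h'))⟩
    · exact (norm_compress_mono le_rfl h3.le h4.le X).trans_lt h2
    · rcases h.eq_or_lt with rfl | h
      · exact absurd hi (not_lt_of_ge ha.2.2.2)
      · exact ha.2.1 (hU a h h'.le)
  have c3 : ∀ N, N ≠ 𝒩.zero → iMinus N X < r →
      ∃ L, L < N ∧ IsCompactOperator (compress L N Y) := by
    intro N hN hi
    obtain ⟨L₀, h1, h2⟩ := exists_of_iMinus_lt hN hi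
    obtain ⟨L', h3, h4⟩ := exists_between_of_lt h1
    have hU : ∀ s, L' ≤ s → s < N → LocallyEssLT X r s := fun s hs1 hs2 =>
      ⟨L₀, N, h3.trans_le hs1, hs2, (essNorm_le _).trans_lt h2⟩
    refine ⟨L', h4, key L' N h4.le (hsmall _ _ h4.le ?_)
      (fun a ha h h' => ha.2.1 (hU a h h')) (fun b hb h h' => ?_)⟩
    · exact (norm_compress_mono h3.le h4.le le_rfl X).trans_lt h2
    · rcases h'.eq_or_lt with rfl | h'
      · exact absurd hi (not_lt_of_ge hb.2.2.2)
      · exact hb.2.1 (hU b h.le h')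
  refine ⟨Y, ?_, c1, c2, c3, ?_, ?_⟩
  · exact hXY
  · intro N hN hi
    by_cases hU : LocallyEssLT X r N
    · obtain ⟨L', M', h1, h2, h3⟩ := c1 N hU
      exact ⟨M', h2, fun s h4 h5 => compress_compact_mono (h1.trans h4).le h5.le le_rfl h3⟩
    · by_cases hi' : iPlus N X < r
      · obtain ⟨M', h2, h3⟩ := c2 N hN hi'
        exact ⟨M', h2, fun s h4 h5 => compress_compact_mono h4.le h5.le le_rfl h3⟩
      · obtain ⟨a, rfl⟩ : ∃ a : A, a.1 = N := ⟨⟨N, hN, hU, hi, not_lt.1 hi'⟩, rfl⟩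
        obtain ⟨M', h3, h4⟩ := exists_between_of_lt (haM a)
        refine ⟨M', h3, fun s h5 h6 => ?_⟩
        have hUs : ∀ t, s ≤ t → t ≤ M' → LocallyEssLT X r t := fun t ht1 ht2 =>
          locallyEssLT_of_right (hMess a) (h5.trans_le ht1) (ht2.trans_lt h4)
        exact key s M' h6.le ((norm_interval_mono h5.le h6.le h4.le X').trans (hA' a))
          (fun a' ha h h' => ha.2.1 (hUs a' h h'.le)) (fun b hb h h' => hb.2.1 (hUs b h.le h'))
  · intro N hN hi
    by_cases hU : LocallyEssLT X r N
    · obtain ⟨L', M', h1, h2, h3⟩ := c1 N hU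
      exact ⟨L', h1, fun s h4 h5 => compress_compact_mono le_rfl h4.le (h5.trans h2).le h3⟩
    · by_cases hi' : iMinus N X < r
      · obtain ⟨L', h2, h3⟩ := c3 N hN hi'
        exact ⟨L', h2, fun s h4 h5 => compress_compact_mono le_rfl h4.le h5.le h3⟩
      · obtain ⟨b, rfl⟩ : ∃ b : B, b.1 = N := ⟨⟨N, hN, hU, hi, not_lt.1 hi'⟩, rfl⟩
        obtain ⟨L', h3, h4⟩ := exists_between_of_lt (hLb b)
        refine ⟨L', h4, fun s h5 h6 => ?_⟩
        have hUs : ∀ t, L' ≤ t → t ≤ s → LocallyEssLT X r t := fun t ht1 ht2 =>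
          locallyEssLT_of_left (hLess b) (h3.trans_le ht1) (ht2.trans_lt h6)
        exact key L' s h5.le ((norm_interval_mono h3.le h5.le h6.le X').trans (hB' b))
          (fun a ha h h' => ha.2.1 (hUs a h h'.le)) (fun b' hb h h' => hb.2.1 (hUs b' h.le h'))

/-- Every `X` is within about `r` of some `Y` on which all elementary seminorms vanish that are
smaller than `r` on `X`. -/
theorem exists_elementarySeminorms_eq_zero [TopologicalSpace.SeparableSpace H] (X : 𝒩.alg)
    {r ε : ℝ} (hr : 0 < r) (hε : 0 < ε) :
    ∃ Y : 𝒩.alg, ‖X - Y‖ ≤ r + ε ∧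
      ∀ N, ∀ p ∈ elementarySeminorms N, p X < r → p Y = 0 := by
  obtain ⟨Y, hXY, hloc, hiP, hiM, heP, heM⟩ := exists_locally_compact X hr hε
  refine ⟨Y, hXY, fun N => ?_⟩
  have hip : iPlus N X < r → iPlus N Y = 0 := fun h => by
    by_cases hN : N = 𝒩.one
    · rw [iPlus, if_pos hN]
    · obtain ⟨M, h1, h2⟩ := hiP N hN h
      exact iPlus_eq_zero h1 h2
  have him : iMinus N X < r → iMinus N Y = 0 := fun h => by
    by_cases hN : N = 𝒩.zero
    · rw [iMinus, if_pos hN]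
    · obtain ⟨L, h1, h2⟩ := hiM N hN h
      exact iMinus_eq_zero h1 h2
  have hep : ePlus N X < r → ePlus N Y = 0 := fun h => by
    by_cases hN : N = 𝒩.one
    · rw [ePlus, if_pos hN]
    · obtain ⟨M, h1, h2⟩ := heP N hN h
      exact ePlus_eq_zero h1 h2
  have hem : eMinus N X < r → eMinus N Y = 0 := fun h => by
    by_cases hN : N = 𝒩.zero
    · rw [eMinus, if_pos hN]
    · obtain ⟨L, h1, h2⟩ := heM N hN h
      exact eMinus_eq_zero h1 h2
  have hj : jBoth N X < r → jBoth N Y = 0 := fun h => by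
    by_cases h0 : N = 𝒩.zero
    · rw [jBoth, if_pos h0] at h ⊢; exact hip h
    by_cases h1 : N = 𝒩.one
    · rw [jBoth, if_neg h0, if_pos h1] at h ⊢; exact him h
    have : Nonempty {M : 𝒩.Elem // M < N} := ⟨⟨𝒩.zero, zero_lt h0⟩⟩
    have : Nonempty {M : 𝒩.Elem // N < M} := ⟨⟨𝒩.one, lt_one h1⟩⟩
    rw [jBoth, if_neg h0, if_neg h1] at h
    obtain ⟨q, hq⟩ := exists_lt_of_ciInf_lt h
    obtain ⟨L, M, k1, k2, k3⟩ :=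
      hloc N ⟨q.1.1, q.2.1, q.1.2, q.2.2, (essNorm_le _).trans_lt hq⟩
    exact jBoth_eq_zero k1 k2 k3
  have hsup : ∀ {p q : 𝒩.alg → ℝ}, (p X < r → p Y = 0) → (q X < r → q Y = 0) →
      ((p ⊔ q) X < r → (p ⊔ q) Y = 0) := fun hp hq h => by
    rw [Pi.sup_apply, sup_lt_iff] at h
    rw [Pi.sup_apply, hp h.1, hq h.2, sup_idem]
  rintro p (rfl | rfl | rfl | rfl | rfl | rfl | rfl | rfl | rfl | rfl)
  · exact fun _ => rfl
  · exact hep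
  · exact hem
  · exact hip
  · exact him
  · exact hj
  · exact hsup hep hem
  · exact hsup hep him
  · exact hsup hip hem
  · exact hsup hip him

/-! ### The quotient norm -/

theorem norm_compress_le_add {L M : 𝒩.Elem} (h : L ≤ M) (X Y : 𝒩.alg) :
    ‖compress L M X‖ ≤ ‖compress L M Y‖ + ‖X - Y‖ := by
  have e : compress L M X = compress L M Y + compress L M (X - Y) := by
    change _ = (proj M - proj L) * _ * _ + (proj M - proj L) * ((X : H →L[ℂ] H) - Y) * _
    unfold compress
    noncomm_ring
  rw [e]
  exact (norm_add_le _ _).trans (by gcongr; exact norm_compress_le h _)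

theorem essNorm_compress_le_add {L M : 𝒩.Elem} (h : L ≤ M) (X Y : 𝒩.alg) :
    essNorm (compress L M X) ≤ essNorm (compress L M Y) + ‖X - Y‖ := by
  have e : compress L M X = compress L M Y + compress L M (X - Y) := by
    change _ = (proj M - proj L) * _ * _ + (proj M - proj L) * ((X : H →L[ℂ] H) - Y) * _
    unfold compress
    noncomm_ring
  have h2 : essNorm (compress L M Y + compress L M (X - Y)) ≤
      essNorm (compress L M Y) + essNorm (compress L M (X - Y)) := by
    unfold essNorm
    rw [Submodule.Quotient.mk_add]
    exact norm_add_le _ _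
  rw [e]
  exact h2.trans (by gcongr; exact (essNorm_le _).trans (norm_compress_le h _))

theorem ciInf_le_ciInf_add {ι : Type*} [Nonempty ι] {f g : ι → ℝ} {c : ℝ} (hf : ∀ i, 0 ≤ f i)
    (h : ∀ i, f i ≤ g i + c) : ⨅ i, f i ≤ (⨅ i, g i) + c := by
  rw [← sub_le_iff_le_add]
  refine le_ciInf fun i => ?_
  rw [sub_le_iff_le_add]
  exact (ciInf_le (bddBelow_range_of_nonneg hf) i).trans (h i)

/-- The elementary seminorms are Lipschitz with constant one. -/
theorem elementarySeminorm_le_add {N : 𝒩.Elem} {p : 𝒩.alg → ℝ} (hp : p ∈ elementarySeminorms N)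
    (X Y : 𝒩.alg) : p X ≤ p Y + ‖X - Y‖ := by
  have hc := norm_nonneg (X - Y)
  have hip : iPlus N X ≤ iPlus N Y + ‖X - Y‖ := by
    unfold iPlus
    split_ifs with h
    · simp
    · have : Nonempty {M : 𝒩.Elem // N < M} := ⟨⟨𝒩.one, lt_one h⟩⟩
      exact ciInf_le_ciInf_add (fun _ => norm_nonneg _) fun M => norm_compress_le_add M.2.le X Y
  have him : iMinus N X ≤ iMinus N Y + ‖X - Y‖ := by
    unfold iMinus
    split_ifs with h
    · simp
    · have : Nonempty {M : 𝒩.Elem // M < N} := ⟨⟨𝒩.zero, zero_lt h⟩⟩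
      exact ciInf_le_ciInf_add (fun _ => norm_nonneg _) fun M => norm_compress_le_add M.2.le X Y
  have hep : ePlus N X ≤ ePlus N Y + ‖X - Y‖ := by
    unfold ePlus
    split_ifs with h
    · simp
    · have : Nonempty {M : 𝒩.Elem // N < M} := ⟨⟨𝒩.one, lt_one h⟩⟩
      refine ciInf_le_ciInf_add (fun _ => Real.iSup_nonneg fun _ => essNorm_nonneg _) fun M => ?_
      refine Real.iSup_le (fun L => (essNorm_compress_le_add L.2.2.le X Y).trans ?_)
        (add_nonneg (Real.iSup_nonneg fun _ => essNorm_nonneg _) hc)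
      gcongr
      exact le_ciSup (ePlus_bdd N M.1 Y) L
  have hem : eMinus N X ≤ eMinus N Y + ‖X - Y‖ := by
    unfold eMinus
    split_ifs with h
    · simp
    · have : Nonempty {M : 𝒩.Elem // M < N} := ⟨⟨𝒩.zero, zero_lt h⟩⟩
      refine ciInf_le_ciInf_add (fun _ => Real.iSup_nonneg fun _ => essNorm_nonneg _) fun M => ?_
      refine Real.iSup_le (fun L => (essNorm_compress_le_add L.2.1.le X Y).trans ?_)
        (add_nonneg (Real.iSup_nonneg fun _ => essNorm_nonneg _) hc)
      gcongr
      exact le_ciSup (eMinus_bdd N M.1 Y) L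
  have hj : jBoth N X ≤ jBoth N Y + ‖X - Y‖ := by
    unfold jBoth
    split_ifs with h h'
    · exact hip
    · exact him
    · have : Nonempty {M : 𝒩.Elem // M < N} := ⟨⟨𝒩.zero, zero_lt h⟩⟩
      have : Nonempty {M : 𝒩.Elem // N < M} := ⟨⟨𝒩.one, lt_one h'⟩⟩
      exact ciInf_le_ciInf_add (fun _ => norm_nonneg _) fun q =>
        norm_compress_le_add (q.1.2.trans q.2.2).le X Y
  have hsup : ∀ {p q : 𝒩.alg → ℝ}, p X ≤ p Y + ‖X - Y‖ → q X ≤ q Y + ‖X - Y‖ →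
      (p ⊔ q) X ≤ (p ⊔ q) Y + ‖X - Y‖ := fun hp hq => by
    rw [Pi.sup_apply, Pi.sup_apply]
    exact sup_le (hp.trans (by gcongr; exact le_sup_left))
      (hq.trans (by gcongr; exact le_sup_right))
  rcases hp with rfl | rfl | rfl | rfl | rfl | rfl | rfl | rfl | rfl | rfl
  · simp
  · exact hep
  · exact hem
  · exact hip
  · exact him
  · exact hj
  · exact hsup hep hem
  · exact hsup hep him
  · exact hsup hip hem
  · exact hsup hip him

/-- The quotient norm for an ideal that is cut out by a set of diagonal seminorm functions. -/
theorem quotientNorm_eq_iInf_iSup [TopologicalSpace.SeparableSpace H] {I : Ideal 𝒩.alg}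
    {F : Set 𝒩.DiagonalSeminormFunction} (hF : Specifies F I) (X : 𝒩.alg) :
    quotientNorm I X = ⨅ δ : F, ⨆ N : 𝒩.Elem, δ.1.seminorm N X := by
  have hne : Nonempty F := by
    obtain ⟨δ, hδ, -⟩ := (hF 0).1 I.zero_mem 1 one_pos
    exact ⟨⟨δ, hδ⟩⟩
  have : Nonempty 𝒩.Elem := ⟨𝒩.zero⟩
  have hsup0 : ∀ δ : F, 0 ≤ ⨆ N : 𝒩.Elem, δ.1.seminorm N X := fun δ =>
    Real.iSup_nonneg fun N => (δ.1.mem_Icc N X).1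
  have hbdd : ∀ δ : F, BddAbove (Set.range fun N : 𝒩.Elem => δ.1.seminorm N X) := fun δ =>
    ⟨‖X‖, by rintro _ ⟨N, rfl⟩; exact (δ.1.mem_Icc N X).2⟩
  rw [quotientNorm_eq_infDist]
  refine le_antisymm (le_ciInf fun δ => le_of_forall_pos_le_add fun ε hε => ?_) ?_
  · set s := ⨆ N : 𝒩.Elem, δ.1.seminorm N X
    have hs := hsup0 δ
    obtain ⟨Y, hXY, hY⟩ := exists_elementarySeminorms_eq_zero X
      (show 0 < s + ε / 2 by positivity) (half_pos hε)
    have hYI : Y ∈ I := (hF Y).2 fun η hη => ⟨δ.1, δ.2, fun N => by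
      rw [hY N _ (δ.1.elementary N) ((le_ciSup (hbdd δ) N).trans_lt (by linarith))]
      exact hη⟩
    refine (Metric.infDist_le_dist_of_mem (s := (I : Set 𝒩.alg)) hYI).trans ?_
    rw [dist_eq_norm]
    linarith
  · refine (Metric.le_infDist ⟨0, I.zero_mem⟩).2 fun Y hY => ?_
    rw [dist_eq_norm]
    refine le_of_forall_pos_le_add fun ε hε => ?_
    obtain ⟨δ, hδ, hδY⟩ := (hF Y).1 hY ε hε
    refine (ciInf_le (bddBelow_range_of_nonneg hsup0) ⟨δ, hδ⟩).trans (ciSup_le fun N => ?_)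
    have := elementarySeminorm_le_add (δ.elementary N) X Y
    linarith [hδY N]

end ContinuousNest

end NestAlgebra

theorem mainTheorem8 {H : Type*} [NormedAddCommGroup H] [InnerProductSpace ℂ H]
    [CompleteSpace H] [TopologicalSpace.SeparableSpace H]
    (𝒩 : NestAlgebra.ContinuousNest H) (I : Ideal 𝒩.alg)
    (hI : NestAlgebra.ContinuousNest.IsStableIdeal I)
    (hc : ¬ NestAlgebra.ContinuousNest.IdealOfCompactCharacter I)
    (F : Set 𝒩.DiagonalSeminormFunction)
    (hF : NestAlgebra.ContinuousNest.Specifies F I) (X : 𝒩.alg) :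
    NestAlgebra.ContinuousNest.quotientNorm I X =
      ⨅ δ : F, ⨆ N : 𝒩.Elem, δ.1.seminorm N X :=
  NestAlgebra.ContinuousNest.quotientNorm_eq_iInf_iSup hF X
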